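/- **Conventions.** For a field $K$ containing a primitive $n$-th root of unity $\rho_n$ and $a,b\in K^\times$, the symbol algebra of degree $n$ is $(a,b)_{n,K}=K\langle x,y\mid x^n=a,\ y^n=b,\ yx=\rho_n xy\rangle$. Two $K$-algebras are similar ($\sim$) if some nonzero matrix algebras over them are isomorphic; $S^{-1}$ denotes the opposite algebra of $S$; $S_L=L\otimes_F S$. Let $F$ be a field containing a primitive $9$-th root of unity $\rho_9$, put $\rho_3=\rho_9^3$, and let $E/F$ be a Galois extension with group $G=\langle\sigma_1,\sigma_2\rangle\cong\mathbb Z_3\times\mathbb Z_3$. Let $t_1,t_2\in E$ satisfy $t_i^3=f_i\in F^\times$, $\sigma_i(t_i)=t_i$, $\sigma_2(t_1)=\rho_3t_1$, $\sigma_1(t_2)=\rho_3t_2$, so that $E^{\langle\sigma_i\rangle}=F[t_i]$. Given $b_i\in F[t_i]\setminus\{0\}$ and $u\in E$ with $N_{E/F}(u)=1$, an abelian crossed product $(E,G,b_1,b_2,u)$ is an $F$-algebra containing $E$ and elements $z_1,z_2$ such that $z_ie=\sigma_i(e)z_i$ for $e\in E$, $z_i^3=b_i$, $z_2z_1=uz_1z_2$,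 and the monomials $z_1^iz_2^j$ $(0\le i,j\le 2)$ form a basis as a left $E$-vector space. **Theorem.** Let $A=(E,G,b_1,b_2,u)$ be an abelian crossed product, where $b_1=c_0+c_1t_1+c_2t_1^2$ and $b_2=a_0+a_1t_2+a_2t_2^2$ with $a_i,c_i\in F$ and $a_0,c_0\neq 0$ (in the generic case all $a_i,c_i$ are nonzero). Put $B=\left(f_1,\tfrac{-c_0}{a_0}\right)_{3,F}$. Then the abelian crossed product $C=\left(E,G,b_1,\tfrac{-c_0}{a_0}b_2,u\right)$, with standard generators again denoted $z_1,z_2$, exists, and there are a field extension $L/F$ and elements $l,l_1,l_2,l_3\in L^\times$ such that: 1. $[L:F]=2$, or else $L=F$ and $F$ has no quadratic extension; 2. $A_L\sim R\otimes_L D^{-1}\otimes_L (B_L)^{-1}$, where $$R=\left(l_3,\ -\left(\tfrac{f_1f_2l_2}{l_1}\right)^3 l\right)_{9,L},\qquad D=\left(f_1f_2,\ \left(-\tfrac{f_1f_2}{l_1}\right)^3l^{-1}\right)_{9,L};$$ 3. in the generic case, that is, if $A\otimes_F A\otimes_F A$ is not split ($A$ has exponent $9$) and $v=z_1+z_2\in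 C$ satisfies $v^9\notin F$, the elements $l,l_1,l_2$ come from $v^3$: there is $t_3\in L[v^3]\subseteq C_L$ with $t_3^3=l$ and $v^3=l_1t_3+l_2t_3^2$. -/

import Mathlib

open scoped TensorProduct

universe u v w

/-- Two `K`-algebras are similar if suitable nonzero matrix algebras over them are isomorphic. -/
def BrauerSimilar (K : Type u) (A : Type v) (B : Type w) [Field K] [Ring A] [Algebra K A]
    [Ring B] [Algebra K B] : Prop :=
  ∃ n m : ℕ, n ≠ 0 ∧ m ≠ 0 ∧
    Nonempty (Matrix (Fin n) (Fin n) A ≃ₐ[K] Matrix (Fin m) (Fin m) B)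

/-- On central simple algebras this is Mathlib's Brauer equivalence. -/
theorem brauerSimilar_iff_isBrauerEquivalent {K : Type u} [Field K] (A B : CSA.{u, v} K) :
    BrauerSimilar K A B ↔ IsBrauerEquivalent A B := by
  constructor
  · rintro ⟨n, m, hn, hm, h⟩
    exact ⟨n, m, hn, hm, h⟩
  · rintro ⟨n, m, hn, hm, h⟩
    exact ⟨n, m, hn, hm, h⟩

/-- The defining relations `x ^ n = a`, `y ^ n = b`, `y x = ρ x y` of a symbol algebra, with `x`
the generator of index `0` and `y` the generator of index `1`. -/
inductive SymbolRel {K : Type u} [Field K] (n : ℕ) (ρ a b : K) :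
    FreeAlgebra K (Fin 2) → FreeAlgebra K (Fin 2) → Prop
  | x_pow : SymbolRel n ρ a b (FreeAlgebra.ι K 0 ^ n) (algebraMap K _ a)
  | y_pow : SymbolRel n ρ a b (FreeAlgebra.ι K 1 ^ n) (algebraMap K _ b)
  | y_mul_x : SymbolRel n ρ a b (FreeAlgebra.ι K 1 * FreeAlgebra.ι K 0)
      (algebraMap K _ ρ * (FreeAlgebra.ι K 0 * FreeAlgebra.ι K 1))

/-- The symbol algebra `(a, b)_{n, K}` with respect to the `n`-th root of unity `ρ`, that is
`K⟨x, y | x ^ n = a, y ^ n = b, y x = ρ x y⟩`. -/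
def SymbolAlgebra {K : Type u} [Field K] (n : ℕ) (ρ a b : K) : Type u :=
  RingQuot (SymbolRel n ρ a b)

noncomputable instance {K : Type u} [Field K] (n : ℕ) (ρ a b : K) : Ring (SymbolAlgebra n ρ a b) :=
  inferInstanceAs (Ring (RingQuot (SymbolRel n ρ a b)))

noncomputable instance {K : Type u} [Field K] (n : ℕ) (ρ a b : K) :
    Algebra K (SymbolAlgebra n ρ a b) :=
  inferInstanceAs (Algebra K (RingQuot (SymbolRel n ρ a b)))

/-- A presentation of the `F`-algebra `A` as the abelian crossed product
`(E, G, b₁, b₂, u) = ⨁ E z₁ ^ i z₂ ^ j` (`0 ≤ i, j < 3`), where `G = ⟨σ₁, σ₂⟩ ≅ ℤ/3 × ℤ/3` is the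
Galois group of `E / F`. -/
structure AbelianCrossedProduct (F : Type u) (E : Type v) (A : Type w) [Field F] [Field E]
    [Algebra F E] [Ring A] [Algebra F A] (σ₁ σ₂ : E ≃ₐ[F] E) (b₁ b₂ u : E) where
  /-- the embedding of the field `E` -/
  emb : E →ₐ[F] A
  /-- the element inducing `σ₁` -/
  z₁ : A
  /-- the element inducing `σ₂` -/
  z₂ : A
  b₁_ne_zero : b₁ ≠ 0
  b₂_ne_zero : b₂ ≠ 0
  b₁_fixed : σ₁ b₁ = b₁
  b₂_fixed : σ₂ b₂ = b₂
  norm_u : Algebra.norm F u = 1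
  z₁_mul : ∀ e : E, z₁ * emb e = emb (σ₁ e) * z₁
  z₂_mul : ∀ e : E, z₂ * emb e = emb (σ₂ e) * z₂
  z₁_pow : z₁ ^ 3 = emb b₁
  z₂_pow : z₂ ^ 3 = emb b₂
  z₂_mul_z₁ : z₂ * z₁ = emb u * (z₁ * z₂)
  /-- the monomials `z₁ ^ i z₂ ^ j` form a basis of `A` as a left `E`-vector space -/
  basis : Function.Bijective fun c : Fin 3 × Fin 3 → E =>
    ∑ k : Fin 3 × Fin 3, emb (c k) * (z₁ ^ (k.1 : ℕ) * z₂ ^ (k.2 : ℕ))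

/-!
Put `g = f₁ f₂`, `v = z₁ + z₂` and `x = t₁ t₂`, so that `x ^ 3 = g` and `v x = ρ ^ 3 x v`.

In `A ⊗ B` the element `t₁⁻¹ ⊗ x_B`, where `x_B` and `y_B` generate `B`, has cube `1`, and `z₁ ⊗ 1`
and `z₂ ⊗ y_B` commute with it. In the corner where it equals `1` they generate the crossed product
`C`, so `A ⊗ B ∼ C` (`AbelianCrossedProduct.exists_brauerSimilar_tensor_symbolAlgebra`). Central
simple algebras being invertible up to similarity, it remains to find `L`, `l`, `l₁`, `l₂`, `l₃`
with `C_L ⊗ D ∼ R` (`BrauerSimilar.of_tensor_of_baseChange_tensor`).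

Splitting off matrix algebras always works in the same way: an element `X` with `X ^ n = 1` and a
unit `Y` with `Y X = ζ X Y`, where `ζ` is a primitive `n`-th root of unity, make the algebra a
matrix algebra of size `n` over the corner where `X` is `1`
(`exists_algEquiv_matrix_of_root_of_one`). The corner is recognised as a symbol algebra as soon as
it has dimension `81` and contains a ninth root of an element `γ` of `L` with `X ^ 9 - γ`
irreducible (`exists_symbolAlgebra_equiv`). This yields `l₃`.

The choice of `b₁` and `(-c₀ / a₀) b₂`, whose constant terms cancel, gives `v ^ 3` trace zero.
Suppose first that `C` is a division algebra.

* In the generic case `v ^ 3` has degree three over `F`, because `F(v ^ 3)` commutes with `x` and is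
  therefore smaller than `F(v)`; its minimal polynomial is some `X ^ 3 + β X + γ`. Cardano's formula
  provides `l` in a quadratic extension `L` and `m = l₂` such that `v ^ 3 = t + m t ^ 2` with
  `t ^ 3 = l` (`exists_cube_root_of_cubic`). If `p`, `q` generate `D`, the elements `x ⊗ p⁻³` and
  `-g⁻¹ t ⊗ q ^ 3` are commuting cube roots of `1`, and in the common corner the image of
  `θ = x ⊗ 1 + v ⊗ q` satisfies `θ ^ 3 = g + v ^ 3 ⊗ q ^ 3 = -g m t`, thus `θ ^ 9 = -(g m) ^ 3 l`
  (`exists_brauerSimilar_tensor_of_cubic`).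
* If `v ^ 9 = γ` lies in `F`, then `C_L ⊗ (g, γ⁻¹)` has a corner containing a ninth root of `γ`
  (`exists_brauerSimilar_tensor_of_pow_nine`).

If `C` is not a division algebra, then by Wedderburn's theorem on division algebras of degree three
it is similar to a symbol algebra `(a, b)` of degree three, hence to `(a, b ^ 3)` of degree nine
(`exists_brauerSimilar_symbolAlgebra_three`, `brauerSimilar_symbolAlgebra_pow_three`). The third
tensor powers of `B` and `C` being split, so is that of `A` (`brauerSimilar_tensor_three`), and the
generic case does not occur.
-/

/-! ### Similarity of algebras -/

namespace BrauerSimilar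

variable {K : Type*} {A B C A' B' : Type*} [Field K] [Ring A] [Algebra K A] [Ring B] [Algebra K B]
  [Ring C] [Algebra K C] [Ring A'] [Algebra K A'] [Ring B'] [Algebra K B']

theorem of_algEquiv (e : A ≃ₐ[K] B) : BrauerSimilar K A B :=
  ⟨1, 1, one_ne_zero, one_ne_zero, ⟨e.mapMatrix⟩⟩

theorem symm (h : BrauerSimilar K A B) : BrauerSimilar K B A :=
  let ⟨n, m, hn, hm, ⟨e⟩⟩ := h
  ⟨m, n, hm, hn, ⟨e.symm⟩⟩

open Matrix in
theorem trans (hAB : BrauerSimilar K A B) (hBC : BrauerSimilar K B C) : BrauerSimilar K A C := by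
  obtain ⟨n, m, hn, hm, ⟨iso1⟩⟩ := hAB
  obtain ⟨p, q, hp, hq, ⟨iso2⟩⟩ := hBC
  exact ⟨p * n, m * q, by simp_all, by simp_all,
    ⟨reindexAlgEquiv _ _ finProdFinEquiv |>.symm.trans <| compAlgEquiv _ _ _ _|>.symm.trans <|
    iso1.mapMatrix (m := Fin p)|>.trans <| compAlgEquiv _ _ _ _|>.trans <|
    reindexAlgEquiv K B (.prodComm (Fin p) (Fin m))|>.trans <| compAlgEquiv _ _ _ _|>.symm.trans <|
    iso2.mapMatrix.trans <| compAlgEquiv _ _ _ _|>.trans <| reindexAlgEquiv _ _ finProdFinEquiv⟩⟩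

theorem of_matrix {n : ℕ} (hn : n ≠ 0) (e : A ≃ₐ[K] Matrix (Fin n) (Fin n) B) :
    BrauerSimilar K A B :=
  ⟨1, n, one_ne_zero, hn, ⟨e.mapMatrix.trans <| (Matrix.compAlgEquiv _ _ _ _).trans <|
    Matrix.reindexAlgEquiv K B (Equiv.uniqueProd (Fin n) (Fin 1))⟩⟩

theorem tensor (h : BrauerSimilar K A A') (h' : BrauerSimilar K B B') :
    BrauerSimilar K (A ⊗[K] B) (A' ⊗[K] B') := by
  obtain ⟨n, m, hn, hm, ⟨e⟩⟩ := h
  obtain ⟨n', m', hn', hm', ⟨e'⟩⟩ := h'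
  exact ⟨n * n', m * m', mul_ne_zero hn hn', mul_ne_zero hm hm',
    ⟨(Matrix.reindexAlgEquiv K _ finProdFinEquiv).symm.trans <|
      (Matrix.kroneckerTMulAlgEquiv (Fin n) (Fin n') K K A B).symm.trans <|
      (Algebra.TensorProduct.congr e e').trans <|
      (Matrix.kroneckerTMulAlgEquiv (Fin m) (Fin m') K K A' B').trans <|
      Matrix.reindexAlgEquiv K _ finProdFinEquiv⟩⟩

theorem baseChange (L : Type*) [Field L] [Algebra K L] (h : BrauerSimilar K A B) :
    BrauerSimilar L (L ⊗[K] A) (L ⊗[K] B) := by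
  obtain ⟨n, m, hn, hm, ⟨e⟩⟩ := h
  let e₁ : Matrix (Fin 1) (Fin 1) L ≃ₐ[L] L :=
    AlgEquiv.ofLinearEquiv
      { toFun := fun M => M 0 0
        invFun := fun a => Matrix.of fun _ _ => a
        map_add' := fun _ _ => rfl
        map_smul' := fun _ _ => rfl
        left_inv := fun M => by ext i j; simp [Subsingleton.elim i 0, Subsingleton.elim j 0]
        right_inv := fun _ => rfl } rfl
      (fun M N => (Matrix.mul_apply (M := M) (N := N)).trans (Fin.sum_univ_one _))
  exact ⟨1 * n, 1 * m, by simpa using hn, by simpa using hm,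
    ⟨(Matrix.reindexAlgEquiv L _ finProdFinEquiv).symm.trans <|
      (Matrix.kroneckerTMulAlgEquiv (Fin 1) (Fin n) K L L A).symm.trans <|
      (Algebra.TensorProduct.congr e₁ e).trans <|
      (Algebra.TensorProduct.congr e₁.symm AlgEquiv.refl).trans <|
      (Matrix.kroneckerTMulAlgEquiv (Fin 1) (Fin m) K L L B).trans <|
      Matrix.reindexAlgEquiv L _ finProdFinEquiv⟩⟩

end BrauerSimilar

/-! ### Central simple algebras -/

section CentralSimple

open MulOpposite

variable {K : Type*} [Field K]

/-- By the Jacobson density theorem, every `K`-linear endomorphism of a central simple algebra is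
a sum of two-sided multiplications. -/
theorem mulLeftRight_surjective (A : Type*) [Ring A] [Algebra K A] [IsSimpleRing A]
    [Algebra.IsCentral K A] [FiniteDimensional K A] :
    Function.Surjective (AlgHom.mulLeftRight K A) := by
  let S := A ⊗[K] Aᵐᵒᵖ
  let _ : Module S A := Module.compHom A (AlgHom.mulLeftRight K A).toRingHom
  have smul_def (s : S) (a : A) : s • a = AlgHom.mulLeftRight K A s a := rfl
  have : IsSimpleModule S A := by
    have : Nontrivial (Submodule S A) := (Submodule.nontrivial_iff S).2 inferInstance
    refine { eq_bot_or_eq_top := fun N => ?_ }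
    by_cases hN : N = ⊥
    · exact Or.inl hN
    right
    obtain ⟨x, hxN, hx0⟩ := (Submodule.ne_bot_iff N).1 hN
    let I : TwoSidedIdeal A := TwoSidedIdeal.mk' N N.zero_mem (fun h h' => N.add_mem h h')
      (fun h => N.neg_mem h)
      (fun {a b} h => by
        have := N.smul_mem (a ⊗ₜ op 1 : S) h
        rwa [smul_def, AlgHom.mulLeftRight_apply, unop_op, mul_one] at this)
      (fun {a b} h => by
        have := N.smul_mem ((1 : A) ⊗ₜ op b : S) h
        rwa [smul_def, AlgHom.mulLeftRight_apply, unop_op, one_mul] at this)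
    have hI : ∀ y, y ∈ I ↔ y ∈ N := fun y => by
      simp only [I, TwoSidedIdeal.mem_mk', SetLike.mem_coe]
    have h1 : (1 : A) ∈ N :=
      (hI 1).1 (IsSimpleRing.one_mem_of_ne_zero_mem I hx0 ((hI x).2 hxN))
    rw [eq_top_iff]
    intro y _
    have := N.smul_mem (y ⊗ₜ op 1 : S) h1
    rwa [smul_def, AlgHom.mulLeftRight_apply, unop_op, mul_one, mul_one] at this
  have scalar (f : Module.End S A) : ∃ c : K, ∀ a, f a = c • a := by
    have hl (a b : A) : f (a * b) = a * f b := by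
      have := f.map_smul (a ⊗ₜ op 1 : S) b
      simpa [smul_def] using this
    have hr (a b : A) : f (a * b) = f a * b := by
      have := f.map_smul ((1 : A) ⊗ₜ op b : S) a
      simpa [smul_def] using this
    have hc : f 1 ∈ Subalgebra.center K A := by
      rw [Subalgebra.mem_center_iff]
      intro b
      rw [← hl, ← hr, mul_one, one_mul]
    obtain ⟨c, hc⟩ := Algebra.IsCentral.mem_center_iff (K := K) |>.1 hc
    refine ⟨c, fun a => ?_⟩
    rw [← one_mul a, hr, hc, one_mul, Algebra.smul_def]
  intro T
  have : Module.Finite (Module.End S A) A := by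
    obtain ⟨s, hs⟩ := (inferInstance : Module.Finite K A).fg_top
    refine ⟨⟨s, ?_⟩⟩
    rw [eq_top_iff]
    intro a _
    have ha : a ∈ Submodule.span K (s : Set A) := hs ▸ Submodule.mem_top
    refine Submodule.span_induction
      (p := fun a _ => a ∈ Submodule.span (Module.End S A) (s : Set A))
      (fun x hx => Submodule.subset_span hx) (Submodule.zero_mem _)
      (fun x y _ _ hx hy => Submodule.add_mem _ hx hy) (fun c x _ hx => ?_) ha
    let g : Module.End S A :=
      { toFun := fun a => c • a
        map_add' := fun a b => smul_add c a b
        map_smul' := fun s a => by simp [smul_def] }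
    exact Submodule.smul_mem _ g hx
  let T' : Module.End (Module.End S A) A :=
    { toFun := T
      map_add' := T.map_add
      map_smul' := fun f a => by
        obtain ⟨c, hc⟩ := scalar f
        simp only [Module.End.smul_def, hc, map_smul, RingHom.id_apply] }
  obtain ⟨s, hs⟩ := Module.Finite.toModuleEnd_moduleEnd_surjective (R := S) (M := A) T'
  refine ⟨s, LinearMap.ext fun a => ?_⟩
  exact congr($hs a)

theorem mulLeftRight_bijective (A : Type*) [Ring A] [Algebra K A] [IsSimpleRing A]
    [Algebra.IsCentral K A] [FiniteDimensional K A] :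
    Function.Bijective (AlgHom.mulLeftRight K A) := by
  have hs := mulLeftRight_surjective (K := K) A
  have hd : Module.finrank K (A ⊗[K] Aᵐᵒᵖ) = Module.finrank K (Module.End K A) := by
    rw [Module.finrank_tensorProduct, Module.finrank_linearMap,
      (MulOpposite.opLinearEquiv K (M := A)).finrank_eq]
  exact ⟨(LinearMap.injective_iff_surjective_of_finrank_eq_finrank
    (f := (AlgHom.mulLeftRight K A).toLinearMap) hd).2 hs, hs⟩

theorem brauerSimilar_tensor_op (A : Type*) [Ring A] [Algebra K A] [IsSimpleRing A]
    [Algebra.IsCentral K A] [FiniteDimensional K A] : BrauerSimilar K (A ⊗[K] Aᵐᵒᵖ) K := by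
  refine BrauerSimilar.of_matrix (n := Module.finrank K A) Module.finrank_pos.ne' ?_
  exact (AlgEquiv.ofBijective (AlgHom.mulLeftRight K A) (mulLeftRight_bijective A)).trans
    (algEquivMatrix (Module.finBasis K A))

theorem exists_linearForm_eq_one {V : Type*} [AddCommGroup V] [Module K V] {x : V} (hx : x ≠ 0) :
    ∃ f : V →ₗ[K] K, f x = 1 := by
  obtain ⟨g, hg⟩ := LinearMap.exists_leftInverse_of_injective (LinearMap.toSpanSingleton K V x)
    (LinearMap.ker_toSpanSingleton K hx)
  exact ⟨g, by simpa using congr($hg 1)⟩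

section TensorProduct

variable {A B : Type*} [Ring A] [Algebra K A] [Ring B] [Algebra K B]

theorem rTensor_mulLeftRight (a b : A) (x : A ⊗[K] B) :
    LinearMap.rTensor B (AlgHom.mulLeftRight K A (a ⊗ₜ op b)) x =
      (a ⊗ₜ 1) * x * (b ⊗ₜ 1) := by
  induction x with
  | zero => simp
  | tmul x y => simp
  | add x y hx hy => rw [map_add, hx, hy, mul_add, add_mul]

/-- Slicing an element of `A ⊗ B` along a linear form on `A`. -/
noncomputable def tensorSlice (f : A →ₗ[K] K) : A ⊗[K] B →ₗ[K] B :=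
  (TensorProduct.lid K B).toLinearMap ∘ₗ LinearMap.rTensor B f

theorem rTensor_smulRight_one (f : A →ₗ[K] K) (x : A ⊗[K] B) :
    LinearMap.rTensor B (f.smulRight (1 : A)) x = 1 ⊗ₜ tensorSlice f x := by
  induction x with
  | zero => simp
  | tmul x y => simp [tensorSlice, TensorProduct.smul_tmul]
  | add x y hx hy => rw [map_add, hx, hy, map_add, TensorProduct.tmul_add]

theorem exists_tensorSlice_ne_zero {x : A ⊗[K] B} (hx : x ≠ 0) :
    ∃ f : A →ₗ[K] K, tensorSlice f x ≠ 0 := by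
  classical
  by_contra! h
  let b := Module.Basis.ofVectorSpace K A
  refine hx ((TensorProduct.equivFinsuppOfBasisLeft b (N := B)).injective ?_)
  rw [map_zero]
  ext i
  rw [Finsupp.zero_apply, ← h (b.coord i)]
  clear h hx
  induction x with
  | zero => simp
  | tmul x y => simp [tensorSlice]
  | add x y hx hy => rw [map_add, map_add, Finsupp.add_apply, hx, hy]

variable [IsSimpleRing A] [Algebra.IsCentral K A] [FiniteDimensional K A]

instance isSimpleRing_tensorProduct [IsSimpleRing B] : IsSimpleRing (A ⊗[K] B) := by
  refine IsSimpleRing.of_eq_bot_or_eq_top fun I => ?_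
  by_cases hI : I = ⊥
  · exact Or.inl hI
  right
  obtain ⟨x, hxI, hx⟩ : ∃ x ∈ I, x ≠ 0 := by
    by_contra! h
    exact hI (le_bot_iff.1 fun x hx => (TwoSidedIdeal.mem_bot _).2 (h x hx))
  have key (T : Module.End K A) : LinearMap.rTensor B T x ∈ I := by
    obtain ⟨s, rfl⟩ := mulLeftRight_surjective (K := K) A T
    induction s with
    | zero => simp
    | tmul a b =>
      have := rTensor_mulLeftRight a b.unop x
      rw [op_unop] at this
      rw [this]
      exact I.mul_mem_right _ _ (I.mul_mem_left _ _ hxI)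
    | add s t hs ht =>
      rw [map_add, LinearMap.rTensor_add, LinearMap.add_apply]
      exact I.add_mem hs ht
  obtain ⟨f, hf⟩ := exists_tensorSlice_ne_zero hx
  have h1 := key (f.smulRight 1)
  rw [rTensor_smulRight_one] at h1
  let J : TwoSidedIdeal B := I.comap (Algebra.TensorProduct.includeRight : B →ₐ[K] A ⊗[K] B)
  have hJ : (1 : B) ∈ J := IsSimpleRing.one_mem_of_ne_zero_mem J hf
    ((TwoSidedIdeal.mem_comap _).2 h1)
  have : (1 : A ⊗[K] B) ∈ I := (TwoSidedIdeal.mem_comap _).1 hJ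
  exact (TwoSidedIdeal.one_mem_iff I).1 this

/-- The centre of `A ⊗ B`, for `A` central simple, lies in `1 ⊗ B`. -/
theorem exists_eq_one_tmul_of_mem_center {z : A ⊗[K] B} (hz : z ∈ Subalgebra.center K (A ⊗[K] B)) :
    ∃ y ∈ Subalgebra.center K B, z = 1 ⊗ₜ y := by
  have key (T : Module.End K A) : LinearMap.rTensor B T z = (T 1 ⊗ₜ 1) * z := by
    obtain ⟨s, rfl⟩ := mulLeftRight_surjective (K := K) A T
    induction s with
    | zero => simp
    | tmul a b =>
      have := rTensor_mulLeftRight a b.unop z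
      rw [op_unop] at this
      rw [this, mul_assoc, ← Subalgebra.mem_center_iff.1 hz, ← mul_assoc]
      simp
    | add s t hs ht =>
      rw [map_add, LinearMap.rTensor_add, LinearMap.add_apply, hs, ht, LinearMap.add_apply,
        TensorProduct.add_tmul, add_mul]
  obtain ⟨f, hf⟩ := exists_linearForm_eq_one (K := K) (one_ne_zero (α := A))
  have h1 := key (f.smulRight 1)
  rw [rTensor_smulRight_one] at h1
  simp only [LinearMap.smulRight_apply, hf, one_smul,
    ← Algebra.TensorProduct.one_def, one_mul] at h1
  refine ⟨_, ?_, h1.symm⟩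
  rw [Subalgebra.mem_center_iff]
  intro b
  have h2 := Subalgebra.mem_center_iff.1 hz (1 ⊗ₜ b)
  rw [← h1] at h2
  simp only [Algebra.TensorProduct.tmul_mul_tmul, one_mul] at h2
  exact Algebra.TensorProduct.includeRight_injective (R := K) (A := A)
    (FaithfulSMul.algebraMap_injective K A) h2

instance isCentral_tensorProduct [Algebra.IsCentral K B] : Algebra.IsCentral K (A ⊗[K] B) := by
  refine ⟨fun z hz => ?_⟩
  obtain ⟨y, hy, rfl⟩ := exists_eq_one_tmul_of_mem_center hz
  obtain ⟨c, rfl⟩ := Algebra.IsCentral.mem_center_iff (K := K) |>.1 hy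
  exact ⟨c, by simp [Algebra.algebraMap_eq_smul_one, Algebra.TensorProduct.one_def]⟩

variable (L : Type*) [Field L] [Algebra K L]

instance isSimpleRing_baseChange : IsSimpleRing (L ⊗[K] A) :=
  IsSimpleRing.of_ringEquiv (Algebra.TensorProduct.comm K A L).toRingEquiv inferInstance

instance isCentral_baseChange : Algebra.IsCentral L (L ⊗[K] A) := by
  refine ⟨fun z hz => ?_⟩
  have hz' : Algebra.TensorProduct.comm K L A z ∈ Subalgebra.center K (A ⊗[K] L) := by
    rw [Subalgebra.mem_center_iff] at hz ⊢
    intro b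
    apply (Algebra.TensorProduct.comm K L A).symm.injective
    simpa using hz ((Algebra.TensorProduct.comm K L A).symm b)
  obtain ⟨y, -, hy⟩ := exists_eq_one_tmul_of_mem_center hz'
  refine ⟨y, ?_⟩
  apply (Algebra.TensorProduct.comm K L A).injective
  rw [hy]
  simp [Algebra.TensorProduct.algebraMap_apply]

end TensorProduct

end CentralSimple

/-! ### Corners and matrix algebras -/

section Corner

variable {K : Type*} [Field K] {A : Type*} [Ring A] [Algebra K A]

/-- The corner `e A e` of an idempotent `e` as an algebra, with unit `e`. -/
noncomputable instance cornerAlgebra {e : A} (he : IsIdempotentElem e) : Algebra K he.Corner :=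
  RingHom.toAlgebra'
    { toFun := fun c => ⟨c • e, (Subsemigroup.mem_corner_iff he).2
        ⟨by rw [mul_smul_comm, he.eq], by rw [smul_mul_assoc, he.eq]⟩⟩
      map_one' := Subtype.ext (one_smul K e)
      map_mul' := fun c d => Subtype.ext (by
        change (c * d) • e = (c • e) * (d • e)
        rw [smul_mul_smul_comm, he.eq])
      map_zero' := Subtype.ext (zero_smul K e)
      map_add' := fun c d => Subtype.ext (add_smul c d e) }
    (fun c x => Subtype.ext (by
      have := (Subsemigroup.mem_corner_iff he).1 x.2
      change (c • e) * x.1 = x.1 * (c • e)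
      rw [smul_mul_assoc, mul_smul_comm, this.1, this.2]))

/-- A family `p i`, `q i` with `∑ p i * e * q i = 1` and `e * q i * p j * e = δ i j • e`, where `e`
is idempotent, is a system of matrix units; it identifies the algebra with matrices over the
corner of `e`. -/
theorem exists_algEquiv_matrix_corner {ι : Type*} [Fintype ι] [DecidableEq ι] {e : A}
    (he : IsIdempotentElem e) (p q : ι → A) (h1 : ∑ i, p i * e * q i = 1)
    (h2 : ∀ i j, e * q i * (p j * e) = if i = j then e else 0) :
    Nonempty (A ≃ₐ[K] Matrix ι ι he.Corner) := by
  have mem (a : A) (i j : ι) : e * q i * a * (p j * e) ∈ Subsemigroup.corner e :=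
    (Subsemigroup.mem_corner_iff he).2 ⟨by simp only [← mul_assoc, he.eq],
      by simp only [mul_assoc, he.eq]⟩
  have sum_coe (s : ι → he.Corner) : (∑ i, s i).1 = ∑ i, (s i).1 :=
    map_sum (AddMonoidHom.mk' (fun x : he.Corner => x.1) fun _ _ => rfl) s _
  have split (a b : A) (i k : ι) :
      ∑ j, e * q i * a * (p j * e) * (e * q j * b * (p k * e)) = e * q i * (a * b) * (p k * e) := by
    calc ∑ j, e * q i * a * (p j * e) * (e * q j * b * (p k * e))
        = ∑ j, e * q i * a * (p j * e * q j) * (b * (p k * e)) := by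
          refine Finset.sum_congr rfl fun j _ => ?_
          simp only [← mul_assoc]
          rw [mul_assoc _ e e, he.eq]
      _ = _ := by rw [← Finset.sum_mul, ← Finset.mul_sum, h1]; simp only [mul_assoc, one_mul]
  let φ : A →ₐ[K] Matrix ι ι he.Corner :=
    { toFun := fun a => Matrix.of fun i j => ⟨e * q i * a * (p j * e), mem a i j⟩
      map_one' := by
        ext i j
        refine Subtype.ext ?_
        change e * q i * 1 * (p j * e) = ((1 : Matrix ι ι he.Corner) i j).1
        rw [mul_one, h2, Matrix.one_apply]
        split_ifs <;> rfl
      map_mul' := fun a b => by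
        ext i k
        refine Subtype.ext ?_
        rw [Matrix.mul_apply, sum_coe]
        exact (split a b i k).symm
      map_zero' := by
        ext i j
        exact Subtype.ext (by change e * q i * 0 * (p j * e) = 0; simp)
      map_add' := fun a b => by
        ext i j
        exact Subtype.ext (by
          change e * q i * (a + b) * (p j * e) = e * q i * a * (p j * e) + e * q i * b * (p j * e)
          rw [mul_add, add_mul])
      commutes' := fun c => by
        ext i j
        refine Subtype.ext ?_
        rw [Matrix.algebraMap_matrix_apply]
        change e * q i * algebraMap K A c * (p j * e) = _
        rw [← Algebra.commutes, mul_assoc, h2, ← Algebra.smul_def]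
        split_ifs
        · rfl
        · exact smul_zero c }
  refine ⟨AlgEquiv.ofBijective φ ⟨?_, ?_⟩⟩
  · intro a b hab
    have h (a : A) : a = ∑ i, ∑ j, p i * (e * q i * a * (p j * e)) * q j := by
      calc a = (∑ i, p i * e * q i) * a * (∑ j, p j * e * q j) := by rw [h1, one_mul, mul_one]
        _ = _ := by
          rw [Finset.sum_mul, Finset.sum_mul]
          refine Finset.sum_congr rfl fun i _ => ?_
          rw [Finset.mul_sum]
          refine Finset.sum_congr rfl fun j _ => ?_
          simp only [mul_assoc]
    rw [h a, h b]
    refine Finset.sum_congr rfl fun i _ => Finset.sum_congr rfl fun j _ => ?_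
    have : (e * q i * a * (p j * e)) = (e * q i * b * (p j * e)) :=
      congr(($hab i j).1)
    rw [this]
  · intro M
    refine ⟨∑ k, ∑ l, p k * (M k l).1 * q l, ?_⟩
    ext i j
    refine Subtype.ext ?_
    change e * q i * (∑ k, ∑ l, p k * (M k l).1 * q l) * (p j * e) = (M i j).1
    have hM (k l) := (Subsemigroup.mem_corner_iff he).1 (M k l).2
    have (k l : ι) : e * q i * (p k * (M k l).1 * q l) * (p j * e) =
        (if i = k then e else 0) * (M k l).1 * (if l = j then e else 0) := by
      calc _ = e * q i * (p k * (e * ((M k l).1 * e)) * q l) * (p j * e) := by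
            rw [(hM k l).2, (hM k l).1]
        _ = e * q i * (p k * e) * (M k l).1 * (e * q l * (p j * e)) := by simp only [mul_assoc]
        _ = _ := by rw [h2, h2]
    simp only [Finset.mul_sum, Finset.sum_mul, this]
    rw [Finset.sum_eq_single i, Finset.sum_eq_single j]
    · simp [(hM i j).1, (hM i j).2]
    · intro l _ hl; simp [hl]
    · simp
    · intro k _ hk; simp [Ne.symm hk]
    · simp

end Corner

section Descent

variable (K : Type*) [Field K] {A H : Type*} [Ring A] [Algebra K A] [Ring H] [Algebra K H]
  {n : ℕ} [NeZero n]

omit [NeZero n] in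
theorem finrank_of_algEquiv_matrix (φ : A ≃ₐ[K] Matrix (Fin n) (Fin n) H) :
    Module.finrank K A = n ^ 2 * Module.finrank K H := by
  rw [φ.toLinearEquiv.finrank_eq, Module.finrank_matrix, Fintype.card_fin, sq]

theorem finiteDimensional_of_algEquiv_matrix [FiniteDimensional K A]
    (φ : A ≃ₐ[K] Matrix (Fin n) (Fin n) H) : FiniteDimensional K H :=
  have : FiniteDimensional K (Matrix (Fin n) (Fin n) H) := Module.Finite.equiv φ.toLinearEquiv
  Module.Finite.of_surjective
    (Matrix.entryLinearMap K _ (0 : Fin n) (0 : Fin n)) fun f ↦ ⟨fun _ _ ↦ f, rfl⟩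

omit [Algebra K A] [Algebra K H] in
theorem isSimpleRing_of_ringEquiv_matrix [IsSimpleRing A]
    (φ : A ≃+* Matrix (Fin n) (Fin n) H) : IsSimpleRing H :=
  have : IsSimpleRing (Matrix (Fin n) (Fin n) H) := IsSimpleRing.of_ringEquiv φ inferInstance
  ⟨(TwoSidedIdeal.orderIsoMatrix (R := H) (n := Fin n)).isSimpleOrder⟩

theorem isCentral_of_algEquiv_matrix [Algebra.IsCentral K A]
    (φ : A ≃ₐ[K] Matrix (Fin n) (Fin n) H) : Algebra.IsCentral K H := by
  refine ⟨fun z hz => ?_⟩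
  have hz' : Matrix.scalar (Fin n) z ∈ Subalgebra.center K (Matrix (Fin n) (Fin n) H) := by
    rw [Matrix.subalgebraCenter_eq_scalarAlgHom_map]
    exact ⟨z, hz, rfl⟩
  have hz'' : φ.symm (Matrix.scalar (Fin n) z) ∈ Subalgebra.center K A := by
    rw [Subalgebra.mem_center_iff] at hz' ⊢
    intro b
    apply φ.injective
    simpa using hz' (φ b)
  obtain ⟨c, hc⟩ := Algebra.IsCentral.mem_center_iff (K := K) |>.1 hz''
  refine ⟨c, ?_⟩
  have := congr($((AlgEquiv.symm_apply_eq φ).1 hc) 0 0)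
  rw [AlgEquiv.commutes] at this
  simpa [Matrix.algebraMap_matrix_apply] using this.symm

end Descent

section RootOfUnity

variable {K : Type*} [Field K] {A : Type w} [Ring A] [Algebra K A]

theorem sum_primitiveRoot_pow_mul {n : ℕ} {ζ : K} (hζ : IsPrimitiveRoot ζ n) {m : ℕ}
    (hm0 : m ≠ 0) (hm : m < n) : ∑ k ∈ Finset.range n, ζ ^ (k * m) = 0 := by
  have h1 : ζ ^ m ≠ 1 := hζ.pow_ne_one_of_pos_of_lt hm0 hm
  have h2 := mul_geom_sum (ζ ^ m) n
  rw [← pow_mul, mul_comm m n, pow_mul, hζ.pow_eq_one, one_pow, sub_self] at h2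
  simpa [← pow_mul, mul_comm m] using (mul_eq_zero.1 h2).resolve_left (sub_ne_zero.2 h1)

/-- The projection onto the `ζ⁻ᵏ`-eigenspace of `X`, where `X ^ n = 1`. -/
noncomputable def rootProj (n : ℕ) (ζ : K) (X : A) (k : ℕ) : A :=
  (n : K)⁻¹ • ∑ m ∈ Finset.range n, (ζ ^ k • X) ^ m

variable {n : ℕ} [NeZero n] {ζ : K} (hζ : IsPrimitiveRoot ζ n) {X : A} (hX : X ^ n = 1)
include hζ

theorem IsPrimitiveRoot.natCast_ne_zero : (n : K) ≠ 0 := by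
  have := hζ.neZero'
  exact NeZero.ne _

theorem sum_rootProj : ∑ k ∈ Finset.range n, rootProj n ζ X k = 1 := by
  have hn : (n : K) ≠ 0 := hζ.natCast_ne_zero
  simp only [rootProj, ← Finset.smul_sum]
  rw [Finset.sum_comm, Finset.sum_eq_single 0]
  · simp [← Nat.cast_smul_eq_nsmul K, smul_smul, hn]
  · intro m hm hm0
    simp only [smul_pow, ← Finset.sum_smul, ← pow_mul]
    rw [sum_primitiveRoot_pow_mul hζ hm0 (Finset.mem_range.1 hm), zero_smul]
  · intro h
    exact absurd (Finset.mem_range.2 (NeZero.pos n)) h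

include hX

omit [NeZero n] in
theorem smul_mul_rootProj (k : ℕ) : (ζ ^ k • X) * rootProj n ζ X k = rootProj n ζ X k := by
  rw [rootProj, mul_smul_comm]
  congr 1
  have := mul_geom_sum (ζ ^ k • X) n
  rw [smul_pow, hX, ← pow_mul, mul_comm k, pow_mul, hζ.pow_eq_one, one_pow, one_smul, sub_self,
    sub_mul, one_mul, sub_eq_zero] at this
  exact this

theorem rootProj_mul_rootProj_self (k : ℕ) :
    rootProj n ζ X k * rootProj n ζ X k = rootProj n ζ X k := by
  have hn : (n : K) ≠ 0 := hζ.natCast_ne_zero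
  have h (m : ℕ) : (ζ ^ k • X) ^ m * rootProj n ζ X k = rootProj n ζ X k := by
    induction m with
    | zero => simp
    | succ m ih => rw [pow_succ, mul_assoc, smul_mul_rootProj hζ hX, ih]
  conv_lhs => enter [1]; rw [rootProj]
  rw [smul_mul_assoc, Finset.sum_mul, Finset.sum_congr rfl fun m _ => h m, Finset.sum_const,
    Finset.card_range, ← Nat.cast_smul_eq_nsmul K, smul_smul, inv_mul_cancel₀ hn, one_smul]

omit hζ [NeZero n] hX in
theorem commute_rootProj {c : A} (h : Commute c X) (k : ℕ) : Commute c (rootProj n ζ X k) :=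
  (Commute.sum_right _ _ _ fun _ _ => (h.smul_right _).pow_right _).smul_right _

theorem rootProj_mul_rootProj_of_ne {j k : ℕ} (hj : j < n) (hk : k < n) (hjk : j ≠ k) :
    rootProj n ζ X j * rootProj n ζ X k = 0 := by
  have h0 : ζ ≠ 0 := hζ.ne_zero (NeZero.ne n)
  have h1 : X * rootProj n ζ X j = (ζ ^ j)⁻¹ • rootProj n ζ X j := by
    rw [eq_inv_smul_iff₀ (pow_ne_zero _ h0), ← smul_mul_assoc, smul_mul_rootProj hζ hX]
  have h2 : X * rootProj n ζ X k = (ζ ^ k)⁻¹ • rootProj n ζ X k := by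
    rw [eq_inv_smul_iff₀ (pow_ne_zero _ h0), ← smul_mul_assoc, smul_mul_rootProj hζ hX]
  have h3 : X * (rootProj n ζ X j * rootProj n ζ X k) =
      (ζ ^ j)⁻¹ • (rootProj n ζ X j * rootProj n ζ X k) := by
    rw [← mul_assoc, h1, smul_mul_assoc]
  have h4 : X * (rootProj n ζ X j * rootProj n ζ X k) =
      (ζ ^ k)⁻¹ • (rootProj n ζ X j * rootProj n ζ X k) := by
    rw [← mul_assoc, (commute_rootProj (Commute.refl X) j).eq, mul_assoc, h2, mul_smul_comm]
  rw [h3, ← sub_eq_zero, ← sub_smul, smul_eq_zero, sub_eq_zero, inv_inj] at h4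
  exact h4.resolve_left fun h => hjk (hζ.pow_inj hj hk h)

/-- If `X ^ n = 1` and `Y * X = ζ X * Y` with `Y` a unit and `ζ` a primitive `n`-th root of unity,
then conjugation by `Y` permutes the eigenprojections of `X` cyclically. Hence the algebra is a
matrix algebra of size `n` over a corner `H`, to which the centralizer of `X` maps, with `X`
going to `1`. -/
theorem exists_algEquiv_matrix_of_root_of_one (Y : Aˣ) (hYX : Y * X = ζ • (X * Y)) :
    ∃ (H : Type w) (_ : Ring H) (_ : Algebra K H) (_ : A ≃ₐ[K] Matrix (Fin n) (Fin n) H)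
      (π : Subalgebra.centralizer K {X} →ₐ[K] H),
      π ⟨X, Subalgebra.mem_centralizer_iff K |>.2 (by simp)⟩ = 1 := by
  let e := rootProj n ζ X 0
  have he : IsIdempotentElem e := rootProj_mul_rootProj_self hζ hX 0
  have hconj (k : ℕ) : (Y : A) ^ k * e * ((Y⁻¹ : Aˣ) : A) ^ k = rootProj n ζ X k := by
    have h1 (m k : ℕ) : (Y : A) * (ζ ^ k • X) ^ m = (ζ ^ (k + 1) • X) ^ m * Y := by
      induction m with
      | zero => simp
      | succ m ih =>
        rw [pow_succ, ← mul_assoc, ih, mul_assoc, mul_smul_comm, hYX, smul_smul, ← pow_succ,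
          ← smul_mul_assoc, ← mul_assoc, ← pow_succ]
    have h2 (k : ℕ) : (Y : A) * rootProj n ζ X k = rootProj n ζ X (k + 1) * Y := by
      simp only [rootProj, mul_smul_comm, Finset.mul_sum, h1, smul_mul_assoc, Finset.sum_mul]
    induction k with
    | zero => simp [e]
    | succ k ih =>
      rw [pow_succ', pow_succ, show (Y : A) * Y ^ k * e * (((Y⁻¹ : Aˣ) : A) ^ k * ((Y⁻¹ : Aˣ) : A))
        = Y * (Y ^ k * e * ((Y⁻¹ : Aˣ) : A) ^ k) * ((Y⁻¹ : Aˣ) : A) by simp only [mul_assoc],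
        ih, h2,
        mul_assoc, Units.mul_inv, mul_one]
  have hinv (k : ℕ) : ((Y⁻¹ : Aˣ) : A) ^ k * (Y : A) ^ k = 1 := by
    rw [← Units.val_pow_eq_pow_val, ← Units.val_pow_eq_pow_val, ← Units.val_mul, inv_pow,
      inv_mul_cancel, Units.val_one]
  obtain ⟨φ⟩ := exists_algEquiv_matrix_corner (K := K) (ι := Fin n) he
    (fun i => (Y : A) ^ (i : ℕ)) (fun i => ((Y⁻¹ : Aˣ) : A) ^ (i : ℕ))
    (by
      simp only [hconj]
      rw [Finset.sum_fin_eq_sum_range]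
      rw [← sum_rootProj hζ (X := X)]
      exact Finset.sum_congr rfl fun k hk => dif_pos (Finset.mem_range.1 hk))
    (fun i j => by
      have hl (k : ℕ) : e * ((Y⁻¹ : Aˣ) : A) ^ k = ((Y⁻¹ : Aˣ) : A) ^ k * rootProj n ζ X k := by
        rw [← hconj, ← mul_assoc, ← mul_assoc, hinv, one_mul]
      have hr (k : ℕ) : (Y : A) ^ k * e = rootProj n ζ X k * (Y : A) ^ k := by
        rw [← hconj, mul_assoc, hinv, mul_one]
      rw [hl, hr, mul_assoc, ← mul_assoc (rootProj _ _ _ _)]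
      split_ifs with h
      · subst h
        rw [rootProj_mul_rootProj_self hζ hX, ← hr, ← mul_assoc, hinv, one_mul]
      · rw [rootProj_mul_rootProj_of_ne hζ hX i.2 j.2 (fun hij => h (Fin.ext hij)), zero_mul,
          mul_zero])
  have hc (c : Subalgebra.centralizer K {X}) : Commute (c : A) e :=
    commute_rootProj (show (c : A) * X = X * c from
      ((Subalgebra.mem_centralizer_iff K).1 c.2 X rfl).symm) 0
  refine ⟨he.Corner, inferInstance, inferInstance, φ,
    { toFun := fun c => ⟨(c : A) * e, (Subsemigroup.mem_corner_iff he).2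
        ⟨by rw [(hc c).eq, ← mul_assoc, he.eq], by rw [mul_assoc, he.eq]⟩⟩
      map_one' := Subtype.ext (one_mul e)
      map_mul' := fun c d => Subtype.ext (by
        change (c : A) * d * e = c * e * (d * e)
        rw [mul_assoc (c : A) e, ← mul_assoc e, ← (hc d).eq, mul_assoc (d : A), he.eq, mul_assoc])
      map_zero' := Subtype.ext (zero_mul e)
      map_add' := fun c d => Subtype.ext (add_mul (c : A) d e)
      commutes' := fun r => Subtype.ext (Algebra.smul_def r e).symm }, Subtype.ext ?_⟩
  have := smul_mul_rootProj hζ hX 0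
  rwa [pow_zero, one_smul] at this

end RootOfUnity

/-! ### Algebras with a basis of monomials in two skew-commuting units -/

section Monomial

variable {K : Type*} [Field K] {R : Type*} [Ring R] [Algebra K R] {n : ℕ} {ρ : K}

/-- A subspace stable under an operator contains the components, with respect to the eigenvalues
`ρ ^ j`, of each of its elements. -/
theorem mem_of_sum_eigenvectors_mem {V : Type*} [AddCommGroup V] [Module K V]
    [NeZero n] (hρ : IsPrimitiveRoot ρ n)
    (c : V →ₗ[K] V) (a : Fin n → V) (ha : ∀ j, c (a j) = ρ ^ (j : ℕ) • a j)
    (N : Submodule K V) (hN : ∀ x ∈ N, c x ∈ N) (hs : ∑ j, a j ∈ N) (k : Fin n) : a k ∈ N := by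
  have h0 : ρ ≠ 0 := hρ.ne_zero (NeZero.ne n)
  have hn : (n : K) ≠ 0 := hρ.natCast_ne_zero
  have hpow (m : ℕ) (j : Fin n) : (c ^ m) (a j) = (ρ ^ (j : ℕ)) ^ m • a j := by
    induction m with
    | zero => simp
    | succ m ih => rw [pow_succ', Module.End.mul_apply, ih, map_smul, ha, smul_smul, pow_succ]
  have hNpow (m : ℕ) : ∀ x ∈ N, (c ^ m) x ∈ N := by
    induction m with
    | zero => simp
    | succ m ih => exact fun x hx => by rw [pow_succ', Module.End.mul_apply]; exact hN _ (ih x hx)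
  have key : ∑ m ∈ Finset.range n, ((ρ ^ (k : ℕ))⁻¹) ^ m • (c ^ m) (∑ j, a j) = (n : K) • a k := by
    simp only [map_sum, hpow, Finset.smul_sum, smul_smul, ← mul_pow]
    rw [Finset.sum_comm, Finset.sum_eq_single k]
    · rw [inv_mul_cancel₀ (pow_ne_zero _ h0)]
      simp [← Nat.cast_smul_eq_nsmul K]
    · intro j _ hj
      rw [← Finset.sum_smul]
      have h1 : (ρ ^ (k : ℕ))⁻¹ * ρ ^ (j : ℕ) ≠ 1 := by
        rw [Ne, inv_mul_eq_one₀ (pow_ne_zero _ h0)]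
        exact fun h => hj (Fin.ext (hρ.pow_inj j.2 k.2 h.symm))
      have h2 := mul_geom_sum ((ρ ^ (k : ℕ))⁻¹ * ρ ^ (j : ℕ)) n
      rw [mul_pow, inv_pow, ← pow_mul, ← pow_mul, mul_comm _ n, pow_mul, mul_comm _ n, pow_mul,
        hρ.pow_eq_one, one_pow, one_pow, inv_one, mul_one, sub_self] at h2
      rw [(mul_eq_zero.1 h2).resolve_left (sub_ne_zero.2 h1), zero_smul]
    · simp
  have := N.smul_mem (n : K)⁻¹ (key ▸ N.sum_mem fun m _ => N.smul_mem _ (hNpow m _ hs))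
  rwa [smul_smul, inv_mul_cancel₀ hn, one_smul] at this

/-- Conjugation by a unit, as a linear map. -/
noncomputable def conjLin (K : Type*) [Field K] {R : Type*} [Ring R] [Algebra K R] (s : Rˣ) :
    R →ₗ[K] R :=
  LinearMap.mulLeft K (s : R) ∘ₗ LinearMap.mulRight K ((s⁻¹ : Rˣ) : R)

theorem conjLin_apply (s : Rˣ) (x : R) : conjLin K s x = s * (x * ((s⁻¹ : Rˣ) : R)) := rfl

theorem conjLin_eq_smul_iff (s : Rˣ) (x : R) (c : K) :
    conjLin K s x = c • x ↔ s * x = c • (x * s) := by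
  rw [conjLin_apply, ← mul_assoc, Units.mul_inv_eq_iff_eq_mul, smul_mul_assoc]

theorem skew_pow {s x : R} {c : K} (h : s * x = c • (x * s)) (i : ℕ) :
    s * x ^ i = c ^ i • (x ^ i * s) := by
  induction i with
  | zero => simp
  | succ i ih =>
    rw [pow_succ, ← mul_assoc, ih, smul_mul_assoc, mul_assoc, h, mul_smul_comm, smul_smul,
      ← mul_assoc, ← pow_succ]

variable {E : Type*} [Field E] [Algebra K E]

/-- Two units `P`, `Q` of a `K`-algebra containing a field `E`, together with units `s`, `t` that
commute with `E` and separate the monomials `P ^ i * Q ^ j`: conjugation by `s` multiplies `P` by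
`ρ` and fixes `Q`, and conversely for `t`. -/
structure MonomialSystem (n : ℕ) (ρ : K) (emb : E →ₐ[K] R) where
  /-- the first unit -/
  P : Rˣ
  /-- the second unit -/
  Q : Rˣ
  /-- the unit detecting the degree in `P` -/
  s : Rˣ
  /-- the unit detecting the degree in `Q` -/
  t : Rˣ
  s_emb : ∀ e, Commute (s : R) (emb e)
  t_emb : ∀ e, Commute (t : R) (emb e)
  s_P : (s : R) * P = ρ • ((P : R) * s)
  s_Q : Commute (s : R) Q
  t_P : Commute (t : R) P
  t_Q : (t : R) * Q = ρ • ((Q : R) * t)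

namespace MonomialSystem

variable {emb : E →ₐ[K] R} (S : MonomialSystem n ρ emb)

/-- The left `E`-linear combination of the monomials `P ^ i * Q ^ j` with given coefficients. -/
noncomputable def comb (c : Fin n × Fin n → E) : R :=
  ∑ k : Fin n × Fin n, emb (c k) * ((S.P : R) ^ (k.1 : ℕ) * (S.Q : R) ^ (k.2 : ℕ))

theorem conj_s_monomial (e : E) (i j : ℕ) :
    conjLin K S.s (emb e * ((S.P : R) ^ i * (S.Q : R) ^ j)) =
      ρ ^ i • (emb e * ((S.P : R) ^ i * (S.Q : R) ^ j)) := by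
  rw [conjLin_eq_smul_iff, ← mul_assoc, (S.s_emb e).eq, mul_assoc, ← mul_assoc _ _ (_ ^ j),
    skew_pow S.s_P, smul_mul_assoc, mul_assoc _ _ (_ ^ j), (S.s_Q.pow_right j).eq, mul_smul_comm]
  simp only [mul_assoc]

theorem conj_t_monomial (e : E) (i j : ℕ) :
    conjLin K S.t (emb e * ((S.P : R) ^ i * (S.Q : R) ^ j)) =
      ρ ^ j • (emb e * ((S.P : R) ^ i * (S.Q : R) ^ j)) := by
  rw [conjLin_eq_smul_iff, ← mul_assoc, (S.t_emb e).eq, mul_assoc, ← mul_assoc _ _ (_ ^ j),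
    (S.t_P.pow_right i).eq, mul_assoc _ _ (_ ^ j), skew_pow S.t_Q, mul_smul_comm, mul_smul_comm]
  simp only [mul_assoc]

variable [NeZero n] (hρ : IsPrimitiveRoot ρ n)
include hρ

theorem monomial_mem {N : Submodule K R} (hs : ∀ x ∈ N, conjLin K S.s x ∈ N)
    (ht : ∀ x ∈ N, conjLin K S.t x ∈ N) {c : Fin n × Fin n → E} (hc : S.comb c ∈ N)
    (i j : Fin n) : emb (c (i, j)) * ((S.P : R) ^ (i : ℕ) * (S.Q : R) ^ (j : ℕ)) ∈ N := by
  rw [comb, Fintype.sum_prod_type] at hc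
  refine mem_of_sum_eigenvectors_mem hρ (conjLin K S.t)
    (fun j => emb (c (i, j)) * ((S.P : R) ^ (i : ℕ) * (S.Q : R) ^ (j : ℕ)))
    (fun j => S.conj_t_monomial _ _ _) N ht ?_ j
  refine mem_of_sum_eigenvectors_mem hρ (conjLin K S.s)
    (fun i => ∑ j, emb (c (i, j)) * ((S.P : R) ^ (i : ℕ) * (S.Q : R) ^ (j : ℕ))) (fun i => ?_) N hs
    hc i
  simp only [map_sum, S.conj_s_monomial, Finset.smul_sum]

omit [NeZero n] hρ in
theorem isUnit_monomial {e : E} (he : e ≠ 0) (i j : ℕ) :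
    IsUnit (emb e * ((S.P : R) ^ i * (S.Q : R) ^ j)) :=
  ((IsUnit.mk0 e he).map emb).mul ((S.P.isUnit.pow i).mul (S.Q.isUnit.pow j))

theorem comb_injective [Nontrivial R] : Function.Injective S.comb := by
  have h0 (c : Fin n × Fin n → E) (hc : S.comb c = 0) : c = 0 := by
    ext ⟨i, j⟩
    by_contra he
    have := S.monomial_mem hρ (N := ⊥) (by simp) (by simp) ((Submodule.mem_bot K).2 hc) i j
    exact (S.isUnit_monomial he i j).ne_zero ((Submodule.mem_bot K).1 this)
  intro c d hcd
  rw [← sub_eq_zero]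
  refine h0 _ ?_
  simp only [comb, Pi.sub_apply, map_sub, sub_mul, Finset.sum_sub_distrib]
  exact sub_eq_zero.2 hcd

theorem isSimpleRing [Nontrivial R] (hS : Function.Surjective S.comb) : IsSimpleRing R := by
  refine IsSimpleRing.of_eq_bot_or_eq_top fun I => ?_
  by_cases hI : I = ⊥
  · exact Or.inl hI
  right
  obtain ⟨x, hxI, hx⟩ : ∃ x ∈ I, x ≠ 0 := by
    by_contra! h
    exact hI (le_bot_iff.1 fun x hx => (TwoSidedIdeal.mem_bot _).2 (h x hx))
  obtain ⟨c, rfl⟩ := hS x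
  obtain ⟨⟨i, j⟩, hij⟩ : ∃ k, c k ≠ 0 := by
    by_contra! h
    exact hx (by simp [comb, h])
  let N : Submodule K R :=
    { carrier := I
      add_mem' := fun h h' => I.add_mem h h'
      zero_mem' := I.zero_mem
      smul_mem' := fun r x hx => by
        rw [Algebra.smul_def]
        exact I.mul_mem_left _ _ hx }
  have h1 := S.monomial_mem hρ (N := N) (fun x hx => I.mul_mem_left _ _ (I.mul_mem_right _ _ hx))
    (fun x hx => I.mul_mem_left _ _ (I.mul_mem_right _ _ hx)) hxI i j
  obtain ⟨y, hy⟩ := (S.isUnit_monomial hij i j).exists_left_inv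
  have h2 := I.mul_mem_left y _ h1
  rw [hy] at h2
  exact (TwoSidedIdeal.one_mem_iff I).1 h2

/-- An element commuting with `s` and `t` lies in `E`. -/
theorem exists_eq_emb [Nontrivial R] (hS : Function.Surjective S.comb) {z : R}
    (hs : Commute (S.s : R) z) (ht : Commute (S.t : R) z) : ∃ e, z = emb e := by
  obtain ⟨c, rfl⟩ := hS z
  have h1 : S.comb (fun k => algebraMap K E (ρ ^ (k.1 : ℕ)) * c k) = S.comb c := by
    have : conjLin K S.s (S.comb c) = S.comb c := by
      simpa using (conjLin_eq_smul_iff (K := K) S.s (S.comb c) 1).2 (by simpa using hs.eq)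
    rw [← this]
    simp only [comb, map_sum, S.conj_s_monomial, map_mul, AlgHom.commutes, Algebra.smul_def,
      mul_assoc]
  have h2 : S.comb (fun k => algebraMap K E (ρ ^ (k.2 : ℕ)) * c k) = S.comb c := by
    have : conjLin K S.t (S.comb c) = S.comb c := by
      simpa using (conjLin_eq_smul_iff (K := K) S.t (S.comb c) 1).2 (by simpa using ht.eq)
    rw [← this]
    simp only [comb, map_sum, S.conj_t_monomial, map_mul, AlgHom.commutes, Algebra.smul_def,
      mul_assoc]
  have h3 (i : Fin n) (e : E) (hi : i ≠ 0) (h : algebraMap K E (ρ ^ (i : ℕ)) * e = e) : e = 0 := by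
    by_contra he
    rw [mul_eq_right₀ he, map_eq_one_iff _ (algebraMap K E).injective] at h
    exact hρ.pow_ne_one_of_pos_of_lt (fun h => hi (Fin.ext h)) i.2 h
  refine ⟨c (0, 0), ?_⟩
  rw [comb, Finset.sum_eq_single (0, 0)]
  · simp
  · rintro ⟨i, j⟩ - hij
    have : c (i, j) = 0 := by
      by_cases hi : i = 0
      · have hj : j ≠ 0 := fun hj => hij (by rw [hi, hj])
        exact h3 j _ hj (congrFun (S.comb_injective hρ h2) (i, j))
      · exact h3 i _ hi (congrFun (S.comb_injective hρ h1) (i, j))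
    rw [this, map_zero, zero_mul]
  · simp

end MonomialSystem

end Monomial

/-! ### Symbol algebras -/

namespace SymbolAlgebra

variable {K : Type u} [Field K] {n : ℕ} {ρ a b : K}

/-- The quotient map from the free algebra to a symbol algebra. -/
noncomputable def mk (n : ℕ) (ρ a b : K) : FreeAlgebra K (Fin 2) →ₐ[K] SymbolAlgebra n ρ a b :=
  RingQuot.mkAlgHom K (SymbolRel n ρ a b)

theorem mk_surjective : Function.Surjective (mk n ρ a b) :=
  RingQuot.mkAlgHom_surjective K (SymbolRel n ρ a b)

theorem mk_rel {p q : FreeAlgebra K (Fin 2)} (h : SymbolRel n ρ a b p q) :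
    mk n ρ a b p = mk n ρ a b q :=
  RingQuot.mkAlgHom_rel K h

/-- The generator `x` of a symbol algebra. -/
noncomputable def genX (n : ℕ) (ρ a b : K) : SymbolAlgebra n ρ a b :=
  mk n ρ a b (FreeAlgebra.ι K 0)

/-- The generator `y` of a symbol algebra. -/
noncomputable def genY (n : ℕ) (ρ a b : K) : SymbolAlgebra n ρ a b :=
  mk n ρ a b (FreeAlgebra.ι K 1)

theorem genX_pow : genX n ρ a b ^ n = algebraMap K _ a := by
  rw [genX, ← map_pow, mk_rel SymbolRel.x_pow, AlgHom.commutes]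

theorem genY_pow : genY n ρ a b ^ n = algebraMap K _ b := by
  rw [genY, ← map_pow, mk_rel SymbolRel.y_pow, AlgHom.commutes]

theorem genY_mul_genX : genY n ρ a b * genX n ρ a b = ρ • (genX n ρ a b * genY n ρ a b) := by
  rw [genX, genY, ← map_mul, mk_rel SymbolRel.y_mul_x, map_mul, map_mul, AlgHom.commutes,
    Algebra.smul_def]

theorem exists_algHom {R : Type*} [Ring R] [Algebra K R] {x y : R} (hx : x ^ n = algebraMap K R a)
    (hy : y ^ n = algebraMap K R b) (hyx : y * x = ρ • (x * y)) :
    ∃ f : SymbolAlgebra n ρ a b →ₐ[K] R, f (genX n ρ a b) = x ∧ f (genY n ρ a b) = y := by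
  let g : FreeAlgebra K (Fin 2) →ₐ[K] R := FreeAlgebra.lift K ![x, y]
  have hg0 : g (FreeAlgebra.ι K 0) = x := by simp [g]
  have hg1 : g (FreeAlgebra.ι K 1) = y := by simp [g]
  have hg : ∀ ⦃p q : FreeAlgebra K (Fin 2)⦄, SymbolRel n ρ a b p q → g p = g q := by
    rintro _ _ (_ | _ | _)
    · rw [map_pow, hg0, hx, AlgHom.commutes]
    · rw [map_pow, hg1, hy, AlgHom.commutes]
    · rw [map_mul, map_mul, map_mul, hg0, hg1, hyx, AlgHom.commutes, Algebra.smul_def]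
  exact ⟨RingQuot.liftAlgHom K ⟨g, hg⟩,
    (RingQuot.liftAlgHom_mkAlgHom_apply K g hg _).trans hg0,
    (RingQuot.liftAlgHom_mkAlgHom_apply K g hg _).trans hg1⟩

theorem span_monomials [NeZero n] : Submodule.span K (Set.range fun k : Fin n × Fin n =>
    genX n ρ a b ^ (k.1 : ℕ) * genY n ρ a b ^ (k.2 : ℕ)) = ⊤ := by
  set N := Submodule.span K (Set.range fun k : Fin n × Fin n =>
    genX n ρ a b ^ (k.1 : ℕ) * genY n ρ a b ^ (k.2 : ℕ)) with hN
  have mem (i j : ℕ) : genX n ρ a b ^ i * genY n ρ a b ^ j ∈ N := by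
    rw [← Nat.div_add_mod i n, ← Nat.div_add_mod j n, pow_add, pow_add, pow_mul, pow_mul, genX_pow,
      genY_pow, ← map_pow, ← map_pow, mul_assoc, Algebra.left_comm, ← Algebra.smul_def,
      ← Algebra.smul_def]
    exact N.smul_mem _ (N.smul_mem _ (Submodule.subset_span
      ⟨(⟨i % n, Nat.mod_lt _ (NeZero.pos n)⟩, ⟨j % n, Nat.mod_lt _ (NeZero.pos n)⟩), rfl⟩))
  have stable (c : SymbolAlgebra n ρ a b)
      (hc : ∀ i j : ℕ, c * (genX n ρ a b ^ i * genY n ρ a b ^ j) ∈ N) :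
      ∀ m ∈ N, c * m ∈ N := fun m hm => by
    refine Submodule.span_induction (p := fun m _ => c * m ∈ N) ?_ ?_ ?_ ?_ hm
    · rintro _ ⟨k, rfl⟩
      exact hc _ _
    · rw [mul_zero]
      exact N.zero_mem
    · exact fun m m' _ _ h h' => by
        rw [mul_add]
        exact N.add_mem h h'
    · exact fun r m _ h => by
        rw [mul_smul_comm]
        exact N.smul_mem _ h
  have gen (f : FreeAlgebra K (Fin 2)) : ∀ m ∈ N, mk n ρ a b f * m ∈ N := by
    induction f using FreeAlgebra.induction with
    | grade0 r =>
      intro m hm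
      rw [AlgHom.commutes, ← Algebra.smul_def]
      exact N.smul_mem _ hm
    | grade1 i =>
      fin_cases i
      · refine stable (genX n ρ a b) fun i j => ?_
        rw [← mul_assoc, ← pow_succ']
        exact mem _ _
      · refine stable (genY n ρ a b) fun i j => ?_
        rw [← mul_assoc, skew_pow genY_mul_genX, smul_mul_assoc, mul_assoc, ← pow_succ']
        exact N.smul_mem _ (mem _ _)
    | mul f g hf hg =>
      intro m hm
      rw [map_mul, mul_assoc]
      exact hf _ (hg _ hm)
    | add f g hf hg =>
      intro m hm
      rw [map_add, add_mul]
      exact N.add_mem (hf _ hm) (hg _ hm)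
  rw [eq_top_iff]
  intro s _
  obtain ⟨f, hf⟩ := mk_surjective (n := n) (ρ := ρ) (a := a) (b := b) s
  have := gen f 1 (by simpa using mem 0 0)
  rw [mul_one] at this
  exact hf ▸ this

instance finiteDimensional [NeZero n] : FiniteDimensional K (SymbolAlgebra n ρ a b) :=
  ⟨(span_monomials (n := n) (ρ := ρ) (a := a) (b := b)) ▸ Submodule.fg_span (Set.finite_range _)⟩

/-- The symbol algebra acts on functions on the `n`-th roots of unity with values in an algebraic
closure, so it is not zero. -/
theorem nontrivial [NeZero n] (hρ : IsPrimitiveRoot ρ n) : Nontrivial (SymbolAlgebra n ρ a b) := by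
  let Ω := AlgebraicClosure K
  obtain ⟨α, hα⟩ := IsAlgClosed.exists_pow_nat_eq (algebraMap K Ω a) (NeZero.pos n)
  obtain ⟨β, hβ⟩ := IsAlgClosed.exists_pow_nat_eq (algebraMap K Ω b) (NeZero.pos n)
  let μ := {z : K // z ^ n = 1}
  let sh : μ → μ := fun z => ⟨ρ * z, by rw [mul_pow, hρ.pow_eq_one, z.2, one_mul]⟩
  let T : Module.End K (μ → Ω) :=
    { toFun := fun f z => α * algebraMap K Ω z * f z
      map_add' := fun f g => by ext z; simp [mul_add]
      map_smul' := fun c f => by ext z; simp }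
  let S : Module.End K (μ → Ω) :=
    { toFun := fun f z => β * f (sh z)
      map_add' := fun f g => by ext z; simp [mul_add]
      map_smul' := fun c f => by ext z; simp }
  have hT (m : ℕ) (f : μ → Ω) (z : μ) : (T ^ m) f z = (α * algebraMap K Ω z) ^ m * f z := by
    induction m generalizing f with
    | zero => simp
    | succ m ih => rw [pow_succ, Module.End.mul_apply, ih, pow_succ, mul_assoc]; rfl
  have hS (m : ℕ) (f : μ → Ω) (z : μ) : (S ^ m) f z = β ^ m * f (sh^[m] z) := by
    induction m generalizing f with
    | zero => simp
    | succ m ih =>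
      rw [pow_succ, Module.End.mul_apply, ih, pow_succ, mul_assoc, Function.iterate_succ_apply']
      rfl
  have hsh (m : ℕ) (z : μ) : (sh^[m] z : K) = ρ ^ m * z := by
    induction m with
    | zero => simp
    | succ m ih => rw [Function.iterate_succ_apply', pow_succ', mul_assoc, ← ih]
  obtain ⟨f, -, -⟩ := exists_algHom (K := K) (n := n) (ρ := ρ) (a := a) (b := b) (x := T) (y := S)
    (by
      ext f z
      rw [hT, mul_pow, hα, ← map_pow, z.2, map_one, mul_one]
      simp [Algebra.smul_def])
    (by
      ext f z
      rw [hS, hβ, show sh^[n] z = z from Subtype.ext (by rw [hsh, hρ.pow_eq_one, one_mul])]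
      simp [Algebra.smul_def])
    (by
      ext f z
      change β * (α * algebraMap K Ω (ρ * z) * f (sh z)) =
        ρ • (α * algebraMap K Ω z * (β * f (sh z)))
      rw [Algebra.smul_def, map_mul]
      ring)
  have : Nonempty μ := ⟨⟨1, one_pow n⟩⟩
  exact f.toRingHom.domain_nontrivial

variable (n ρ a b) in
/-- The generators of a symbol algebra with nonzero slots form a monomial system over the base
field. -/
noncomputable def monomialSystem [NeZero n] (ha : a ≠ 0) (hb : b ≠ 0) :
    MonomialSystem n ρ (Algebra.ofId K (SymbolAlgebra n ρ a b)) :=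
  have hX : IsUnit (genX n ρ a b) := by
    rw [← isUnit_pow_iff (NeZero.ne n), genX_pow]
    exact (IsUnit.mk0 a ha).map _
  have hY : IsUnit (genY n ρ a b) := by
    rw [← isUnit_pow_iff (NeZero.ne n), genY_pow]
    exact (IsUnit.mk0 b hb).map _
  { P := hX.unit
    Q := hY.unit
    s := hY.unit
    t := hX.unit⁻¹
    s_emb := fun e => (Algebra.commutes e _).symm
    t_emb := fun e => (Algebra.commutes e _).symm
    s_P := genY_mul_genX
    s_Q := Commute.refl _
    t_P := by
      have : Commute (hX.unit⁻¹) hX.unit := (Commute.refl _).inv_left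
      exact this.map (Units.coeHom _)
    t_Q := by
      rw [Units.inv_mul_eq_iff_eq_mul, mul_smul_comm, ← mul_assoc, ← smul_mul_assoc,
        Units.eq_mul_inv_iff_mul_eq]
      exact genY_mul_genX }

theorem comb_surjective [NeZero n] (ha : a ≠ 0) (hb : b ≠ 0) :
    Function.Surjective (monomialSystem n ρ a b ha hb).comb := by
  intro s
  obtain ⟨c, hc⟩ := (Submodule.mem_span_range_iff_exists_fun K).1
    (span_monomials (n := n) (ρ := ρ) (a := a) (b := b) ▸ Submodule.mem_top (x := s))
  refine ⟨c, ?_⟩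
  rw [← hc]
  exact Finset.sum_congr rfl fun k _ => (Algebra.smul_def _ _).symm

section

variable [NeZero n] (hρ : IsPrimitiveRoot ρ n) (ha : a ≠ 0) (hb : b ≠ 0)
include hρ ha hb

theorem isSimpleRing : IsSimpleRing (SymbolAlgebra n ρ a b) :=
  have := nontrivial (a := a) (b := b) hρ
  (monomialSystem n ρ a b ha hb).isSimpleRing hρ
    (comb_surjective ha hb)

theorem isCentral : Algebra.IsCentral K (SymbolAlgebra n ρ a b) := by
  have := nontrivial (a := a) (b := b) hρ
  refine ⟨fun z hz => ?_⟩
  rw [Subalgebra.mem_center_iff] at hz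
  obtain ⟨e, rfl⟩ := (monomialSystem n ρ a b ha hb).exists_eq_emb hρ
    (comb_surjective ha hb) (hz _) (hz _)
  exact ⟨e, rfl⟩

theorem finrank_eq : Module.finrank K (SymbolAlgebra n ρ a b) = n ^ 2 := by
  have := nontrivial (a := a) (b := b) hρ
  let S := monomialSystem n ρ a b ha hb
  let f : (Fin n × Fin n → K) →ₗ[K] SymbolAlgebra n ρ a b :=
    Fintype.linearCombination K fun k : Fin n × Fin n =>
      genX n ρ a b ^ (k.1 : ℕ) * genY n ρ a b ^ (k.2 : ℕ)
  have hf : ⇑f = S.comb := funext fun c => by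
    rw [Fintype.linearCombination_apply]
    exact Finset.sum_congr rfl fun k _ => Algebra.smul_def _ _
  have := (LinearEquiv.ofBijective f (by
    rw [hf]
    exact ⟨S.comb_injective hρ, comb_surjective ha hb⟩)).finrank_eq
  rw [← this, Module.finrank_pi]
  simp [sq]

/-- Elements of an algebra of dimension `n ^ 2` that satisfy the relations of a symbol algebra
identify the algebra with the symbol algebra. -/
theorem nonempty_algEquiv {H : Type*} [Ring H] [Algebra K H] [Nontrivial H]
    (hH : Module.finrank K H = n ^ 2) {x y : H} (hx : x ^ n = algebraMap K H a)
    (hy : y ^ n = algebraMap K H b) (hyx : y * x = ρ • (x * y)) :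
    Nonempty (SymbolAlgebra n ρ a b ≃ₐ[K] H) := by
  have := isSimpleRing hρ ha hb
  obtain ⟨f, -⟩ := exists_algHom hx hy hyx
  have hf : Function.Injective f := f.toRingHom.injective
  have : FiniteDimensional K H := Module.finite_of_finrank_pos (by
    rw [hH]
    exact pow_pos (NeZero.pos n) 2)
  exact ⟨AlgEquiv.ofBijective f ⟨hf, (LinearMap.injective_iff_surjective_of_finrank_eq_finrank
    (f := f.toLinearMap) (by rw [finrank_eq hρ ha hb, hH])).1 hf⟩⟩

end

end SymbolAlgebra

/-! ### Kummer elements in central simple algebras -/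

section Kummer

open MulOpposite Polynomial

variable {K : Type u} [Field K] {H : Type w} [Ring H] [Algebra K H] {n : ℕ} {ρ : K}

theorem isUnit_and_of_mul_eq [FiniteDimensional K H] {a b : H} (h : IsUnit (a * b)) :
    IsUnit a ∧ IsUnit b := by
  have : IsArtinianRing H := IsArtinianRing.of_finite K H
  obtain ⟨u, hu⟩ := h.exists_right_inv
  obtain ⟨w, hw⟩ := h.exists_left_inv
  rw [mul_assoc] at hu
  rw [← mul_assoc] at hw
  exact ⟨IsUnit.of_mul_eq_one _ hu, IsUnit.of_mul_eq_one_right _ hw⟩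

/-- A linear form on an algebra that picks the constant term of the polynomials of degree
less than `n` in `θ`, where `n` is the degree of the minimal polynomial of `θ`. -/
theorem exists_dual_pow (θ : H) (hn : (minpoly K θ).natDegree = n) [NeZero n] :
    ∃ f : H →ₗ[K] K, ∀ m < n, f (θ ^ m) = if m = 0 then 1 else 0 := by
  have hli : LinearIndependent K fun i : Fin n => θ ^ (i : ℕ) := by
    subst hn
    exact linearIndependent_pow θ
  let b := Module.Basis.span hli
  obtain ⟨g, hg⟩ := LinearMap.exists_extend (b.coord 0)
  refine ⟨g, fun m hm => ?_⟩
  have h1 : (b ⟨m, hm⟩ : H) = θ ^ m :=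
    congrArg Subtype.val (Module.Basis.span_apply hli ⟨m, hm⟩)
  rw [← h1]
  have := congr($hg (b ⟨m, hm⟩))
  simp only [LinearMap.comp_apply, Submodule.subtype_apply] at this
  rw [this, Module.Basis.coord_apply, Module.Basis.repr_self, Finsupp.single_apply]
  simp [Fin.ext_iff]

/-- Evaluation at a root in a possibly noncommutative algebra factors through `AdjoinRoot`. -/
theorem exists_adjoinRoot_algHom {f : K[X]} {θ : H} (h : aeval θ f = 0) :
    ∃ emb : AdjoinRoot f →ₐ[K] H, ∀ p, emb (AdjoinRoot.mk f p) = aeval θ p := by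
  refine ⟨Ideal.Quotient.liftₐ (Ideal.span {f}) (aeval θ) fun p hp => ?_, fun p => rfl⟩
  obtain ⟨q, rfl⟩ := Ideal.mem_span_singleton'.1 hp
  rw [map_mul, h, mul_zero]

theorem conjLin_pow_apply (θ : Hˣ) (m : ℕ) (x : H) :
    (conjLin K θ ^ m) x = θ ^ m * (x * ((θ⁻¹ : Hˣ) : H) ^ m) := by
  induction m generalizing x with
  | zero => simp
  | succ m ih =>
    rw [pow_succ, Module.End.mul_apply, ih, conjLin_apply, pow_succ, pow_succ']
    simp only [mul_assoc]

theorem conjLin_pow_eq_one (θ : Hˣ) {γ : K} (hθ : (θ : H) ^ n = algebraMap K H γ) :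
    conjLin K θ ^ n = 1 := by
  ext x
  rw [conjLin_pow_apply, ← mul_assoc, hθ, Algebra.commutes, mul_assoc, ← hθ,
    ← Units.val_pow_eq_pow_val, ← Units.val_pow_eq_pow_val, inv_pow, Units.mul_inv, mul_one,
    Module.End.one_apply]

variable [IsSimpleRing H] [Algebra.IsCentral K H] [FiniteDimensional K H] [NeZero n]
  (hρ : IsPrimitiveRoot ρ n)
include hρ

/-- Every power of `ρ` is an eigenvalue of conjugation by an element `θ` with `θ ^ n ∈ K` whose
minimal polynomial has degree `n`: two-sided multiplications by the powers of `θ` are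
linearly independent, so no eigenprojection vanishes. -/
theorem exists_skew_ne_zero (θ : Hˣ) {γ : K} (hθ : (θ : H) ^ n = algebraMap K H γ)
    (hn : (minpoly K (θ : H)).natDegree = n) (k : ℕ) :
    ∃ s : H, s ≠ 0 ∧ (θ : H) * s = ρ ^ k • (s * θ) := by
  have h0 : ρ ≠ 0 := hρ.ne_zero (NeZero.ne n)
  have hζ : IsPrimitiveRoot ρ⁻¹ n := hρ.inv
  have hcn := conjLin_pow_eq_one θ hθ
  have hproj : rootProj n ρ⁻¹ (conjLin K θ) k ≠ 0 := by
    intro h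
    have h1 : rootProj n ρ⁻¹ (conjLin K θ) k = AlgHom.mulLeftRight K H ((n : K)⁻¹ •
        ∑ m ∈ Finset.range n, ((ρ⁻¹ ^ k) ^ m) • (((θ : H) ^ m) ⊗ₜ op (((θ⁻¹ : Hˣ) : H) ^ m))) := by
      rw [rootProj, map_smul, map_sum]
      congr 1
      refine Finset.sum_congr rfl fun m _ => ?_
      ext x
      rw [_root_.smul_pow, map_smul, LinearMap.smul_apply, LinearMap.smul_apply, conjLin_pow_apply,
        AlgHom.mulLeftRight_apply, unop_op, mul_assoc]
    rw [h1, map_eq_zero_iff _ (mulLeftRight_bijective H).1, smul_eq_zero] at h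
    have h2 := h.resolve_left (inv_ne_zero hρ.natCast_ne_zero)
    obtain ⟨f, hf⟩ := exists_dual_pow (θ : H) hn
    have h3 := congr(tensorSlice f $h2)
    rw [map_sum, Finset.sum_eq_single 0] at h3
    · have := hf 0 (NeZero.pos n)
      rw [if_pos rfl, pow_zero] at this
      simp [tensorSlice, this] at h3
    · intro m hm hm0
      simp [tensorSlice, hf m (Finset.mem_range.1 hm), hm0]
    · intro h
      exact absurd (Finset.mem_range.2 (NeZero.pos n)) h
  obtain ⟨x, hx⟩ : ∃ x, rootProj n ρ⁻¹ (conjLin K θ) k x ≠ 0 := by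
    by_contra! h
    exact hproj (LinearMap.ext h)
  refine ⟨_, hx, (conjLin_eq_smul_iff θ _ _).1 ?_⟩
  have h1 := congr($(smul_mul_rootProj hζ hcn k) x)
  rw [Module.End.mul_apply, LinearMap.smul_apply, inv_pow,
    inv_smul_eq_iff₀ (pow_ne_zero _ h0)] at h1
  exact h1

variable {E : Type*} [Field E] [Algebra K E]

omit [IsSimpleRing H] [Algebra.IsCentral K H] in
theorem eigen_comb_surjective (emb : E →ₐ[K] H) (hE : Module.finrank K E = n)
    (hH : Module.finrank K H = n ^ 2) (θ : Hˣ) (hθ : ∀ e, Commute (θ : H) (emb e))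
    (s : Fin n → H) (hs0 : ∀ i, s i ≠ 0)
    (hs : ∀ i : Fin n, (θ : H) * s i = ρ ^ (i : ℕ) • (s i * θ)) (x : H) :
    ∃ c : Fin n → E, x = ∑ i, emb (c i) * s i := by
  let Φ : (Fin n → E) →ₗ[K] H := ∑ i, LinearMap.mulRight K (s i) ∘ₗ emb.toLinearMap ∘ₗ
    LinearMap.proj i
  have hΦ (c : Fin n → E) : Φ c = ∑ i, emb (c i) * s i := by simp [Φ]
  have : FiniteDimensional K E := Module.finite_of_finrank_pos (hE ▸ NeZero.pos n)
  have hinj : Function.Injective Φ := by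
    rw [← LinearMap.ker_eq_bot, LinearMap.ker_eq_bot']
    intro c hc
    ext i
    have h1 := mem_of_sum_eigenvectors_mem hρ (conjLin K θ) (fun i => emb (c i) * s i)
      (fun j => by
        rw [conjLin_eq_smul_iff, ← mul_assoc, (hθ _).eq, mul_assoc, hs, mul_smul_comm, mul_assoc])
      ⊥ (by simp) (by rw [Submodule.mem_bot, ← hΦ, hc]) i
    rw [Submodule.mem_bot] at h1
    by_contra he
    exact hs0 i (((IsUnit.mk0 _ he).map emb).mul_right_eq_zero.1 h1)
  have hd : Module.finrank K (Fin n → E) = Module.finrank K H := by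
    rw [Module.finrank_pi_fintype, hH]
    simp [hE, sq]
  obtain ⟨c, hc⟩ := (LinearMap.injective_iff_surjective_of_finrank_eq_finrank hd).1 hinj x
  exact ⟨c, by rw [← hΦ, hc]⟩

/-- A central simple algebra of dimension `n ^ 2` containing an element `θ` with `θ ^ n = γ`, where
`X ^ n - γ` is irreducible, is a symbol algebra with second slot `γ`: conjugation by `θ` has all
powers of `ρ` as eigenvalues, an eigenvector `s` for `ρ` is a unit, and `s ^ n` commutes with
`θ` and `s`, which generate the algebra. -/
theorem exists_symbolAlgebra_equiv (hH : Module.finrank K H = n ^ 2) {θ : H} {γ : K} (hγ0 : γ ≠ 0)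
    (hθ : θ ^ n = algebraMap K H γ) (hγ : Irreducible (X ^ n - C γ : K[X])) :
    ∃ c : K, c ≠ 0 ∧ Nonempty (SymbolAlgebra n ρ c γ ≃ₐ[K] H) := by
  have hn0 : n ≠ 0 := NeZero.ne n
  have hθu : IsUnit θ := by
    rw [← isUnit_pow_iff hn0, hθ]
    exact (IsUnit.mk0 γ hγ0).map _
  obtain ⟨θ, rfl⟩ := hθu
  have haev : aeval (θ : H) (X ^ n - C γ : K[X]) = 0 := by simp [hθ]
  have hmin : X ^ n - C γ = minpoly K (θ : H) :=
    minpoly.eq_of_irreducible_of_monic hγ haev (monic_X_pow_sub_C γ hn0)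
  have hdeg : (minpoly K (θ : H)).natDegree = n := by rw [← hmin, natDegree_X_pow_sub_C]
  -- the field `K(θ)`
  have : Fact (Irreducible (X ^ n - C γ : K[X])) := ⟨hγ⟩
  let E := AdjoinRoot (X ^ n - C γ : K[X])
  have hE : Module.finrank K E = n := by
    rw [(AdjoinRoot.powerBasis hγ.ne_zero).finrank, AdjoinRoot.powerBasis_dim,
      natDegree_X_pow_sub_C]
  obtain ⟨emb, hemb⟩ := exists_adjoinRoot_algHom haev
  have hroot : emb (AdjoinRoot.root _) = θ := (hemb X).trans (aeval_X _)
  have hcomm (e : E) : Commute (θ : H) (emb e) := by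
    rw [← hroot]
    exact (Commute.all _ e).map emb
  have hcomm_all (x : H) (hx : Commute (θ : H) x) (e : E) : Commute (emb e) x := by
    obtain ⟨p, rfl⟩ := AdjoinRoot.mk_surjective e
    rw [hemb]
    induction p using Polynomial.induction_on' with
    | add p q hp hq => rw [map_add]; exact hp.add_left hq
    | monomial m c =>
      rw [aeval_monomial]
      exact Commute.mul_left (Algebra.commutes c x) (hx.pow_left m)
  choose s hs0 hs using exists_skew_ne_zero hρ θ hθ hdeg
  -- the centralizer of `θ` is `K(θ)`
  have cent (x : H) (hx : Commute (θ : H) x) : ∃ e, x = emb e := by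
    let s' : Fin n → H := fun i => if i = 0 then 1 else s i
    have hs' (i : Fin n) : (θ : H) * s' i = ρ ^ (i : ℕ) • (s' i * θ) := by
      by_cases hi : i = 0
      · simp [s', hi]
      · simp only [s', hi, if_false, hs]
    obtain ⟨c, hc⟩ := eigen_comb_surjective hρ emb hE hH θ hcomm s'
      (fun i => by simp only [s']; split_ifs; exacts [one_ne_zero, hs0 _]) hs' x
    have h1 (i : Fin n) := mem_of_sum_eigenvectors_mem hρ (conjLin K θ)
      (fun i => emb (c i) * s' i - if i = 0 then x else 0)
      (fun j => by
        rw [conjLin_eq_smul_iff, mul_sub, sub_mul, ← mul_assoc, (hcomm _).eq, mul_assoc, hs',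
          mul_smul_comm, mul_assoc, smul_sub]
        congr 1
        split_ifs with h
        · simp [h, hx.eq]
        · simp)
      ⊥ (by simp) (by simp [← hc]) i
    refine ⟨c 0, ?_⟩
    have := (Submodule.mem_bot K).1 (h1 0)
    simp only [s', if_true, mul_one, sub_eq_zero] at this
    exact this.symm
  -- a skew element is a unit, because `H` is simple
  have hunit : IsUnit (s 1) := by
    have hcn := conjLin_pow_eq_one θ hθ
    let P := rootProj n ρ⁻¹ (conjLin K θ) 0
    have hP1 : P 1 = 1 := by
      have h1 (m : ℕ) : (conjLin K θ ^ m) 1 = 1 := by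
        rw [conjLin_pow_apply, one_mul, ← Units.val_pow_eq_pow_val, ← Units.val_pow_eq_pow_val,
          inv_pow, Units.mul_inv]
      simp [P, rootProj, h1, ← Nat.cast_smul_eq_nsmul K, hρ.natCast_ne_zero]
    have hP (x : H) (k : ℕ) (hx : (θ : H) * x = ρ ^ k • (x * θ)) (h0 : P x ≠ 0) :
        Commute (θ : H) x := by
      have h1 := congr($(smul_mul_rootProj hρ.inv hcn 0) x)
      have h2 :=
        congr($((commute_rootProj (n := n) (ζ := ρ⁻¹) (Commute.refl (conjLin K θ)) 0).eq) x)
      rw [pow_zero, one_smul] at h1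
      rw [h1, Module.End.mul_apply, (conjLin_eq_smul_iff θ x _).2 hx, map_smul] at h2
      have h3 : (1 : K) = ρ ^ k := smul_left_injective K h0 (by simpa using h2)
      rwa [← h3, one_smul] at hx
    obtain ⟨a, b, hab⟩ : ∃ a b, P (a * s 1 * b) ≠ 0 := by
      by_contra! h
      obtain ⟨T, hT⟩ : ∃ T : Module.End K H, T (s 1) = 1 := by
        obtain ⟨f, hf⟩ := exists_linearForm_eq_one (K := K) (hs0 1)
        exact ⟨f.smulRight 1, by simp [hf]⟩
      obtain ⟨T, rfl⟩ := mulLeftRight_surjective (K := K) H T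
      have h2 : P (AlgHom.mulLeftRight K H T (s 1)) = 0 := by
        clear hT
        induction T with
        | zero => simp
        | tmul a b =>
          have := AlgHom.mulLeftRight_apply K H a b (s 1)
          rw [this, h]
        | add T T' h h' => rw [map_add, LinearMap.add_apply, map_add, h, h', add_zero]
      rw [hT, hP1] at h2
      exact one_ne_zero h2
    obtain ⟨c, hc⟩ := eigen_comb_surjective hρ emb hE hH θ hcomm (fun i => s i)
      (fun i => hs0 _) (fun i => hs _) a
    obtain ⟨d, hd⟩ := eigen_comb_surjective hρ emb hE hH θ hcomm (fun i => s i)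
      (fun i => hs0 _) (fun i => hs _) b
    obtain ⟨i, j, hij⟩ : ∃ i j, P (emb (c i) * s i * s 1 * (emb (d j) * s j)) ≠ 0 := by
      by_contra! h
      refine hab ?_
      rw [hc, hd, Finset.sum_mul, Finset.sum_mul, map_sum]
      refine Finset.sum_eq_zero fun i _ => ?_
      rw [Finset.mul_sum, map_sum]
      exact Finset.sum_eq_zero fun j _ => h i j
    have hskew {x y : H} {k l : ℕ} (hx : (θ : H) * x = ρ ^ k • (x * θ))
        (hy : (θ : H) * y = ρ ^ l • (y * θ)) : (θ : H) * (x * y) = ρ ^ (k + l) • (x * y * θ) := by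
      rw [← mul_assoc, hx, smul_mul_assoc, mul_assoc, hy, mul_smul_comm, smul_smul, ← pow_add,
        mul_assoc]
    have hembs (e : E) (i : ℕ) : (θ : H) * (emb e * s i) = ρ ^ i • (emb e * s i * θ) := by
      rw [← mul_assoc, (hcomm _).eq, mul_assoc, hs, mul_smul_comm, mul_assoc]
    obtain ⟨e, he⟩ := cent _ (hP _ _ (hskew (hskew (hembs _ _) (hs 1)) (hembs _ _)) hij)
    have he0 : e ≠ 0 := by
      rintro rfl
      rw [he, map_zero, map_zero] at hij
      exact hij rfl
    have hu : IsUnit (emb (c i) * s i * s 1 * (emb (d j) * s j)) := by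
      rw [he]
      exact (IsUnit.mk0 e he0).map emb
    exact (isUnit_and_of_mul_eq (K := K) (isUnit_and_of_mul_eq (K := K) hu).1).2
  have hsθ : (s 1) * (θ : H) = ρ⁻¹ • ((θ : H) * s 1) := by
    have h0 : ρ ≠ 0 := hρ.ne_zero hn0
    rw [hs 1, smul_smul, pow_one, inv_mul_cancel₀ h0, one_smul]
  have hs1 : (θ : H) * s 1 = ρ • (s 1 * θ) := by simpa using hs 1
  have hsn : Commute (θ : H) (s 1 ^ n) := by
    have := skew_pow hs1 n
    rwa [hρ.pow_eq_one, one_smul] at this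
  have hcentral : s 1 ^ n ∈ Subalgebra.center K H := by
    rw [Subalgebra.mem_center_iff]
    intro x
    obtain ⟨c, rfl⟩ := eigen_comb_surjective hρ emb hE hH θ hcomm (fun i => s 1 ^ (i : ℕ))
      (fun i => (hunit.pow _).ne_zero) (fun i => skew_pow hs1 _) x
    rw [Finset.sum_mul, Finset.mul_sum]
    refine Finset.sum_congr rfl fun i _ => ?_
    exact ((hcomm_all _ hsn _).mul_left (Commute.pow_pow_self _ _ _)).eq
  obtain ⟨c, hc⟩ := Algebra.IsCentral.mem_center_iff (K := K) |>.1 hcentral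
  have hc0 : c ≠ 0 := by
    rintro rfl
    rw [map_zero] at hc
    exact (hunit.pow n).ne_zero hc
  exact ⟨c, hc0, SymbolAlgebra.nonempty_algEquiv hρ hc0 hγ0 hH hc hθ hs1⟩

end Kummer

/-! ### Subfields and traces -/

section Subfield

open MulOpposite Polynomial

/-- The trace of left multiplication on a possibly noncommutative algebra. -/
noncomputable def mulTrace (K : Type*) [Field K] (H : Type*) [Ring H] [Algebra K H] : H →ₗ[K] K :=
  LinearMap.trace K H ∘ₗ LinearMap.mul K H

variable {K : Type u} [Field K] {H : Type w} [Ring H] [Algebra K H] [FiniteDimensional K H]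

omit [FiniteDimensional K H] in
theorem mulTrace_apply (x : H) :
    mulTrace K H x = LinearMap.trace K H (LinearMap.mulLeft K x) := rfl

theorem mulTrace_algebraMap (c : K) :
    mulTrace K H (algebraMap K H c) = Module.finrank K H * c := by
  rw [Algebra.algebraMap_eq_smul_one, map_smul, mulTrace_apply, LinearMap.mulLeft_one,
    LinearMap.trace_id, smul_eq_mul, mul_comm]

section

variable {E : Type*} [Field E] [Algebra K E]

/-- A subfield of a central simple algebra of dimension `n ^ 2` has degree at most `n`: the algebra
`E ⊗ Hᵒᵖ` acts faithfully on `H` by `E`-linear maps. -/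
theorem finrank_le_of_algHom [Nontrivial H] [IsSimpleRing H] [Algebra.IsCentral K H]
    (emb : E →ₐ[K] H) {n : ℕ} (hH : Module.finrank K H = n ^ 2) : Module.finrank K E ≤ n := by
  let _ : Module E H := Module.compHom H emb.toRingHom
  have smul_def (e : E) (x : H) : e • x = emb e * x := rfl
  have : IsScalarTower K E H := ⟨fun k e x => by
    rw [smul_def, smul_def, map_smul, smul_mul_assoc]⟩
  have : FiniteDimensional K E :=
    Module.Finite.of_injective emb.toLinearMap emb.toRingHom.injective
  have : Module.Finite E H := Module.Finite.of_restrictScalars_finite K E H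
  have hfe := Module.finrank_mul_finrank K E H
  let φ : E ⊗[K] Hᵐᵒᵖ →ₗ[K] (H →ₗ[E] H) := TensorProduct.lift
    (LinearMap.mk₂ K (fun e h =>
      { toFun := fun x => emb e * x * h.unop
        map_add' := fun x y => by rw [mul_add, add_mul]
        map_smul' := fun c x => by
          simp only [smul_def, RingHom.id_apply, ← mul_assoc]
          rw [← map_mul, mul_comm, map_mul] })
      (fun e e' h => by ext x; simp [add_mul])
      (fun c e h => by ext x; simp)
      (fun e h h' => by ext x; simp [mul_add])
      (fun c e h => by ext x; simp))
  have hφ (t : E ⊗[K] Hᵐᵒᵖ) (x : H) :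
      φ t x = AlgHom.mulLeftRight K H (TensorProduct.map emb.toLinearMap LinearMap.id t) x := by
    induction t with
    | zero => simp
    | tmul e h =>
      rw [TensorProduct.map_tmul]
      exact (AlgHom.mulLeftRight_apply K H (emb e) h x).symm
    | add t t' ht ht' => rw [map_add, map_add, map_add, LinearMap.add_apply, ht, ht']; rfl
  have hinj : Function.Injective φ := by
    intro t t' h
    have h1 : Function.Injective (TensorProduct.map emb.toLinearMap (LinearMap.id (M := Hᵐᵒᵖ))) :=
      Module.Flat.rTensor_preserves_injective_linearMap (M := Hᵐᵒᵖ) emb.toLinearMap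
        emb.toRingHom.injective
    refine h1 ((mulLeftRight_bijective (K := K) H).1 (LinearMap.ext fun x => ?_))
    rw [← hφ, ← hφ, h]
  have : Module.Finite K (H →ₗ[E] H) := Module.Finite.trans E _
  have h1 := LinearMap.finrank_le_finrank_of_injective hinj
  rw [Module.finrank_tensorProduct, (opLinearEquiv K (M := H)).symm.finrank_eq,
    ← Module.finrank_mul_finrank K E (H →ₗ[E] H), Module.finrank_linearMap] at h1
  have hpos : 0 < Module.finrank K E := Module.finrank_pos
  have hpos' : 0 < Module.finrank E H := Module.finrank_pos
  have h2 := Nat.le_of_mul_le_mul_left h1 hpos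
  rw [← hfe] at h2
  have h3 := Nat.le_of_mul_le_mul_right h2 hpos'
  rw [← hfe] at hH
  nlinarith

/-- The trace of left multiplication by an element of a subfield. -/
theorem mulTrace_algHom [Nontrivial H] (emb : E →ₐ[K] H) :
    ∃ r : ℕ, Module.finrank K H = Module.finrank K E * r ∧
      ∀ e, mulTrace K H (emb e) = r * Algebra.trace K E e := by
  let _ : Module E H := Module.compHom H emb.toRingHom
  have smul_def (e : E) (x : H) : e • x = emb e * x := rfl
  have : IsScalarTower K E H := ⟨fun k e x => by
    rw [smul_def, smul_def, map_smul, smul_mul_assoc]⟩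
  have : FiniteDimensional K E :=
    Module.Finite.of_injective emb.toLinearMap emb.toRingHom.injective
  have : Module.Finite E H := Module.Finite.of_restrictScalars_finite K E H
  refine ⟨Module.finrank E H, (Module.finrank_mul_finrank K E H).symm, fun e => ?_⟩
  let ι := Fin (Module.finrank E H)
  let φ : H ≃ₗ[E] E ⊗[K] (ι → K) := (Module.finBasis E H).equivFun.trans
    (TensorProduct.piScalarRight K E E ι).symm
  have h1 : (φ.restrictScalars K).conj (LinearMap.mulLeft K (emb e)) =
      TensorProduct.map (Algebra.lmul K E e) LinearMap.id := by
    refine LinearMap.ext fun t => ?_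
    have h2 : (φ.restrictScalars K).conj (LinearMap.mulLeft K (emb e)) t = φ (e • φ.symm t) := rfl
    rw [h2, map_smul, LinearEquiv.apply_symm_apply]
    induction t with
    | zero => simp
    | tmul x y => simp [TensorProduct.smul_tmul']
    | add t t' ht ht' => rw [smul_add, map_add, ht, ht'] <;> rfl
  rw [mulTrace_apply, ← LinearMap.trace_conj' _ (φ.restrictScalars K), h1,
    LinearMap.trace_tensorProduct', LinearMap.trace_id]
  simp [ι, Algebra.trace_apply, mul_comm]

end

/-- The dimension of an algebra is divisible by the degree of the minimal polynomial of an element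
if that polynomial is irreducible, and the trace of left multiplication by the element is given by
the second coefficient of the polynomial. -/
theorem mulTrace_eq_nextCoeff [Nontrivial H] {z : H} (hz : Irreducible (minpoly K z)) :
    ∃ r : ℕ, Module.finrank K H = (minpoly K z).natDegree * r ∧
      mulTrace K H z = -(r * (minpoly K z).nextCoeff) := by
  have : Fact (Irreducible (minpoly K z)) := ⟨hz⟩
  obtain ⟨emb, hemb⟩ := exists_adjoinRoot_algHom (minpoly.aeval K z)
  obtain ⟨r, hr, htr⟩ := mulTrace_algHom emb
  let pb := AdjoinRoot.powerBasis hz.ne_zero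
  have hdim : Module.finrank K (AdjoinRoot (minpoly K z)) = (minpoly K z).natDegree := by
    rw [pb.finrank, AdjoinRoot.powerBasis_dim]
  refine ⟨r, by rw [hr, hdim], ?_⟩
  have h1 := htr (AdjoinRoot.root _)
  rw [show emb (AdjoinRoot.root _) = z from (hemb X).trans (aeval_X z)] at h1
  have h2 := pb.trace_gen_eq_nextCoeff_minpoly
  rw [AdjoinRoot.powerBasis_gen, AdjoinRoot.minpoly_root hz.ne_zero] at h2
  have hmonic : (minpoly K z).Monic := minpoly.monic (IsIntegral.of_finite K z)
  rw [hmonic.leadingCoeff, inv_one, map_one, mul_one] at h2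
  rw [h1, h2, mul_neg]

theorem natDegree_minpoly_le [Nontrivial H] [IsSimpleRing H] [Algebra.IsCentral K H] {n : ℕ}
    (hH : Module.finrank K H = n ^ 2) {z : H} (hz : Irreducible (minpoly K z)) :
    (minpoly K z).natDegree ≤ n := by
  have : Fact (Irreducible (minpoly K z)) := ⟨hz⟩
  obtain ⟨emb, -⟩ := exists_adjoinRoot_algHom (minpoly.aeval K z)
  have := finrank_le_of_algHom emb hH
  rwa [(AdjoinRoot.powerBasis hz.ne_zero).finrank, AdjoinRoot.powerBasis_dim] at this

end Subfield

/-! ### Division algebras of degree three -/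

section DegreeThree

open Polynomial

variable {K : Type u} [Field K]

/-- An element of degree three and trace zero has a reduced cubic as its minimal polynomial. -/
theorem minpoly_eq_reduced_cubic {H : Type w} [Ring H] [Algebra K H] [FiniteDimensional K H]
    [Nontrivial H] {z : H} (hz : Irreducible (minpoly K z)) (hdeg : (minpoly K z).natDegree = 3)
    (htr : mulTrace K H z = 0) (hH : (Module.finrank K H : K) ≠ 0) :
    ∃ β γ : K, minpoly K z = X ^ 3 + C β * X + C γ := by
  obtain ⟨r, hr, htr'⟩ := mulTrace_eq_nextCoeff hz
  rw [htr, eq_comm, neg_eq_zero, mul_eq_zero] at htr'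
  have h2 : (minpoly K z).nextCoeff = 0 := htr'.resolve_left fun h => hH (by rw [hr]; simp [h])
  rw [nextCoeff, if_neg (by omega), hdeg] at h2
  have h3 : (minpoly K z).coeff 3 = 1 := by
    have := (minpoly.monic (IsIntegral.of_finite K z)).coeff_natDegree
    rwa [hdeg] at this
  refine ⟨(minpoly K z).coeff 1, (minpoly K z).coeff 0, ?_⟩
  conv_lhs => rw [(minpoly K z).as_sum_range_C_mul_X_pow, hdeg]
  simp only [Finset.sum_range_succ, Finset.sum_range_zero, h3]
  rw [show (minpoly K z).coeff 2 = 0 from h2, map_zero, map_one]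
  ring

variable {D : Type w} [DivisionRing D] [Algebra K D] [FiniteDimensional K D]

theorem exists_notMem_range_algebraMap (hD : Module.finrank K D ≠ 1) :
    ∃ a : D, a ∉ Set.range (algebraMap K D) := by
  by_contra! h
  refine hD (Subalgebra.bot_eq_top_iff_finrank_eq_one.1 (le_antisymm bot_le fun a _ => ?_))
  exact Algebra.mem_bot.2 (h a)

/-- A noncommutative division algebra contains a noncentral element such that the element and its
inverse both have trace zero: if `E` is the centralizer of a noncentral element, choose `d ≠ 0`
orthogonal to `E` for the trace form and `k ∈ E` with `d⁻¹ * k` of trace zero; then `k⁻¹ * d`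
is such an element. -/
theorem exists_trace_eq_zero_trace_inv_eq_zero [Algebra.IsCentral K D]
    (hD : Module.finrank K D ≠ 1) :
    ∃ y : D, y ≠ 0 ∧ mulTrace K D y = 0 ∧ mulTrace K D y⁻¹ = 0 := by
  obtain ⟨a, ha⟩ := exists_notMem_range_algebraMap hD
  let E := Subalgebra.centralizer K {a}
  have haE : a ∈ E := (Subalgebra.mem_centralizer_iff K).2 (by simp)
  have hinv (k : D) (hk : k ∈ E) : k⁻¹ ∈ E := by
    rw [Subalgebra.mem_centralizer_iff] at hk ⊢
    intro g hg
    exact ((show Commute g k from hk g hg).inv_right₀).eq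
  have hE1 : 1 < Module.finrank K E := by
    by_contra! h
    have h1 : E = ⊥ := Subalgebra.eq_bot_of_finrank_one
      (le_antisymm h Module.finrank_pos)
    rw [h1] at haE
    exact ha (Algebra.mem_bot.1 haE)
  have hE2 : Module.finrank K E < Module.finrank K D := by
    refine Submodule.finrank_lt (s := Subalgebra.toSubmodule E) fun h => ?_
    have h1 : a ∈ Subalgebra.center K D := by
      rw [Subalgebra.mem_center_iff]
      intro b
      have : b ∈ E := by
        rw [← Subalgebra.mem_toSubmodule, h]
        exact Submodule.mem_top
      exact ((Subalgebra.mem_centralizer_iff K).1 this a rfl).symm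
    obtain ⟨c, hc⟩ := Algebra.IsCentral.mem_center_iff (K := K) |>.1 h1
    exact ha ⟨c, hc.symm⟩
  obtain ⟨d, hd0, hd⟩ : ∃ d : D, d ≠ 0 ∧ ∀ k ∈ E, mulTrace K D (k * d) = 0 := by
    let f : D →ₗ[K] (E →ₗ[K] K) := LinearMap.mk₂ K (fun d k => mulTrace K D ((k : D) * d))
      (fun d d' k => by rw [mul_add, map_add]) (fun c d k => by rw [mul_smul_comm, map_smul])
      (fun d k k' => by rw [Subalgebra.coe_add, add_mul, map_add])
      (fun c d k => by rw [Subalgebra.coe_smul, smul_mul_assoc, map_smul])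
    have hf : LinearMap.ker f ≠ ⊥ := LinearMap.ker_ne_bot_of_finrank_lt (by
      have : Module.finrank K (E →ₗ[K] K) = Module.finrank K E := Subspace.dual_finrank_eq
      omega)
    obtain ⟨d, hd, hd0⟩ := Submodule.exists_mem_ne_zero_of_ne_bot hf
    exact ⟨d, hd0, fun k hk => congr($(LinearMap.mem_ker.1 hd) ⟨k, hk⟩)⟩
  obtain ⟨k, hkE, hk0, hk⟩ : ∃ k ∈ E, k ≠ 0 ∧ mulTrace K D (d⁻¹ * k) = 0 := by
    let g : E →ₗ[K] K := mulTrace K D ∘ₗ LinearMap.mulLeft K d⁻¹ ∘ₗ E.val.toLinearMap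
    have hg : LinearMap.ker g ≠ ⊥ := LinearMap.ker_ne_bot_of_finrank_lt (by
      rw [Module.finrank_self]
      exact hE1)
    obtain ⟨k, hk, hk0⟩ := Submodule.exists_mem_ne_zero_of_ne_bot hg
    exact ⟨k, k.2, fun h => hk0 (Subtype.ext h), LinearMap.mem_ker.1 hk⟩
  refine ⟨k⁻¹ * d, mul_ne_zero (inv_ne_zero hk0) hd0, hd _ (hinv k hkE), ?_⟩
  rw [mul_inv_rev, inv_inv]
  exact hk

variable [Algebra.IsCentral K D]

theorem natDegree_minpoly_eq_three (hD : Module.finrank K D = 9) {z : D}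
    (hz : z ∉ Set.range (algebraMap K D)) : (minpoly K z).natDegree = 3 := by
  have hirr : Irreducible (minpoly K z) := minpoly.irreducible (IsIntegral.of_finite K z)
  have h1 := natDegree_minpoly_le (n := 3) (by rw [hD]; rfl) hirr
  obtain ⟨r, hr, -⟩ := mulTrace_eq_nextCoeff hirr
  have h2 : (minpoly K z).natDegree ≠ 1 := fun h => hz (minpoly.natDegree_eq_one_iff.1 h)
  rw [hD] at hr
  generalize (minpoly K z).natDegree = m at *
  interval_cases m <;> omega

/-- Wedderburn's theorem in the presence of a primitive cube root of unity: a central division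
algebra of degree three is a symbol algebra. -/
theorem exists_symbolAlgebra_equiv_of_finrank_eq_nine (hD : Module.finrank K D = 9) {ζ : K}
    (hζ : IsPrimitiveRoot ζ 3) :
    ∃ a b : K, a ≠ 0 ∧ b ≠ 0 ∧ Nonempty (SymbolAlgebra 3 ζ a b ≃ₐ[K] D) := by
  have h9 : (Module.finrank K D : K) ≠ 0 := by
    have h3 : ((3 : ℕ) : K) ≠ 0 := hζ.natCast_ne_zero
    rw [hD, show 9 = 3 * 3 from rfl, Nat.cast_mul]
    exact mul_ne_zero h3 h3
  obtain ⟨y, hy0, hy, hy'⟩ := exists_trace_eq_zero_trace_inv_eq_zero (K := K) (D := D) (by omega)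
  have hnot {z : D} (hz0 : z ≠ 0) (hz : mulTrace K D z = 0) :
      z ∉ Set.range (algebraMap K D) := by
    rintro ⟨c, rfl⟩
    rw [mulTrace_algebraMap, mul_eq_zero] at hz
    exact hz0 (by rw [hz.resolve_left h9, map_zero])
  have hirr (z : D) : Irreducible (minpoly K z) := minpoly.irreducible (IsIntegral.of_finite K z)
  have hdeg := natDegree_minpoly_eq_three hD (hnot hy0 hy)
  obtain ⟨β, γ, h⟩ := minpoly_eq_reduced_cubic (hirr y) hdeg hy h9
  obtain ⟨β', γ', h'⟩ := minpoly_eq_reduced_cubic (hirr y⁻¹)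
    (natDegree_minpoly_eq_three hD (hnot (inv_ne_zero hy0) hy')) hy' h9
  have e : y ^ 3 + algebraMap K D β * y + algebraMap K D γ = 0 := by
    simpa [h] using minpoly.aeval K y
  have e' : y⁻¹ ^ 3 + algebraMap K D β' * y⁻¹ + algebraMap K D γ' = 0 := by
    simpa [h'] using minpoly.aeval K y⁻¹
  -- the minimal polynomial of `y⁻¹` is the reversal of that of `y`; both lack the quadratic term
  have e2 : 1 + algebraMap K D β' * y ^ 2 + algebraMap K D γ' * y ^ 3 = 0 := by
    have h1 : y⁻¹ ^ 3 * y ^ 3 = 1 := by rw [inv_pow, inv_mul_cancel₀ (pow_ne_zero 3 hy0)]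
    have h2 : y⁻¹ * y ^ 3 = y ^ 2 := by
      rw [pow_succ' y 2, ← mul_assoc, inv_mul_cancel₀ hy0, one_mul]
    rw [← h1, ← h2, ← mul_assoc, ← add_mul, ← add_mul, e', zero_mul]
  have e3 : aeval y (C β' * X ^ 2 + C (-(γ' * β)) * X + C (1 - γ' * γ)) = 0 := by
    have h3 : y ^ 3 = -(algebraMap K D β * y) - algebraMap K D γ := by
      rw [eq_sub_iff_add_eq, eq_neg_iff_add_eq_zero, ← e]
      abel
    rw [h3, mul_sub, mul_neg, ← mul_assoc, ← map_mul, ← map_mul] at e2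
    simp only [map_add, map_sub, map_neg, neg_mul, map_mul, aeval_C, aeval_X, map_pow,
      map_one] at e2 ⊢
    rw [← e2]
    abel
  have e4 : (C β' * X ^ 2 + C (-(γ' * β)) * X + C (1 - γ' * γ) : K[X]) = 0 := by
    by_contra hne
    have h1 := minpoly.degree_le_of_ne_zero K y hne e3
    rw [Polynomial.degree_eq_natDegree (hirr y).ne_zero, hdeg] at h1
    have h2 := h1.trans degree_quadratic_le
    exact absurd h2 (by decide)
  have c1 : γ' * β = 0 := by simpa [coeff_one, coeff_C] using congr(coeff $e4 1)
  have c0 : 1 - γ' * γ = 0 := by simpa using congr(coeff $e4 0)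
  have hγ' : γ' ≠ 0 := by rintro rfl; simp at c0
  have hγ : γ ≠ 0 := by rintro rfl; simp at c0
  obtain rfl : β = 0 := (mul_eq_zero.1 c1).resolve_left hγ'
  have hirr' : Irreducible (X ^ 3 - C (-γ) : K[X]) := by
    have := hirr y
    rw [h] at this
    simpa using this
  obtain ⟨a, ha, ⟨φ⟩⟩ := exists_symbolAlgebra_equiv (H := D) hζ (by rw [hD]; rfl) (neg_ne_zero.2 hγ)
    (θ := y) (by rw [map_neg, eq_neg_iff_add_eq_zero]; simpa using e) hirr'
  exact ⟨a, -γ, ha, neg_ne_zero.2 hγ, ⟨φ⟩⟩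

end DegreeThree

section Split

variable {K : Type u} [Field K]

/-- An algebra of dimension one is the base field. -/
theorem nonempty_algEquiv_of_finrank_eq_one {H : Type w} [Ring H] [Algebra K H]
    (hH : Module.finrank K H = 1) : Nonempty (H ≃ₐ[K] K) := by
  have : Nontrivial H := Module.nontrivial_of_finrank_pos (R := K) (by omega)
  have : FiniteDimensional K H := Module.finite_of_finrank_pos (by omega)
  have hinj : Function.Injective (Algebra.ofId K H) := (algebraMap K H).injective
  exact ⟨(AlgEquiv.ofBijective (Algebra.ofId K H)
    ⟨hinj, (LinearMap.injective_iff_surjective_of_finrank_eq_finrank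
      (f := (Algebra.ofId K H).toLinearMap) (by rw [hH, Module.finrank_self])).1 hinj⟩).symm⟩

/-- A symbol algebra whose second slot is `1` is split. -/
theorem brauerSimilar_symbolAlgebra_one {n : ℕ} [NeZero n] {ρ a : K} (hρ : IsPrimitiveRoot ρ n)
    (ha : a ≠ 0) : BrauerSimilar K (SymbolAlgebra n ρ a 1) K := by
  let S := SymbolAlgebra.monomialSystem n ρ a 1 ha one_ne_zero
  obtain ⟨H, _, _, φ, -⟩ := exists_algEquiv_matrix_of_root_of_one hρ.inv
    (X := SymbolAlgebra.genY n ρ a 1) (by rw [SymbolAlgebra.genY_pow, map_one]) S.P (by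
      change SymbolAlgebra.genX n ρ a 1 * SymbolAlgebra.genY n ρ a 1 = _
      rw [show SymbolAlgebra.genY n ρ a 1 * (S.P : SymbolAlgebra n ρ a 1) = _ from
        SymbolAlgebra.genY_mul_genX, smul_smul, inv_mul_cancel₀ (hρ.ne_zero (NeZero.ne n)),
        one_smul])
  have h1 := finrank_of_algEquiv_matrix K φ
  rw [SymbolAlgebra.finrank_eq hρ ha one_ne_zero] at h1
  obtain ⟨e⟩ := nonempty_algEquiv_of_finrank_eq_one (K := K) (H := H)
    (Nat.eq_of_mul_eq_mul_left (pow_pos (NeZero.pos n) 2) (by rw [← h1, mul_one]))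
  exact (BrauerSimilar.of_matrix (NeZero.ne n) φ).trans (.of_algEquiv e)

/-- A central simple algebra of degree nine that is not a division algebra is similar to a symbol
algebra of degree three. -/
theorem exists_brauerSimilar_symbolAlgebra_three {H : Type w} [Ring H] [Algebra K H]
    [FiniteDimensional K H] [IsSimpleRing H] [Algebra.IsCentral K H]
    (hH : Module.finrank K H = 81) {x : H} (hx0 : x ≠ 0) (hx : ¬ IsUnit x) {ζ : K}
    (hζ : IsPrimitiveRoot ζ 3) :
    ∃ a b : K, a ≠ 0 ∧ b ≠ 0 ∧ BrauerSimilar K H (SymbolAlgebra 3 ζ a b) := by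
  have : IsArtinianRing H := IsArtinianRing.of_finite K H
  obtain ⟨k, _, D, _, _, _, ⟨φ⟩⟩ := IsSimpleRing.exists_algEquiv_matrix_divisionRing_finite K H
  have : Algebra.IsCentral K D := isCentral_of_algEquiv_matrix K φ
  have hsim : BrauerSimilar K H D := .of_matrix (NeZero.ne k) φ
  have hd := finrank_of_algEquiv_matrix K φ
  rw [hH] at hd
  have hk1 : k ≠ 1 := by
    rintro rfl
    refine hx ((MulEquiv.isUnit_map φ).1 ?_)
    have h0 : φ x 0 0 ≠ 0 := fun h => hx0 (φ.injective (by
      ext i j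
      rw [Subsingleton.elim i 0, Subsingleton.elim j 0, h, map_zero, Matrix.zero_apply]))
    refine IsUnit.of_mul_eq_one (Matrix.of fun _ _ => (φ x 0 0)⁻¹) ?_
    ext i j
    rw [Subsingleton.elim i 0, Subsingleton.elim j 0, Matrix.mul_apply]
    simp [h0]
  have hk : k ∣ 9 := (Nat.pow_dvd_pow_iff two_ne_zero).1 ⟨_, hd⟩
  have hk' : k ≤ 9 := Nat.le_of_dvd (by norm_num) hk
  have h39 : k = 3 ∨ k = 9 := by
    interval_cases k <;> omega
  rcases h39 with rfl | rfl
  · obtain ⟨a, b, ha, hb, ⟨e⟩⟩ :=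
      exists_symbolAlgebra_equiv_of_finrank_eq_nine (K := K) (D := D) (by omega) hζ
    exact ⟨a, b, ha, hb, hsim.trans (.of_algEquiv e.symm)⟩
  · obtain ⟨e⟩ := nonempty_algEquiv_of_finrank_eq_one (K := K) (H := D) (by omega)
    exact ⟨1, 1, one_ne_zero, one_ne_zero, (hsim.trans (.of_algEquiv e)).trans
      (brauerSimilar_symbolAlgebra_one hζ one_ne_zero).symm⟩

end Split

/-! ### Abelian crossed products of degree nine -/

/-- The structure of an algebra can be transported to any type in bijection with it. -/
theorem exists_algEquiv_of_equiv (F : Type u) [Field F] {T : Type v} {H : Type w} [Ring H]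
    [Algebra F H] (e : T ≃ H) :
    ∃ (C : Type v) (_ : Ring C) (_ : Algebra F C), Nonempty (C ≃ₐ[F] H) :=
  ⟨T, e.ring, letI := e.ring; e.algebra F, ⟨letI := e.ring; e.algEquiv F⟩⟩

namespace AbelianCrossedProduct

variable {F : Type u} {E : Type v} [Field F] [Field E] [Algebra F E]
  {σ₁ σ₂ : E ≃ₐ[F] E} {t₁ t₂ : E} {ζ : F}

/-- Units inducing `σ₁` and `σ₂` on `E`, together with Kummer generators `t₁`, `t₂` of `E`, form a
monomial system. -/
noncomputable def monomialSystem {R : Type*} [Ring R] [Algebra F R] (emb : E →ₐ[F] R) (z₁ z₂ : Rˣ)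
    (hz₁ : ∀ e, (z₁ : R) * emb e = emb (σ₁ e) * z₁) (hz₂ : ∀ e, (z₂ : R) * emb e = emb (σ₂ e) * z₂)
    (ht₁ : t₁ ≠ 0) (ht₂ : t₂ ≠ 0) (h₁₁ : σ₁ t₁ = t₁) (h₂₁ : σ₂ t₁ = algebraMap F E ζ * t₁)
    (h₂₂ : σ₂ t₂ = t₂) (h₁₂ : σ₁ t₂ = algebraMap F E ζ * t₂) :
    MonomialSystem 3 ζ emb where
  P := z₁
  Q := z₂
  s := (Units.map (emb : E →* R) (Units.mk0 t₂ ht₂))⁻¹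
  t := (Units.map (emb : E →* R) (Units.mk0 t₁ ht₁))⁻¹
  s_emb e := by
    rw [← map_inv]
    exact (Commute.all _ e).map emb
  t_emb e := by
    rw [← map_inv]
    exact (Commute.all _ e).map emb
  s_P := by
    rw [Units.inv_mul_eq_iff_eq_mul, mul_smul_comm, ← mul_assoc, ← smul_mul_assoc,
      Units.eq_mul_inv_iff_mul_eq]
    change (z₁ : R) * emb t₂ = ζ • (emb t₂ * z₁)
    rw [hz₁, h₁₂, map_mul, AlgHom.commutes, mul_assoc, Algebra.smul_def]
  s_Q := by
    have : Commute (emb t₂) (z₂ : R) := by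
      have := hz₂ t₂
      rw [h₂₂] at this
      exact this.symm
    exact this.units_inv_left (u := Units.map (emb : E →* R) (Units.mk0 t₂ ht₂))
  t_P := by
    have : Commute (emb t₁) (z₁ : R) := by
      have := hz₁ t₁
      rw [h₁₁] at this
      exact this.symm
    exact this.units_inv_left (u := Units.map (emb : E →* R) (Units.mk0 t₁ ht₁))
  t_Q := by
    rw [Units.inv_mul_eq_iff_eq_mul, mul_smul_comm, ← mul_assoc, ← smul_mul_assoc,
      Units.eq_mul_inv_iff_mul_eq]
    change (z₂ : R) * emb t₁ = ζ • (emb t₁ * z₂)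
    rw [hz₂, h₂₁, map_mul, AlgHom.commutes, mul_assoc, Algebra.smul_def]

section Structure

variable {A : Type w} [Ring A] [Algebra F A] {b₁ b₂ u : E}
  (X : AbelianCrossedProduct F E A σ₁ σ₂ b₁ b₂ u)

theorem isUnit_z₁ : IsUnit X.z₁ := by
  rw [← isUnit_pow_iff three_ne_zero, X.z₁_pow]
  exact (IsUnit.mk0 _ X.b₁_ne_zero).map _

theorem isUnit_z₂ : IsUnit X.z₂ := by
  rw [← isUnit_pow_iff three_ne_zero, X.z₂_pow]
  exact (IsUnit.mk0 _ X.b₂_ne_zero).map _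

/-- The `F`-linear form of the coordinates in an abelian crossed product. -/
noncomputable def coordEquiv : (Fin 3 × Fin 3 → E) ≃ₗ[F] A :=
  LinearEquiv.ofBijective
    { toFun := fun c : Fin 3 × Fin 3 → E =>
        ∑ k : Fin 3 × Fin 3, X.emb (c k) * (X.z₁ ^ (k.1 : ℕ) * X.z₂ ^ (k.2 : ℕ))
      map_add' := fun c d => by
        simp only [Pi.add_apply, map_add, add_mul, Finset.sum_add_distrib]
      map_smul' := fun r c => by
        simp only [Pi.smul_apply, map_smul, smul_mul_assoc, Finset.smul_sum, RingHom.id_apply] }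
    X.basis

include X in
theorem finrank_eq (hE : Module.finrank F E = 9) : Module.finrank F A = 81 := by
  have : FiniteDimensional F E := Module.finite_of_finrank_pos (by omega)
  rw [← X.coordEquiv.finrank_eq, Module.finrank_pi_fintype]
  simp [hE]

include X in
theorem nontrivial : Nontrivial A := X.coordEquiv.symm.toEquiv.nontrivial

include X in
theorem finiteDimensional (hE : Module.finrank F E = 9) : FiniteDimensional F A :=
  Module.finite_of_finrank_pos (by rw [X.finrank_eq hE]; norm_num)

/-- Transport of an abelian crossed product along an isomorphism of algebras. -/
noncomputable def map {B : Type*} [Ring B] [Algebra F B] (e : A ≃ₐ[F] B) :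
    AbelianCrossedProduct F E B σ₁ σ₂ b₁ b₂ u where
  emb := e.toAlgHom.comp X.emb
  z₁ := e X.z₁
  z₂ := e X.z₂
  b₁_ne_zero := X.b₁_ne_zero
  b₂_ne_zero := X.b₂_ne_zero
  b₁_fixed := X.b₁_fixed
  b₂_fixed := X.b₂_fixed
  norm_u := X.norm_u
  z₁_mul x := by simpa using congr(e $(X.z₁_mul x))
  z₂_mul x := by simpa using congr(e $(X.z₂_mul x))
  z₁_pow := by simpa using congr(e $(X.z₁_pow))
  z₂_pow := by simpa using congr(e $(X.z₂_pow))
  z₂_mul_z₁ := by simpa using congr(e $(X.z₂_mul_z₁))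
  basis := by
    convert e.bijective.comp X.basis using 2 with c
    simp

variable (hζ : IsPrimitiveRoot ζ 3)
  (ht₁ : t₁ ≠ 0) (ht₂ : t₂ ≠ 0) (h₁₁ : σ₁ t₁ = t₁) (h₂₁ : σ₂ t₁ = algebraMap F E ζ * t₁)
  (h₂₂ : σ₂ t₂ = t₂) (h₁₂ : σ₁ t₂ = algebraMap F E ζ * t₂)
include hζ ht₁ ht₂ h₁₁ h₂₁ h₂₂ h₁₂

include X in
theorem isSimpleRing : IsSimpleRing A :=
  have := X.nontrivial
  (monomialSystem X.emb X.isUnit_z₁.unit X.isUnit_z₂.unit X.z₁_mul X.z₂_mul ht₁ ht₂ h₁₁ h₂₁ h₂₂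
    h₁₂).isSimpleRing hζ X.basis.2

include X in
theorem isCentral [IsGalois F E] [FiniteDimensional F E] (hσ : Subgroup.closure {σ₁, σ₂} = ⊤) :
    Algebra.IsCentral F A := by
  have := X.nontrivial
  refine ⟨fun z hz => ?_⟩
  rw [Subalgebra.mem_center_iff] at hz
  obtain ⟨e, rfl⟩ := (monomialSystem X.emb X.isUnit_z₁.unit X.isUnit_z₂.unit X.z₁_mul X.z₂_mul ht₁
    ht₂ h₁₁ h₂₁ h₂₂ h₁₂).exists_eq_emb hζ X.basis.2 (hz _) (hz _)
  have hfix₁ : σ₁ e = e := by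
    have h1 := X.z₁_mul e
    rw [hz, X.isUnit_z₁.mul_left_inj] at h1
    exact (X.emb.toRingHom.injective h1).symm
  have hfix₂ : σ₂ e = e := by
    have h1 := X.z₂_mul e
    rw [hz, X.isUnit_z₂.mul_left_inj] at h1
    exact (X.emb.toRingHom.injective h1).symm
  have hfix (g : E ≃ₐ[F] E) : g e = e := by
    have hg : g ∈ Subgroup.closure {σ₁, σ₂} := hσ ▸ Subgroup.mem_top g
    have hle : Subgroup.closure {σ₁, σ₂} ≤ MulAction.stabilizer (E ≃ₐ[F] E) e := by
      rw [Subgroup.closure_le]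
      rintro _ (rfl | rfl)
      · exact hfix₁
      · exact hfix₂
    exact hle hg
  obtain ⟨c, rfl⟩ := (IsGalois.mem_range_algebraMap_iff_fixed e).2 hfix
  exact ⟨c, (X.emb.commutes c).symm⟩

include X in
/-- Tensoring with the symbol algebra `(f₁, d)` of degree three multiplies `b₂` by `d`: the elements
`z₁ ⊗ 1` and `z₂ ⊗ y` commute with `t₁⁻¹ ⊗ x`, whose cube is `1`. -/
theorem exists_brauerSimilar_tensor_symbolAlgebra (hE : Module.finrank F E = 9) {f₁ d : F}
    (hf₁ : t₁ ^ 3 = algebraMap F E f₁) (hd : d ≠ 0) :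
    ∃ (C : Type v) (_ : Ring C) (_ : Algebra F C)
      (_ : AbelianCrossedProduct F E C σ₁ σ₂ b₁ (algebraMap F E d * b₂) u),
      BrauerSimilar F (A ⊗[F] SymbolAlgebra 3 ζ f₁ d) C := by
  have hf₁0 : f₁ ≠ 0 := by
    rintro rfl
    rw [map_zero] at hf₁
    exact ht₁ (pow_eq_zero_iff three_ne_zero |>.1 hf₁)
  have hζ0 : ζ ≠ 0 := hζ.ne_zero three_ne_zero
  have hE0 : FiniteDimensional F E := Module.finite_of_finrank_pos (by omega)
  have := X.nontrivial
  have := X.finiteDimensional hE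
  let S := SymbolAlgebra 3 ζ f₁ d
  have : Nontrivial S := SymbolAlgebra.nontrivial hζ
  let x : S := SymbolAlgebra.genX 3 ζ f₁ d
  let y : S := SymbolAlgebra.genY 3 ζ f₁ d
  have hx3 : x ^ 3 = algebraMap F S f₁ := SymbolAlgebra.genX_pow
  have hy3 : y ^ 3 = algebraMap F S d := SymbolAlgebra.genY_pow
  have hyx : y * x = ζ • (x * y) := SymbolAlgebra.genY_mul_genX
  have hyu : IsUnit ((1 : A) ⊗ₜ[F] y) := by
    rw [← isUnit_pow_iff three_ne_zero, Algebra.TensorProduct.tmul_pow, hy3, one_pow]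
    exact ((IsUnit.mk0 d hd).map (algebraMap F S)).map
      (Algebra.TensorProduct.includeRight : S →ₐ[F] A ⊗[F] S)
  have hZ3 : (X.emb t₁⁻¹ ⊗ₜ[F] x) ^ 3 = (1 : A ⊗[F] S) := by
    rw [Algebra.TensorProduct.tmul_pow, ← map_pow, inv_pow, hf₁, hx3, ← map_inv₀, AlgHom.commutes,
      Algebra.algebraMap_eq_smul_one, Algebra.algebraMap_eq_smul_one, TensorProduct.smul_tmul,
      smul_smul, inv_mul_cancel₀ hf₁0, one_smul, Algebra.TensorProduct.one_def]
  obtain ⟨H, _, _, φ, π, -⟩ := exists_algEquiv_matrix_of_root_of_one hζ hZ3 hyu.unit (by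
    change (1 : A) ⊗ₜ[F] y * X.emb t₁⁻¹ ⊗ₜ[F] x = ζ • (X.emb t₁⁻¹ ⊗ₜ[F] x * (1 : A) ⊗ₜ[F] y)
    rw [Algebra.TensorProduct.tmul_mul_tmul, Algebra.TensorProduct.tmul_mul_tmul, hyx, one_mul,
      mul_one, TensorProduct.tmul_smul])
  have hfin : Module.finrank F H = 81 := by
    have h1 := finrank_of_algEquiv_matrix F φ
    rw [Module.finrank_tensorProduct, X.finrank_eq hE, SymbolAlgebra.finrank_eq hζ hf₁0 hd] at h1
    omega
  have : Nontrivial H := Module.nontrivial_of_finrank_pos (R := F) (by omega)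
  have mem {c : A ⊗[F] S} (hc : Commute c (X.emb t₁⁻¹ ⊗ₜ[F] x)) :
      c ∈ Subalgebra.centralizer F {X.emb t₁⁻¹ ⊗ₜ[F] x} := by
    rw [Subalgebra.mem_centralizer_iff]
    rintro _ rfl
    exact hc.eq.symm
  -- the generators of the new crossed product
  let incl : A →ₐ[F] A ⊗[F] S := Algebra.TensorProduct.includeLeft
  let embC := (incl.comp X.emb).codRestrict (Subalgebra.centralizer F {X.emb t₁⁻¹ ⊗ₜ[F] x})
    (fun e => mem (by
      change X.emb e ⊗ₜ[F] (1 : S) * X.emb t₁⁻¹ ⊗ₜ[F] x = X.emb t₁⁻¹ ⊗ₜ[F] x * X.emb e ⊗ₜ[F] 1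
      rw [Algebra.TensorProduct.tmul_mul_tmul, Algebra.TensorProduct.tmul_mul_tmul, ← map_mul,
        ← map_mul, mul_comm e, one_mul, mul_one]))
  let z₁C : Subalgebra.centralizer F {X.emb t₁⁻¹ ⊗ₜ[F] x} := ⟨X.z₁ ⊗ₜ[F] 1, mem (by
      change X.z₁ ⊗ₜ[F] (1 : S) * X.emb t₁⁻¹ ⊗ₜ[F] x = X.emb t₁⁻¹ ⊗ₜ[F] x * X.z₁ ⊗ₜ[F] 1
      rw [Algebra.TensorProduct.tmul_mul_tmul, Algebra.TensorProduct.tmul_mul_tmul, X.z₁_mul,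
        map_inv₀, h₁₁, one_mul, mul_one])⟩
  let z₂C : Subalgebra.centralizer F {X.emb t₁⁻¹ ⊗ₜ[F] x} := ⟨X.z₂ ⊗ₜ[F] y, mem (by
      change X.z₂ ⊗ₜ[F] y * X.emb t₁⁻¹ ⊗ₜ[F] x = X.emb t₁⁻¹ ⊗ₜ[F] x * X.z₂ ⊗ₜ[F] y
      rw [Algebra.TensorProduct.tmul_mul_tmul, Algebra.TensorProduct.tmul_mul_tmul, X.z₂_mul,
        map_inv₀, h₂₁, hyx, mul_inv, ← map_inv₀, map_mul, AlgHom.commutes, mul_assoc,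
        ← Algebra.smul_def, TensorProduct.smul_tmul, smul_smul, inv_mul_cancel₀ hζ0, one_smul])⟩
  have hz₁C (e : E) : z₁C * embC e = embC (σ₁ e) * z₁C := Subtype.ext (by
    change X.z₁ ⊗ₜ[F] (1 : S) * X.emb e ⊗ₜ[F] 1 = X.emb (σ₁ e) ⊗ₜ[F] 1 * X.z₁ ⊗ₜ[F] 1
    rw [Algebra.TensorProduct.tmul_mul_tmul, Algebra.TensorProduct.tmul_mul_tmul, X.z₁_mul])
  have hz₂C (e : E) : z₂C * embC e = embC (σ₂ e) * z₂C := Subtype.ext (by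
    change X.z₂ ⊗ₜ[F] y * X.emb e ⊗ₜ[F] 1 = X.emb (σ₂ e) ⊗ₜ[F] 1 * X.z₂ ⊗ₜ[F] y
    rw [Algebra.TensorProduct.tmul_mul_tmul, Algebra.TensorProduct.tmul_mul_tmul, X.z₂_mul,
      one_mul, mul_one])
  have hz₁3 : z₁C ^ 3 = embC b₁ := Subtype.ext (by
    change (X.z₁ ⊗ₜ[F] (1 : S)) ^ 3 = X.emb b₁ ⊗ₜ[F] 1
    rw [Algebra.TensorProduct.tmul_pow, X.z₁_pow, one_pow])
  have hz₂3 : z₂C ^ 3 = embC (algebraMap F E d * b₂) := Subtype.ext (by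
    change (X.z₂ ⊗ₜ[F] y) ^ 3 = X.emb (algebraMap F E d * b₂) ⊗ₜ[F] 1
    rw [Algebra.TensorProduct.tmul_pow, X.z₂_pow, hy3, ← Algebra.smul_def, map_smul,
      TensorProduct.smul_tmul, Algebra.algebraMap_eq_smul_one])
  have hzz : z₂C * z₁C = embC u * (z₁C * z₂C) := Subtype.ext (by
    change X.z₂ ⊗ₜ[F] y * X.z₁ ⊗ₜ[F] 1 = X.emb u ⊗ₜ[F] 1 * (X.z₁ ⊗ₜ[F] 1 * X.z₂ ⊗ₜ[F] y)
    rw [Algebra.TensorProduct.tmul_mul_tmul, Algebra.TensorProduct.tmul_mul_tmul,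
      Algebra.TensorProduct.tmul_mul_tmul, X.z₂_mul_z₁, one_mul, one_mul, mul_one])
  have hb₂ : algebraMap F E d * b₂ ≠ 0 :=
    mul_ne_zero ((map_ne_zero _).2 hd) X.b₂_ne_zero
  let embH : E →ₐ[F] H := π.comp embC
  have hz₁H (e : E) : π z₁C * embH e = embH (σ₁ e) * π z₁C := by
    exact (map_mul π _ _).symm.trans (congr(π $(hz₁C e)).trans (map_mul π _ _))
  have hz₂H (e : E) : π z₂C * embH e = embH (σ₂ e) * π z₂C := by
    exact (map_mul π _ _).symm.trans (congr(π $(hz₂C e)).trans (map_mul π _ _))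
  have hz₁3H : π z₁C ^ 3 = embH b₁ := (map_pow π _ 3).symm.trans congr(π $hz₁3)
  have hz₂3H : π z₂C ^ 3 = embH (algebraMap F E d * b₂) := by
    rw [← map_pow, hz₂3]
    rfl
  have hu₁ : IsUnit (π z₁C) := by
    rw [← isUnit_pow_iff three_ne_zero, hz₁3H]
    exact (IsUnit.mk0 _ X.b₁_ne_zero).map _
  have hu₂ : IsUnit (π z₂C) := by
    rw [← isUnit_pow_iff three_ne_zero, hz₂3H]
    exact (IsUnit.mk0 _ hb₂).map _
  have hinj := (monomialSystem embH hu₁.unit hu₂.unit hz₁H hz₂H ht₁ ht₂ h₁₁ h₂₁ h₂₂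
    h₁₂).comb_injective hζ
  have hbij : Function.Bijective fun c : Fin 3 × Fin 3 → E =>
      ∑ k : Fin 3 × Fin 3, embH (c k) * (π z₁C ^ (k.1 : ℕ) * π z₂C ^ (k.2 : ℕ)) := by
    have : FiniteDimensional F H := Module.finite_of_finrank_pos (by omega)
    let f : (Fin 3 × Fin 3 → E) →ₗ[F] H :=
      { toFun := fun c : Fin 3 × Fin 3 → E =>
          ∑ k : Fin 3 × Fin 3, embH (c k) * (π z₁C ^ (k.1 : ℕ) * π z₂C ^ (k.2 : ℕ))
        map_add' := fun c d => by
          simp only [Pi.add_apply, map_add, add_mul, Finset.sum_add_distrib]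
        map_smul' := fun r c => by
          simp only [Pi.smul_apply, map_smul, smul_mul_assoc, Finset.smul_sum, RingHom.id_apply] }
    refine ⟨hinj, (LinearMap.injective_iff_surjective_of_finrank_eq_finrank (f := f) ?_).1 hinj⟩
    rw [hfin, Module.finrank_pi_fintype]
    simp [hE]
  let XH : AbelianCrossedProduct F E H σ₁ σ₂ b₁ (algebraMap F E d * b₂) u :=
    { emb := embH
      z₁ := π z₁C
      z₂ := π z₂C
      b₁_ne_zero := X.b₁_ne_zero
      b₂_ne_zero := hb₂
      b₁_fixed := X.b₁_fixed
      b₂_fixed := by rw [map_mul, AlgEquiv.commutes, X.b₂_fixed]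
      norm_u := X.norm_u
      z₁_mul := hz₁H
      z₂_mul := hz₂H
      z₁_pow := hz₁3H
      z₂_pow := hz₂3H
      z₂_mul_z₁ := by
        have := congr(π $hzz)
        rw [map_mul, map_mul, map_mul] at this
        exact this
      basis := hbij }
  obtain ⟨C, _, _, ⟨e⟩⟩ := exists_algEquiv_of_equiv F (Equiv.ofBijective _ hbij)
  exact ⟨C, _, _, XH.map e.symm, (BrauerSimilar.of_matrix three_ne_zero φ).trans
    (.of_algEquiv e.symm)⟩

end Structure

end AbelianCrossedProduct

/-! ### Quadratic extensions -/

section Quadratic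

open Polynomial

/-- Every quadratic polynomial has a root in a quadratic extension, or in the base field if that
has no quadratic extension. -/
theorem exists_quadratic_extension_root (F : Type u) [Field F] (p q : F) :
    ∃ (L : Type u) (_ : Field L) (_ : Algebra F L) (l : L),
      (Module.finrank F L = 2 ∨ (Module.finrank F L = 1 ∧
        ∀ M : IntermediateField F (AlgebraicClosure F), Module.finrank F M ≠ 2)) ∧
      l ^ 2 + algebraMap F L p * l + algebraMap F L q = 0 := by
  let Ω := AlgebraicClosure F
  let f : F[X] := X ^ 2 + C p * X + C q
  have hf : f.natDegree = 2 := by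
    have := natDegree_quadratic (a := (1 : F)) (b := p) (c := q) one_ne_zero
    rwa [map_one, one_mul] at this
  have hf0 : f ≠ 0 := fun h => by simp [h] at hf
  obtain ⟨r, hr⟩ := IsAlgClosed.exists_aeval_eq_zero Ω f (by
    rw [degree_eq_natDegree hf0, hf]; norm_num)
  have hr' : r ^ 2 + algebraMap F Ω p * r + algebraMap F Ω q = 0 := by simpa [f] using hr
  by_cases hrF : r ∈ Set.range (algebraMap F Ω)
  · obtain ⟨r₀, rfl⟩ := hrF
    have h0 : r₀ ^ 2 + p * r₀ + q = 0 := by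
      apply (algebraMap F Ω).injective
      simpa using hr'
    by_cases hM : ∃ M : IntermediateField F Ω, Module.finrank F M = 2
    · obtain ⟨M, hM⟩ := hM
      exact ⟨M, inferInstance, inferInstance, algebraMap F M r₀, Or.inl hM, by
        rw [← map_pow, ← map_mul, ← map_add, ← map_add, h0, map_zero]⟩
    · push Not at hM
      exact ⟨F, inferInstance, inferInstance, r₀, Or.inr ⟨Module.finrank_self F, hM⟩, h0⟩
  · have hint : IsIntegral F r := Algebra.IsIntegral.isIntegral r
    have h2 : (minpoly F r).natDegree = 2 := by
      refine le_antisymm ?_ ((minpoly.two_le_natDegree_iff hint).2 hrF)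
      rw [← hf]
      exact natDegree_le_of_dvd (minpoly.dvd F r hr) hf0
    refine ⟨IntermediateField.adjoin F {r}, inferInstance, inferInstance,
      IntermediateField.AdjoinSimple.gen F r,
      Or.inl (by rw [IntermediateField.adjoin.finrank hint, h2]), ?_⟩
    apply (algebraMap (IntermediateField.adjoin F {r}) Ω).injective
    simpa [← IsScalarTower.algebraMap_apply] using hr'

theorem aeval_ne_zero_of_finrank_le_two {F L : Type*} [Field F] [Field L] [Algebra F L] {p : F[X]}
    (hp : Irreducible p) (hdeg : p.natDegree = 3) (hL0 : 0 < Module.finrank F L)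
    (hL : Module.finrank F L ≤ 2) (x : L) :
    aeval x p ≠ 0 := by
  intro h
  have : FiniteDimensional F L := Module.finite_of_finrank_pos hL0
  have h1 : p.natDegree = (minpoly F x).natDegree := by
    rw [← minpoly.eq_of_irreducible hp h,
      natDegree_mul_C (inv_ne_zero (leadingCoeff_ne_zero.2 hp.ne_zero))]
  have := minpoly.natDegree_le (A := F) x
  omega

end Quadratic

/-! ### Similarity and tensor products -/

namespace BrauerSimilar

section

variable {K : Type*} {A B C : Type*} [Field K] [Ring A] [Algebra K A] [Ring B] [Algebra K B]
  [Ring C] [Algebra K C]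

/-- Division by a central simple algebra in the Brauer monoid. -/
theorem tensor_op_of_tensor [IsSimpleRing B] [Algebra.IsCentral K B] [FiniteDimensional K B]
    (h : BrauerSimilar K (A ⊗[K] B) C) : BrauerSimilar K A (C ⊗[K] Bᵐᵒᵖ) :=
  (((of_algEquiv (Algebra.TensorProduct.rid K K A).symm).trans
    (tensor (of_algEquiv AlgEquiv.refl) (brauerSimilar_tensor_op B).symm)).trans
    (of_algEquiv (Algebra.TensorProduct.assoc K K K A B Bᵐᵒᵖ).symm)).trans
    (h.tensor (of_algEquiv AlgEquiv.refl))

theorem tensor_split (h : BrauerSimilar K B K) : BrauerSimilar K (A ⊗[K] B) A :=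
  (tensor (of_algEquiv AlgEquiv.refl) h).trans (of_algEquiv (Algebra.TensorProduct.rid K K A))

end

variable {F L : Type*} {A B C D R : Type*} [Field F] [Field L] [Algebra F L] [Ring A] [Algebra F A]
  [Ring B] [Algebra F B] [Ring C] [Algebra F C] [Ring D] [Algebra L D] [Ring R] [Algebra L R]

theorem baseChange_tensor :
    BrauerSimilar L (L ⊗[F] (A ⊗[F] B)) ((L ⊗[F] A) ⊗[L] (L ⊗[F] B)) :=
  of_algEquiv <| Algebra.TensorProduct.algEquivOfLinearEquivTensorProduct
    (TensorProduct.AlgebraTensorModule.distribBaseChange F L A B)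
    (fun l l' x x' => by
      induction x with
      | zero => simp
      | add x y hx hy => simp only [add_mul, TensorProduct.tmul_add, map_add, hx, hy]
      | tmul a b =>
        induction x' with
        | zero => simp
        | add x y hx hy => simp only [mul_add, TensorProduct.tmul_add, map_add, hx, hy]
        | tmul a' b' =>
          simp [TensorProduct.AlgebraTensorModule.distribBaseChange_tmul])
    (by simp [Algebra.TensorProduct.one_def])

/-- If `A ⊗ B ∼ C` over `F` and `C_L ⊗ D ∼ R`, then `A_L ∼ R ⊗ D⁻¹ ⊗ B_L⁻¹`. -/
theorem of_tensor_of_baseChange_tensor [IsSimpleRing B] [Algebra.IsCentral F B]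
    [FiniteDimensional F B] [IsSimpleRing D] [Algebra.IsCentral L D] [FiniteDimensional L D]
    (h : BrauerSimilar F (A ⊗[F] B) C) (h' : BrauerSimilar L ((L ⊗[F] C) ⊗[L] D) R) :
    BrauerSimilar L (L ⊗[F] A) ((R ⊗[L] Dᵐᵒᵖ) ⊗[L] (L ⊗[F] B)ᵐᵒᵖ) :=
  have hAB : BrauerSimilar L ((L ⊗[F] A) ⊗[L] (L ⊗[F] B)) (L ⊗[F] C) :=
    (baseChange_tensor (F := F) (L := L) (A := A) (B := B)).symm.trans (h.baseChange L)
  hAB.tensor_op_of_tensor.trans (tensor h'.tensor_op_of_tensor (of_algEquiv AlgEquiv.refl))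

end BrauerSimilar

/-! ### Corners of two commuting roots of unity, and identities between symbols -/

section Corner

variable {K : Type*} [Field K] {A : Type w} [Ring A] [Algebra K A]

/-- The properties that a corner `H` inherits from `A` if `A` is a matrix algebra of size `m` over
`H`. Matrix units are not recorded, so that the notion can be iterated. -/
structure IsCornerOf (K : Type*) [Field K] (A : Type w) [Ring A] [Algebra K A] (m : ℕ)
    (H : Type w) [Ring H] [Algebra K H] : Prop where
  similar : BrauerSimilar K A H
  finrank_eq : Module.finrank K A = m ^ 2 * Module.finrank K H
  isSimpleRing : IsSimpleRing A → IsSimpleRing H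
  isCentral : Algebra.IsCentral K A → Algebra.IsCentral K H
  finiteDimensional : FiniteDimensional K A → FiniteDimensional K H

theorem IsCornerOf.of_algEquiv {m : ℕ} [NeZero m] {H : Type w} [Ring H] [Algebra K H]
    (φ : A ≃ₐ[K] Matrix (Fin m) (Fin m) H) : IsCornerOf K A m H :=
  ⟨.of_matrix (NeZero.ne m) φ, finrank_of_algEquiv_matrix K φ,
    fun _ => isSimpleRing_of_ringEquiv_matrix φ.toRingEquiv,
    fun _ => isCentral_of_algEquiv_matrix K φ, fun _ => finiteDimensional_of_algEquiv_matrix K φ⟩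

theorem IsCornerOf.trans {m n : ℕ} {H H' : Type w} [Ring H] [Algebra K H] [Ring H'] [Algebra K H']
    (h : IsCornerOf K A m H) (h' : IsCornerOf K H n H') : IsCornerOf K A (m * n) H' :=
  ⟨h.similar.trans h'.similar, by rw [h.finrank_eq, h'.finrank_eq]; ring,
    fun hA => h'.isSimpleRing (h.isSimpleRing hA), fun hA => h'.isCentral (h.isCentral hA),
    fun hA => h'.finiteDimensional (h.finiteDimensional hA)⟩

theorem mem_centralizer_of_commute {x c : A}
    (h : Commute x c) : c ∈ Subalgebra.centralizer K {x} := by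
  rw [Subalgebra.mem_centralizer_iff]
  rintro _ rfl
  exact h.eq

theorem mem_centralizer_pair_of_commute {x y c : A}
    (h : Commute x c) (h' : Commute y c) : c ∈ Subalgebra.centralizer K {x, y} := by
  rw [Subalgebra.mem_centralizer_iff]
  rintro _ (rfl | rfl)
  · exact h.eq
  · exact h'.eq

theorem isUnit_mk_centralizer {S : Set A} {s : A} (hs : IsUnit s)
    (h : s ∈ Subalgebra.centralizer K S) :
    IsUnit (⟨s, h⟩ : Subalgebra.centralizer K S) := by
  obtain ⟨s, rfl⟩ := hs
  have h' : ((s⁻¹ : Aˣ) : A) ∈ Subalgebra.centralizer K S := fun x hx =>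
    (Commute.units_inv_right (h x hx)).eq
  exact ⟨⟨⟨s, h⟩, ⟨_, h'⟩, Subtype.ext s.mul_inv, Subtype.ext s.inv_mul⟩, rfl⟩

theorem exists_corner {n : ℕ} [NeZero n] {ζ : K} (hζ : IsPrimitiveRoot ζ n) {X Y : A}
    (hX : X ^ n = 1) (hY : IsUnit Y) (hYX : Y * X = ζ • (X * Y)) :
    ∃ (H : Type w) (_ : Ring H) (_ : Algebra K H) (_ : IsCornerOf K A n H)
      (π : Subalgebra.centralizer K {X} →ₐ[K] H), ∀ hm, π ⟨X, hm⟩ = 1 := by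
  obtain ⟨H, _, _, φ, π, hπ⟩ := exists_algEquiv_matrix_of_root_of_one hζ hX hY.unit hYX
  exact ⟨H, _, _, .of_algEquiv φ, π, fun _ => hπ⟩

/-- Two commuting elements `X₁`, `X₂` whose `n`-th powers are `1`, together with units permuting
their eigenspaces cyclically, split off a matrix algebra of size `n * n`. -/
theorem exists_corner_two {n : ℕ} [NeZero n] {ζ₁ ζ₂ : K} (hζ₁ : IsPrimitiveRoot ζ₁ n)
    (hζ₂ : IsPrimitiveRoot ζ₂ n) {X₁ Y₁ X₂ Y₂ : A} (hX₁ : X₁ ^ n = 1) (hX₂ : X₂ ^ n = 1)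
    (hY₁ : IsUnit Y₁) (hY₂ : IsUnit Y₂) (hYX₁ : Y₁ * X₁ = ζ₁ • (X₁ * Y₁))
    (hYX₂ : Y₂ * X₂ = ζ₂ • (X₂ * Y₂)) (hXX : Commute X₁ X₂) (hXY : Commute X₁ Y₂) :
    ∃ (H : Type w) (_ : Ring H) (_ : Algebra K H) (_ : IsCornerOf K A (n * n) H)
      (π : Subalgebra.centralizer K {X₁, X₂} →ₐ[K] H),
        (∀ hm, π ⟨X₁, hm⟩ = 1) ∧ ∀ hm, π ⟨X₂, hm⟩ = 1 := by
  obtain ⟨H₁, _, _, hH₁, π₁, hπ₁⟩ := exists_corner hζ₁ hX₁ hY₁ hYX₁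
  let X₂' : Subalgebra.centralizer K {X₁} := ⟨X₂, mem_centralizer_of_commute hXX⟩
  let Y₂' : Subalgebra.centralizer K {X₁} := ⟨Y₂, mem_centralizer_of_commute hXY⟩
  have hY₂' : IsUnit Y₂' := isUnit_mk_centralizer hY₂ _
  obtain ⟨H, _, _, hH, π₂, hπ₂⟩ := exists_corner hζ₂ (X := π₁ X₂') (Y := π₁ Y₂')
    (by rw [← map_pow, show X₂' ^ n = 1 from Subtype.ext hX₂, map_one]) (hY₂'.map π₁)
    (by rw [← map_mul, ← map_mul, ← map_smul]; exact congrArg π₁ (Subtype.ext hYX₂))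
  have hle : Subalgebra.centralizer K {X₁, X₂} ≤ Subalgebra.centralizer K {X₁} :=
    Subalgebra.centralizer_le K _ _ (by simp)
  let ψ : Subalgebra.centralizer K {X₁, X₂} →ₐ[K] Subalgebra.centralizer K {π₁ X₂'} :=
    (π₁.comp (Subalgebra.inclusion hle)).codRestrict _ (fun c => by
      rw [Subalgebra.mem_centralizer_iff]
      rintro _ rfl
      have h1 : X₂' * Subalgebra.inclusion hle c = Subalgebra.inclusion hle c * X₂' :=
        Subtype.ext ((Subalgebra.mem_centralizer_iff K).1 c.2 X₂ (by simp))
      exact (map_mul π₁ _ _).symm.trans (congr(π₁ $h1).trans (map_mul π₁ _ _)))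
  refine ⟨H, _, _, hH₁.trans hH, π₂.comp ψ, fun hm => ?_, fun hm => ?_⟩
  · have h1 : ψ ⟨X₁, hm⟩ = 1 := Subtype.ext (hπ₁ _)
    rw [AlgHom.comp_apply, h1, map_one]
  · exact hπ₂ (ψ ⟨X₂, hm⟩).2

end Corner

section Symbols

variable {K : Type u} [Field K]

open SymbolAlgebra

theorem isUnit_genX {n : ℕ} [NeZero n] {ρ a b : K} (ha : a ≠ 0) : IsUnit (genX n ρ a b) := by
  rw [← isUnit_pow_iff (NeZero.ne n), genX_pow]
  exact (IsUnit.mk0 a ha).map _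

/-- The symbol algebra `(a, b ^ 3)` of degree nine is similar to the symbol algebra `(a, b)` of
degree three: `b⁻¹ y ^ 3` is a cube root of `1` whose centralizer contains `x ^ 3` and `y`, and
`y ^ 3` maps to `b` in the corner where this root is `1`. -/
theorem brauerSimilar_symbolAlgebra_pow_three {ρ a b : K} (hρ : IsPrimitiveRoot ρ 9) (ha : a ≠ 0)
    (hb : b ≠ 0) :
    BrauerSimilar K (SymbolAlgebra 9 ρ a (b ^ 3)) (SymbolAlgebra 3 (ρ ^ 3) a b) := by
  have hζ : IsPrimitiveRoot (ρ ^ 3) 3 := hρ.pow (by norm_num) (by norm_num)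
  have hb3 : b ^ 3 ≠ 0 := pow_ne_zero 3 hb
  have hρ0 : ρ ≠ 0 := hρ.ne_zero (by norm_num)
  let x := genX 9 ρ a (b ^ 3)
  let y := genY 9 ρ a (b ^ 3)
  have hyx : y * x = ρ • (x * y) := genY_mul_genX
  have hy3x : x * y ^ 3 = (ρ ^ 3)⁻¹ • (y ^ 3 * x) := by
    rw [← inv_pow]
    exact skew_pow (by rw [hyx, smul_smul, inv_mul_cancel₀ hρ0, one_smul]) 3
  have hX : (b⁻¹ • y ^ 3) ^ 3 = 1 := by
    rw [smul_pow, ← pow_mul, show y ^ (3 * 3) = _ from genY_pow, Algebra.algebraMap_eq_smul_one,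
      smul_smul, inv_pow, inv_mul_cancel₀ hb3, one_smul]
  obtain ⟨H, _, _, hH, π, hπ⟩ := exists_corner hζ.inv hX (isUnit_genX (n := 9) (ρ := ρ) ha)
    (by
      change x * (b⁻¹ • y ^ 3) = _ • (b⁻¹ • y ^ 3 * x)
      rw [mul_smul_comm, hy3x, smul_mul_assoc, smul_comm])
  have hfin := hH.finrank_eq
  rw [SymbolAlgebra.finrank_eq hρ ha hb3] at hfin
  have : Nontrivial H := Module.nontrivial_of_finrank_pos (R := K) (by omega)
  have hyc : Commute (b⁻¹ • y ^ 3) y := (Commute.pow_self y 3).smul_left _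
  have hxc : Commute (b⁻¹ • y ^ 3) (x ^ 3) := by
    refine Commute.smul_left ?_ _
    have h1 : y ^ 3 * x = ρ ^ 3 • (x * y ^ 3) := by
      rw [hy3x, smul_smul, mul_inv_cancel₀ (pow_ne_zero 3 hρ0), one_smul]
    have h2 := skew_pow h1 3
    rwa [hζ.pow_eq_one, one_smul] at h2
  let x' : Subalgebra.centralizer K {b⁻¹ • y ^ 3} := ⟨x ^ 3, mem_centralizer_of_commute hxc⟩
  let y' : Subalgebra.centralizer K {b⁻¹ • y ^ 3} := ⟨y, mem_centralizer_of_commute hyc⟩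
  have hxy : y' * x' = ρ ^ 3 • (x' * y') := Subtype.ext (skew_pow hyx 3)
  obtain ⟨e⟩ := SymbolAlgebra.nonempty_algEquiv hζ ha hb (H := H) (by omega)
    (x := π x') (y := π y')
    (by
      rw [← map_pow, ← AlgHom.commutes π]
      refine congrArg π (Subtype.ext ?_)
      change (x ^ 3) ^ 3 = algebraMap K _ a
      rw [← pow_mul]
      exact genX_pow)
    (by
      have h1 : y' ^ 3 = b • ⟨b⁻¹ • y ^ 3, mem_centralizer_of_commute (Commute.refl _)⟩ :=
        Subtype.ext (by
        change y ^ 3 = b • b⁻¹ • y ^ 3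
        rw [smul_smul, mul_inv_cancel₀ hb, one_smul])
      rw [← map_pow, h1, map_smul, hπ, Algebra.algebraMap_eq_smul_one])
    (by rw [← map_mul, hxy, map_smul, map_mul])
  exact hH.similar.trans (.of_algEquiv e.symm)

theorem skew_tmul {A B : Type*} [Ring A] [Algebra K A] [Ring B] [Algebra K B] {s x : A} {s' x' : B}
    {c c' d : K} (h : s * x = c • (x * s)) (h' : s' * x' = c' • (x' * s')) (hd : c * c' = d) :
    (s ⊗ₜ[K] s') * (x ⊗ₜ[K] x') = d • ((x ⊗ₜ[K] x') * (s ⊗ₜ[K] s')) := by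
  simp only [Algebra.TensorProduct.tmul_mul_tmul, h, h', TensorProduct.smul_tmul_smul, hd]

theorem skew_smul {A : Type*} [Ring A] [Algebra K A] {s x : A} {c : K} (r : K)
    (h : s * x = c • (x * s)) : s * (r • x) = c • (r • x * s) := by
  rw [mul_smul_comm, h, smul_mul_assoc, smul_comm]

theorem tmul_pow_eq_smul_one {A B : Type*} [Ring A] [Algebra K A] [Ring B] [Algebra K B] {x : A}
    {y : B} {a b : K} {n : ℕ} (hx : x ^ n = a • 1) (hy : y ^ n = b • 1) :
    (x ⊗ₜ[K] y) ^ n = (a * b) • 1 := by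
  rw [Algebra.TensorProduct.tmul_pow, hx, hy, TensorProduct.smul_tmul_smul,
    Algebra.TensorProduct.one_def]

theorem skew_one_left {A : Type*} [Ring A] [Algebra K A] (x : A) :
    (1 : A) * x = (1 : K) • (x * 1) := by
  simp

theorem skew_one_right {A : Type*} [Ring A] [Algebra K A] (s : A) :
    s * (1 : A) = (1 : K) • (1 * s) := by
  simp

theorem isUnit_of_pow_eq_smul_one {A : Type*} [Ring A] [Algebra K A] {x : A} {c : K} {n : ℕ}
    (hn : n ≠ 0) (hc : c ≠ 0) (h : x ^ n = c • 1) : IsUnit x := by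
  rw [← isUnit_pow_iff hn, h, ← Algebra.algebraMap_eq_smul_one]
  exact (IsUnit.mk0 c hc).map _

/-- The third tensor power of an algebra of dimension nine that is generated by two skew-commuting
elements `x`, `y` is split: the commuting elements `x ⊗ x² ⊗ 1`, `1 ⊗ x ⊗ x²` and `y ⊗ y ⊗ y` have
scalar cubes and cut out a corner of dimension one. -/
theorem brauerSimilar_tensor_three_of_skew {S : Type u} [Ring S] [Algebra K S] {ζ a b : K}
    (hζ : IsPrimitiveRoot ζ 3) (ha : a ≠ 0) (hb : b ≠ 0) (hfin : Module.finrank K S = 3 ^ 2)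
    {x y : S} (hx : x ^ 3 = a • 1) (hy : y ^ 3 = b • 1) (hyx : y * x = ζ • (x * y)) :
    BrauerSimilar K (S ⊗[K] (S ⊗[K] S)) K := by
  have : FiniteDimensional K S := Module.finite_of_finrank_pos (by omega)
  have hζ0 : ζ ≠ 0 := hζ.ne_zero (by norm_num)
  have hζ3 : ζ ^ 3 = 1 := hζ.pow_eq_one
  have hyx2 : y * x ^ 2 = ζ ^ 2 • (x ^ 2 * y) := skew_pow hyx 2
  have hxy : x * y = ζ⁻¹ • (y * x) := by rw [hyx, smul_smul, inv_mul_cancel₀ hζ0, one_smul]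
  have hx2 : (x ^ 2) ^ 3 = (a ^ 2) • 1 := by
    rw [← pow_mul, mul_comm, pow_mul, hx, smul_pow, one_pow]
  have h1 : (1 : S) ^ 3 = (1 : K) • 1 := by simp
  have comm {s t : S ⊗[K] (S ⊗[K] S)} (h : s * t = (1 : K) • (t * s)) : Commute s t := by
    rwa [one_smul] at h
  have norm {z : S ⊗[K] (S ⊗[K] S)} {c d : K} (h : z ^ 3 = c • 1) (hc : d ^ 3 * c = 1) :
      (d • z) ^ 3 = 1 := by rw [smul_pow, h, smul_smul, hc, one_smul]
  have hX₁ := norm (tmul_pow_eq_smul_one hx (tmul_pow_eq_smul_one hx2 h1)) (d := a⁻¹)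
    (by field_simp)
  have hX₂ := norm (tmul_pow_eq_smul_one h1 (tmul_pow_eq_smul_one hx hx2)) (d := a⁻¹)
    (by field_simp)
  have hW := norm (tmul_pow_eq_smul_one hy (tmul_pow_eq_smul_one hy hy)) (d := b⁻¹) (by field_simp)
  have hY₁ := isUnit_of_pow_eq_smul_one three_ne_zero (by simpa using hb)
    (tmul_pow_eq_smul_one hy (tmul_pow_eq_smul_one h1 h1))
  have hY₂ := isUnit_of_pow_eq_smul_one three_ne_zero (by simpa using hb)
    (tmul_pow_eq_smul_one h1 (tmul_pow_eq_smul_one h1 hy))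
  have hV := isUnit_of_pow_eq_smul_one three_ne_zero (by simpa using ha)
    (tmul_pow_eq_smul_one hx (tmul_pow_eq_smul_one h1 h1))
  have hxx : x * x = (1 : K) • (x * x) := (one_smul K _).symm
  have hxx2 : x * x ^ 2 = (1 : K) • (x ^ 2 * x) := by rw [one_smul, ← pow_succ, ← pow_succ']
  have h11 : (1 : S) * 1 = (1 : K) • (1 * 1) := skew_one_left 1
  have hX₂X₁ : Commute (a⁻¹ • (1 : S) ⊗ₜ[K] (x ⊗ₜ[K] (x ^ 2)))
      (a⁻¹ • x ⊗ₜ[K] ((x ^ 2) ⊗ₜ[K] (1 : S))) :=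
    (comm (skew_tmul (skew_one_left x) (skew_tmul hxx2 (skew_one_right (x ^ 2)) rfl)
      (by simp))).smul_left _ |>.smul_right _
  have hY₂X₁ : Commute ((1 : S) ⊗ₜ[K] ((1 : S) ⊗ₜ[K] y)) (a⁻¹ • x ⊗ₜ[K] ((x ^ 2) ⊗ₜ[K] (1 : S))) :=
    (comm (skew_tmul (skew_one_left x) (skew_tmul (skew_one_left _) (skew_one_right y) rfl)
      (by simp))).smul_right _
  obtain ⟨H, _, _, hH, π, -, -⟩ := exists_corner_two hζ (hζ.pow_of_coprime 2 (by norm_num))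
    hX₁ hX₂ hY₁ hY₂
    (skew_smul _ (skew_tmul hyx (skew_tmul (skew_one_left _) h11 rfl) (by simp)))
    (skew_smul _ (skew_tmul h11 (skew_tmul (skew_one_left _) hyx2 rfl) (by simp)))
    hX₂X₁.symm hY₂X₁.symm
  have hWX₁ : Commute (b⁻¹ • y ⊗ₜ[K] (y ⊗ₜ[K] y)) (a⁻¹ • x ⊗ₜ[K] ((x ^ 2) ⊗ₜ[K] (1 : S))) :=
    (comm (skew_tmul hyx (skew_tmul hyx2 (skew_one_right y) rfl)
      (by linear_combination hζ3))).smul_left _ |>.smul_right _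
  have hWX₂ : Commute (b⁻¹ • y ⊗ₜ[K] (y ⊗ₜ[K] y)) (a⁻¹ • (1 : S) ⊗ₜ[K] (x ⊗ₜ[K] (x ^ 2))) :=
    (comm (skew_tmul (skew_one_right y) (skew_tmul hyx hyx2 rfl)
      (by linear_combination hζ3))).smul_left _ |>.smul_right _
  have hVX₁ : Commute (x ⊗ₜ[K] ((1 : S) ⊗ₜ[K] (1 : S))) (a⁻¹ • x ⊗ₜ[K] ((x ^ 2) ⊗ₜ[K] (1 : S))) :=
    (comm (skew_tmul hxx (skew_tmul (skew_one_left _) h11 rfl) (by simp))).smul_right _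
  have hVX₂ : Commute (x ⊗ₜ[K] ((1 : S) ⊗ₜ[K] (1 : S))) (a⁻¹ • (1 : S) ⊗ₜ[K] (x ⊗ₜ[K] (x ^ 2))) :=
    (comm (skew_tmul (skew_one_right x) (skew_tmul (skew_one_left _) (skew_one_left _) rfl)
      (by simp))).smul_right _
  let W' : Subalgebra.centralizer K _ := ⟨_, mem_centralizer_pair_of_commute hWX₁.symm hWX₂.symm⟩
  let V' : Subalgebra.centralizer K _ := ⟨_, mem_centralizer_pair_of_commute hVX₁.symm hVX₂.symm⟩
  have hVW : V' * W' = ζ⁻¹ • (W' * V') := Subtype.ext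
    (skew_smul _ (skew_tmul hxy (skew_tmul (skew_one_left _) (skew_one_left _) rfl) (by simp)))
  obtain ⟨H', _, _, hH', -, -⟩ := exists_corner hζ.inv (X := π W') (Y := π V')
    (by rw [← map_pow, show W' ^ 3 = 1 from Subtype.ext hW, map_one])
    ((isUnit_mk_centralizer hV _).map π)
    (by rw [← map_mul, hVW, map_smul, map_mul])
  have h9 := (hH.trans hH').finrank_eq
  rw [Module.finrank_tensorProduct, Module.finrank_tensorProduct, hfin] at h9
  obtain ⟨e⟩ := nonempty_algEquiv_of_finrank_eq_one (K := K) (H := H') (by omega)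
  exact (hH.trans hH').similar.trans (.of_algEquiv e)

/-- The class of a symbol algebra of degree three is killed by three. -/
theorem brauerSimilar_symbolAlgebra_tensor_three {ζ a b : K} (hζ : IsPrimitiveRoot ζ 3)
    (ha : a ≠ 0) (hb : b ≠ 0) :
    BrauerSimilar K (SymbolAlgebra 3 ζ a b ⊗[K] (SymbolAlgebra 3 ζ a b ⊗[K] SymbolAlgebra 3 ζ a b))
      K :=
  brauerSimilar_tensor_three_of_skew hζ ha hb (SymbolAlgebra.finrank_eq hζ ha hb)
    (genX_pow.trans (Algebra.algebraMap_eq_smul_one a))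
    (genY_pow.trans (Algebra.algebraMap_eq_smul_one b)) genY_mul_genX

/-- If `A ⊗ B ∼ C` and the third tensor powers of `B` and `C` are split, then so is that of `A`. -/
theorem brauerSimilar_tensor_three {A B C : Type*} [Ring A] [Algebra K A] [Ring B] [Algebra K B]
    [Ring C] [Algebra K C] (hAB : BrauerSimilar K (A ⊗[K] B) C)
    (hB : BrauerSimilar K (B ⊗[K] (B ⊗[K] B)) K) (hC : BrauerSimilar K (C ⊗[K] (C ⊗[K] C)) K) :
    BrauerSimilar K (A ⊗[K] (A ⊗[K] A)) K :=
  (BrauerSimilar.tensor_split hB).symm.trans <|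
    (BrauerSimilar.of_algEquiv
      ((Algebra.TensorProduct.tensorTensorTensorComm K K K K A (A ⊗[K] A) B (B ⊗[K] B)).trans
        (Algebra.TensorProduct.congr AlgEquiv.refl
          (Algebra.TensorProduct.tensorTensorTensorComm K K K K A A B B)))).trans <|
    (hAB.tensor (hAB.tensor hAB)).trans hC

end Symbols

/-! ### Cubic elements -/

section Cubic

open Polynomial

variable {K : Type*} [Field K] {A : Type*} [Ring A] [Algebra K A]

theorem skew_of_commute {a b : A} (h : Commute a b) : a * b = (1 : K) • (b * a) :=
  h.eq.trans (one_smul K _).symm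

theorem add_pow_three_of_skew {ζ : K} (hζ : IsPrimitiveRoot ζ 3) {s t : A}
    (h : t * s = ζ • (s * t)) : (s + t) ^ 3 = s ^ 3 + t ^ 3 := by
  have hsum : 1 + ζ + ζ ^ 2 = 0 := by
    have := hζ.geom_sum_eq_zero (by norm_num)
    simpa [Finset.sum_range_succ] using this
  have h1 : t * s * s = (ζ ^ 2) • (s * s * t) := by
    rw [h, smul_mul_assoc, mul_assoc, h, mul_smul_comm, smul_smul, sq, mul_assoc]
  have h2 : t * t * s = (ζ ^ 2) • (s * t * t) := by
    rw [mul_assoc, h, mul_smul_comm, ← mul_assoc, h, smul_mul_assoc, smul_smul, sq]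
  have h3 : s * t * s = ζ • (s * s * t) := by rw [mul_assoc, h, mul_smul_comm, mul_assoc]
  have h4 : t * s * t = ζ • (s * t * t) := by rw [h, smul_mul_assoc]
  have h5 : (s + t) ^ 3 = s ^ 3 + t ^ 3 + (1 + ζ + ζ ^ 2) • (s * s * t) +
      (1 + ζ + ζ ^ 2) • (s * t * t) := by
    simp only [pow_succ, pow_zero, one_mul, mul_add, add_mul, h1, h2, h3, h4, add_smul, one_smul]
    abel
  rw [h5, hsum, zero_smul, zero_smul, add_zero, add_zero]

/-- Cardano's substitution: a root of `X ^ 3 - 3 m l X - (l + m ^ 3 l ^ 2)` has the form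
`t + m t ^ 2` with `t ^ 3 = l`. -/
theorem exists_cube_root_of_cubic {l m : K} (hk : 1 - m ^ 3 * l ≠ 0) {w : A}
    (hw : aeval w (X ^ 3 - C (3 * m * l) * X - C (l + m ^ 3 * l ^ 2)) = 0) :
    ∃ t ∈ Algebra.adjoin K {w}, t ^ 3 = algebraMap K A l ∧ w = t + m • t ^ 2 := by
  let k := 1 - m ^ 3 * l
  -- solving `w = t + m t ^ 2`, `w ^ 2 = 2 m l + m ^ 2 l t + t ^ 2` for `t`
  let T : K[X] := C k⁻¹ * (X - C m * X ^ 2 + C (2 * m ^ 2 * l))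
  have hk' : (C k⁻¹ : K[X]) * (1 - C m ^ 3 * C l) = 1 := by
    rw [show (1 - C m ^ 3 * C l : K[X]) = C k by simp [k], ← C_mul, inv_mul_cancel₀ hk, C_1]
  refine ⟨aeval w T, aeval_mem_adjoin_singleton K w, ?_, ?_⟩
  · have h1 : T ^ 3 - C l = C k⁻¹ ^ 3 * ((X ^ 3 - C (3 * m * l) * X - C (l + m ^ 3 * l ^ 2)) *
        (-C m ^ 3 * X ^ 3 + 3 * C m ^ 2 * X ^ 2 + (3 * C m ^ 4 * C l - 3 * C m) * X +
          (1 - 4 * C m ^ 3 * C l - C m ^ 6 * C l ^ 2))) := by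
      simp only [T, C_mul, C_add, C_pow, C_ofNat]
      linear_combination C l * ((C k⁻¹ * (1 - C m ^ 3 * C l)) ^ 2 +
        C k⁻¹ * (1 - C m ^ 3 * C l) + 1) * hk'
    have h3 := congr(aeval w $h1)
    rw [map_mul _ (C k⁻¹ ^ 3), map_mul, hw, zero_mul, mul_zero, map_sub, map_pow, aeval_C,
      sub_eq_zero] at h3
    exact h3
  · have h1 : T + C m * T ^ 2 - X = C k⁻¹ ^ 2 *
        ((X ^ 3 - C (3 * m * l) * X - C (l + m ^ 3 * l ^ 2)) * (C m ^ 3 * X - 2 * C m ^ 2)) := by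
      simp only [T, C_mul, C_add, C_pow, C_ofNat]
      linear_combination (X * (C k⁻¹ * (1 - C m ^ 3 * C l) + 1) -
        C k⁻¹ * (X - C m * X ^ 2 + 2 * C m ^ 2 * C l)) * hk'
    have h3 := congr(aeval w $h1)
    rw [map_mul _ (C k⁻¹ ^ 2), map_mul, hw, zero_mul, mul_zero, map_sub, aeval_X, sub_eq_zero,
      map_add, map_mul _ (C m), aeval_C, map_pow, ← Algebra.smul_def] at h3
    exact h3.symm

theorem irreducible_X_pow_nine_sub_C {γ : K} (h : ∀ c, c ^ 3 ≠ γ) :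
    Irreducible (X ^ 9 - C γ : K[X]) :=
  X_pow_sub_C_irreducible_of_prime_pow Nat.prime_three (by norm_num) 2 h

end Cubic

/-! ### Identification of the tensor product with a symbol algebra -/

section Identification

open Polynomial SymbolAlgebra

variable {K : Type u} [Field K] {C : Type v} [Ring C] [Algebra K C] [FiniteDimensional K C]
  [IsSimpleRing C] [Algebra.IsCentral K C]

/-- If `v ^ 9 = γ` for some `v` in a central simple algebra `C` of degree nine, then
`C ⊗ (g, γ⁻¹)` has a corner of degree nine containing a ninth root of `γ`: with `q` the second
generator of the symbol algebra, `(v ⊗ q) ^ 9 = 1` and `v ⊗ 1` commutes with `v ⊗ q`. -/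
theorem exists_brauerSimilar_tensor_of_pow_nine {ρ : K} (hρ : IsPrimitiveRoot ρ 9)
    (hC : Module.finrank K C = 81) {g γ : K} (hg : g ≠ 0) (hγ : γ ≠ 0)
    (hγ3 : ∀ c, c ^ 3 ≠ γ) {v : C} (hv : v ^ 9 = algebraMap K C γ) :
    ∃ c ≠ 0, BrauerSimilar K (C ⊗[K] SymbolAlgebra 9 ρ g γ⁻¹) (SymbolAlgebra 9 ρ c γ) := by
  have hρ0 : ρ ≠ 0 := hρ.ne_zero (by norm_num)
  have hγi : γ⁻¹ ≠ 0 := inv_ne_zero hγ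
  let p := genX 9 ρ g γ⁻¹
  let q := genY 9 ρ g γ⁻¹
  have hqp : q * p = ρ • (p * q) := genY_mul_genX
  have hpq : p * q = ρ⁻¹ • (q * p) := by rw [hqp, smul_smul, inv_mul_cancel₀ hρ0, one_smul]
  have := SymbolAlgebra.isSimpleRing hρ hg hγi
  have := SymbolAlgebra.isCentral hρ hg hγi
  have hv' : v ^ 9 = γ • 1 := hv.trans (Algebra.algebraMap_eq_smul_one γ)
  have hq : q ^ 9 = γ⁻¹ • 1 := genY_pow.trans (Algebra.algebraMap_eq_smul_one _)
  have hp : p ^ 9 = g • 1 := genX_pow.trans (Algebra.algebraMap_eq_smul_one _)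
  have hX : (v ⊗ₜ[K] q) ^ 9 = 1 := by
    rw [tmul_pow_eq_smul_one hv' hq, mul_inv_cancel₀ hγ, one_smul]
  have hY : IsUnit ((1 : C) ⊗ₜ[K] p) := isUnit_of_pow_eq_smul_one (n := 9) (by norm_num)
    (by simpa using hg) (tmul_pow_eq_smul_one (a := 1) (by simp) hp)
  obtain ⟨H, _, _, hH, π, -⟩ := exists_corner hρ.inv hX hY
    (skew_tmul (skew_one_left v) hpq (one_mul _))
  have hθ : Commute (v ⊗ₜ[K] q) (v ⊗ₜ[K] 1) := by
    rw [Commute, SemiconjBy, Algebra.TensorProduct.tmul_mul_tmul,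
      Algebra.TensorProduct.tmul_mul_tmul, one_mul, mul_one]
  have hfin := hH.finrank_eq
  rw [Module.finrank_tensorProduct, hC, SymbolAlgebra.finrank_eq hρ hg hγi] at hfin
  have := hH.isSimpleRing inferInstance
  have := hH.isCentral inferInstance
  have := hH.finiteDimensional inferInstance
  obtain ⟨c, hc, ⟨e⟩⟩ := exists_symbolAlgebra_equiv hρ (H := H) (by omega) hγ
    (θ := π ⟨v ⊗ₜ[K] 1, mem_centralizer_of_commute hθ⟩) (by
      rw [← map_pow, ← AlgHom.commutes π]
      refine congrArg π (Subtype.ext ?_)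
      change (v ⊗ₜ[K] (1 : SymbolAlgebra 9 ρ g γ⁻¹)) ^ 9 = algebraMap K _ γ
      rw [tmul_pow_eq_smul_one hv' (b := 1) (by simp), mul_one, Algebra.algebraMap_eq_smul_one])
    (irreducible_X_pow_nine_sub_C hγ3)
  exact ⟨c, hc, hH.similar.trans (.of_algEquiv e.symm)⟩

/-- If `v ^ 3 = t + m t ^ 2` with `t ^ 3 = l`, and `v` skew-commutes with a cube root `x` of `g`,
then `C ⊗ (g, -g ^ 3 l⁻¹)` has a corner of dimension `81` containing a ninth root of
`-(g m) ^ 3 l`: the commuting elements `x ⊗ p⁻³ = g⁻¹ x ⊗ p ^ 6` and `-g⁻¹ t ⊗ q ^ 3` are cube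
roots of `1`, they commute with `θ = x ⊗ 1 + v ⊗ q`, and `θ ^ 3 = g + t ⊗ q ^ 3 + m t ^ 2 ⊗ q ^ 3`
maps to `-g m t` in the corner where both are `1`. Here `p` and `q` are the generators of the
symbol algebra. -/
theorem exists_brauerSimilar_tensor_of_cubic {ρ : K} (hρ : IsPrimitiveRoot ρ 9)
    (hC : Module.finrank K C = 81) {g l m : K} (hg : g ≠ 0) (hl : l ≠ 0) (hm : m ≠ 0)
    (hl3 : ∀ c, c ^ 3 ≠ l) {x v t : C} (hx : x ^ 3 = algebraMap K C g)
    (hvx : v * x = ρ ^ 3 • (x * v)) (ht : t ^ 3 = algebraMap K C l)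
    (htv : t ∈ Algebra.adjoin K {v ^ 3}) (hv : v ^ 3 = t + m • t ^ 2) :
    ∃ c ≠ 0, BrauerSimilar K (C ⊗[K] SymbolAlgebra 9 ρ g ((-g) ^ 3 * l⁻¹))
      (SymbolAlgebra 9 ρ c (-(g * m) ^ 3 * l)) := by
  have hρ0 : ρ ≠ 0 := hρ.ne_zero (by norm_num)
  have hρ9 : ρ ^ 9 = 1 := hρ.pow_eq_one
  have hζ : IsPrimitiveRoot (ρ ^ 3) 3 := hρ.pow (by norm_num) (by norm_num)
  let d := (-g) ^ 3 * l⁻¹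
  have hd : d ≠ 0 := mul_ne_zero (pow_ne_zero 3 (neg_ne_zero.2 hg)) (inv_ne_zero hl)
  let S := SymbolAlgebra 9 ρ g d
  let p : S := genX 9 ρ g d
  let q : S := genY 9 ρ g d
  have hqp : q * p = ρ • (p * q) := genY_mul_genX
  have hpq : p * q = ρ⁻¹ • (q * p) := by rw [hqp, smul_smul, inv_mul_cancel₀ hρ0, one_smul]
  have hp : p ^ 9 = g • 1 := genX_pow.trans (Algebra.algebraMap_eq_smul_one _)
  have hq : q ^ 9 = d • 1 := genY_pow.trans (Algebra.algebraMap_eq_smul_one _)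
  have : IsSimpleRing S := SymbolAlgebra.isSimpleRing hρ hg hd
  have : Algebra.IsCentral K S := SymbolAlgebra.isCentral hρ hg hd
  have : FiniteDimensional K S := inferInstance
  have hfinS : Module.finrank K S = 9 ^ 2 := SymbolAlgebra.finrank_eq hρ hg hd
  have hx' : x ^ 3 = g • 1 := hx.trans (Algebra.algebraMap_eq_smul_one _)
  have ht' : t ^ 3 = l • 1 := ht.trans (Algebra.algebraMap_eq_smul_one _)
  -- commutation in `C`
  have hcomm {y : C} (hy : Commute y (v ^ 3)) : Commute y t := by
    have hle : Algebra.adjoin K {v ^ 3} ≤ Subalgebra.centralizer K {y} :=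
      Algebra.adjoin_le (by
        rintro _ rfl
        exact mem_centralizer_of_commute hy)
    exact (Subalgebra.mem_centralizer_iff K).1 (hle htv) y rfl
  have hvt : Commute v t := hcomm (Commute.self_pow v 3)
  have hxt : Commute x t := hcomm (by
    have h0 : x * v = (ρ ^ 3)⁻¹ • (v * x) := by
      rw [hvx, smul_smul, inv_mul_cancel₀ (pow_ne_zero 3 hρ0), one_smul]
    have h1 := skew_pow h0 3
    rwa [inv_pow, ← pow_mul, hρ9, inv_one, one_smul] at h1)
  have comm {a b : C ⊗[K] S} (h : a * b = (1 : K) • (b * a)) : Commute a b := by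
    rwa [one_smul] at h
  -- the two cube roots of one
  let X₁ : C ⊗[K] S := g⁻¹ • x ⊗ₜ[K] (p ^ 6)
  let X₂ : C ⊗[K] S := (-g⁻¹) • t ⊗ₜ[K] (q ^ 3)
  have hX₁ : X₁ ^ 3 = 1 := by
    rw [_root_.smul_pow, tmul_pow_eq_smul_one hx' (b := g ^ 2) (by
      rw [← pow_mul, show 6 * 3 = 9 * 2 from rfl, pow_mul, hp, _root_.smul_pow, one_pow]),
      smul_smul,
      show g⁻¹ ^ 3 * (g * g ^ 2) = 1 by field_simp, one_smul]
  have hX₂ : X₂ ^ 3 = 1 := by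
    rw [_root_.smul_pow, tmul_pow_eq_smul_one ht' (b := d) (by rw [← pow_mul, hq]), smul_smul,
      show (-g⁻¹) ^ 3 * (l * ((-g) ^ 3 * l⁻¹)) = 1 by field_simp, one_smul]
  have hY₁ : IsUnit ((1 : C) ⊗ₜ[K] q) := isUnit_of_pow_eq_smul_one (n := 9) (by norm_num)
    (by simpa using hd) (tmul_pow_eq_smul_one (a := 1) (by simp) hq)
  have hY₂ : IsUnit ((1 : C) ⊗ₜ[K] p) := isUnit_of_pow_eq_smul_one (n := 9) (by norm_num)
    (by simpa using hg) (tmul_pow_eq_smul_one (a := 1) (by simp) hp)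
  have hqp6 : q * p ^ 6 = ρ ^ 6 • (p ^ 6 * q) := skew_pow hqp 6
  have hpq3 : p * q ^ 3 = ρ⁻¹ ^ 3 • (q ^ 3 * p) := skew_pow hpq 3
  have hpq6 : p ^ 6 * q ^ 3 = (1 : K) • (q ^ 3 * p ^ 6) := by
    have h0 : q ^ 3 * p = ρ ^ 3 • (p * q ^ 3) := by
      rw [hpq3, smul_smul, ← mul_pow, mul_inv_cancel₀ hρ0, one_pow, one_smul]
    have h1 := skew_pow h0 6
    rw [← pow_mul, show 3 * 6 = 9 * 2 from rfl, pow_mul, hρ9, one_pow, one_smul] at h1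
    rw [h1, one_smul]
  have hX₁X₂ : Commute X₁ X₂ :=
    ((comm (skew_tmul (skew_of_commute hxt) hpq6 (one_mul 1))).smul_left _).smul_right _
  have hX₁Y₂ : Commute X₁ ((1 : C) ⊗ₜ[K] p) :=
    (comm (skew_tmul (skew_one_right x) (skew_of_commute (Commute.pow_self p 6))
      (one_mul 1))).smul_left _
  obtain ⟨H, _, _, hH, π, -, hπ⟩ := exists_corner_two (X₁ := X₁) (X₂ := X₂)
    (hζ.pow_of_coprime 2 (by norm_num)) hζ.inv hX₁ hX₂ hY₁ hY₂
    (skew_smul _ (skew_tmul (skew_one_left x) hqp6 (by ring)))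
    (skew_smul _ (skew_tmul (skew_one_left t) hpq3 (by rw [one_mul, inv_pow]))) hX₁X₂ hX₁Y₂
  have hfin := hH.finrank_eq
  rw [Module.finrank_tensorProduct, hC, hfinS] at hfin
  have := hH.isSimpleRing inferInstance
  have := hH.isCentral inferInstance
  have := hH.finiteDimensional inferInstance
  -- the ninth root in the corner
  let θ : C ⊗[K] S := x ⊗ₜ[K] 1 + v ⊗ₜ[K] q
  have hX₁θ : Commute X₁ θ := by
    refine Commute.smul_left (Commute.add_right ?_ (Commute.symm ?_)) _
    · exact comm (skew_tmul (skew_of_commute (Commute.refl x)) (skew_one_right _) (one_mul 1))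
    · exact comm (skew_tmul hvx hqp6 (by rw [← pow_add, hρ9]))
  have hX₂θ : Commute X₂ θ := by
    refine Commute.smul_left (Commute.add_right ?_ ?_) _
    · exact comm (skew_tmul (skew_of_commute hxt.symm) (skew_one_right _) (one_mul 1))
    · exact comm (skew_tmul (skew_of_commute hvt.symm) (skew_of_commute (Commute.pow_self q 3))
        (one_mul 1))
  have hX₁t : Commute X₁ (t ⊗ₜ[K] 1) :=
    (comm (skew_tmul (skew_of_commute hxt) (skew_one_right _) (one_mul 1))).smul_left _
  have hX₂t : Commute X₂ (t ⊗ₜ[K] 1) :=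
    (comm (skew_tmul (skew_of_commute (Commute.refl t)) (skew_one_right _) (one_mul 1))).smul_left _
  have hθ3 : θ ^ 3 = g • (1 - X₂) + (-(g * m)) • (t ⊗ₜ[K] 1 * X₂) := by
    rw [add_pow_three_of_skew hζ (skew_tmul hvx (skew_one_right q) (mul_one _)),
      tmul_pow_eq_smul_one hx' (b := 1) (by simp), mul_one, Algebra.TensorProduct.tmul_pow, hv,
      TensorProduct.add_tmul]
    simp only [X₂, mul_smul_comm, smul_sub, smul_smul, Algebra.TensorProduct.tmul_mul_tmul,
      one_mul, ← sq, ← TensorProduct.smul_tmul']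
    rw [show g * -g⁻¹ = -1 by field_simp, show -(g * m) * -g⁻¹ = m by field_simp, neg_smul,
      one_smul, sub_neg_eq_add, add_assoc]
  let θ' : Subalgebra.centralizer K {X₁, X₂} := ⟨θ, mem_centralizer_pair_of_commute hX₁θ hX₂θ⟩
  let t' : Subalgebra.centralizer K {X₁, X₂} :=
    ⟨t ⊗ₜ[K] 1, mem_centralizer_pair_of_commute hX₁t hX₂t⟩
  let X₂' : Subalgebra.centralizer K {X₁, X₂} :=
    ⟨X₂, mem_centralizer_pair_of_commute hX₁X₂ (Commute.refl _)⟩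
  have hθ3' : θ' ^ 3 = g • (1 - X₂') + (-(g * m)) • (t' * X₂') := Subtype.ext hθ3
  have ht3' : t' ^ 3 = l • 1 := Subtype.ext (by
    change (t ⊗ₜ[K] (1 : S)) ^ 3 = l • 1
    rw [tmul_pow_eq_smul_one ht' (b := 1) (by simp), mul_one])
  have hγ : -(g * m) ^ 3 * l ≠ 0 :=
    mul_ne_zero (neg_ne_zero.2 (pow_ne_zero 3 (mul_ne_zero hg hm))) hl
  obtain ⟨c, hc, ⟨e⟩⟩ := exists_symbolAlgebra_equiv hρ (H := H) (by omega) hγ (θ := π θ') (by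
      have h1 : π θ' ^ 3 = (-(g * m)) • π t' := by
        rw [← map_pow, hθ3', map_add, map_smul, map_sub, map_one, map_smul, map_mul,
          show π X₂' = 1 from hπ _, sub_self, smul_zero, zero_add, mul_one]
      refine (pow_mul (π θ') 3 3).trans ?_
      rw [h1, _root_.smul_pow, ← map_pow, ht3', map_smul, map_one, smul_smul,
        Algebra.algebraMap_eq_smul_one]
      congr 1
      ring)
    (irreducible_X_pow_nine_sub_C fun c hc => hl3 (-(g * m)⁻¹ * c) (by
      rw [mul_pow, hc]
      field_simp))
  exact ⟨c, hc, hH.similar.trans (.of_algEquiv e.symm)⟩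

end Identification

/-! ### The element `z₁ + z₂` -/

section Degree

open Polynomial

variable {K : Type u} [Field K] {C : Type v} [Ring C] [Algebra K C]

theorem skew_mul {s x y : C} {c c' d : K} (h : s * x = c • (x * s)) (h' : s * y = c' • (y * s))
    (hd : c * c' = d) : s * (x * y) = d • (x * y * s) := by
  rw [← mul_assoc, h, smul_mul_assoc, mul_assoc, h', mul_smul_comm, smul_smul, hd, mul_assoc]

theorem mulTrace_eq_zero_of_skew {s y : C} (hs : IsUnit s) {c : K} (hc : c ≠ 1)
    (h : s * y = c • (y * s)) : mulTrace K C y = 0 := by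
  obtain ⟨s, rfl⟩ := hs
  have h1 : c • y = s * (y * ((s⁻¹ : Cˣ) : C)) := by
    rw [← mul_assoc, h, smul_mul_assoc, mul_assoc, Units.mul_inv, mul_one]
  have h2 : mulTrace K C (c • y) = mulTrace K C y := by
    rw [h1, mulTrace_apply, LinearMap.mulLeft_mul, ← Module.End.mul_eq_comp,
      LinearMap.trace_mul_comm, Module.End.mul_eq_comp, ← LinearMap.mulLeft_mul, mul_assoc,
      Units.inv_mul, mul_one, mulTrace_apply]
  rw [map_smul, smul_eq_mul] at h2
  have h3 : (c - 1) * mulTrace K C y = 0 := by rw [sub_mul, h2, one_mul, sub_self]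
  exact (mul_eq_zero.1 h3).resolve_left (sub_ne_zero.2 hc)

variable [FiniteDimensional K C] [IsSimpleRing C] [Algebra.IsCentral K C]

/-- In a central division algebra of degree nine, an element `v ^ 3` that is not central has degree
three if some nonzero `x` commutes with `v ^ 3` but not with `v`: the degree divides `81`, is at
most `9`, and `K(v ^ 3)` is a proper subfield of `K(v)`. -/
theorem natDegree_minpoly_pow_three [IsDomain C] (hC : Module.finrank K C = 81) {x v : C}
    (hxv : ¬ Commute x v) (hx : Commute x (v ^ 3)) (hv : v ^ 3 ∉ (algebraMap K C).range) :
    (minpoly K (v ^ 3)).natDegree = 3 := by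
  have hint (z : C) : IsIntegral K z := IsIntegral.of_finite K z
  have hle (z : C) : (minpoly K z).natDegree ≤ 9 :=
    natDegree_minpoly_le (n := 9) hC (minpoly.irreducible (hint z))
  obtain ⟨r, hr, -⟩ := mulTrace_eq_nextCoeff (minpoly.irreducible (hint (v ^ 3)))
  have h2 : 2 ≤ (minpoly K (v ^ 3)).natDegree := (minpoly.two_le_natDegree_iff (hint _)).2 hv
  have hdvd : (minpoly K (v ^ 3)).natDegree ∣ 3 ^ 4 := ⟨r, by rw [← hr, hC]; norm_num⟩
  obtain ⟨k, hk, hk'⟩ := (Nat.dvd_prime_pow Nat.prime_three).1 hdvd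
  have h9 : (minpoly K (v ^ 3)).natDegree ≠ 9 := by
    intro h9
    have hirr := minpoly.irreducible (hint v)
    have : Fact (Irreducible (minpoly K v)) := ⟨hirr⟩
    obtain ⟨emb, hemb⟩ := exists_adjoinRoot_algHom (minpoly.aeval K v)
    let E := AdjoinRoot (minpoly K v)
    let pb := AdjoinRoot.powerBasis hirr.ne_zero
    have : FiniteDimensional K E := pb.finite
    let r : E := AdjoinRoot.root (minpoly K v)
    have hr : emb r = v := (hemb X).trans (aeval_X v)
    have hfin : Module.finrank K E = (minpoly K v).natDegree := by
      rw [pb.finrank, AdjoinRoot.powerBasis_dim]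
    have hmin : minpoly K (r ^ 3) = minpoly K (v ^ 3) := by
      rw [← minpoly.algHom_eq emb emb.toRingHom.injective, map_pow, hr]
    have htop : IntermediateField.adjoin K {r ^ 3} = ⊤ := by
      rw [Field.primitive_element_iff_minpoly_natDegree_eq, hmin, h9, hfin]
      refine le_antisymm ?_ (hle v)
      have h3 := minpoly.natDegree_le (A := K) (r ^ 3)
      rwa [hmin, h9, hfin] at h3
    have hmem : r ∈ Algebra.adjoin K {r ^ 3} := by
      rw [← IntermediateField.adjoin_simple_toSubalgebra_of_isAlgebraic
        (Algebra.IsAlgebraic.isAlgebraic _), htop]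
      exact Algebra.mem_top
    have hle' : Algebra.adjoin K {r ^ 3} ≤ (Subalgebra.centralizer K {x}).comap emb :=
      Algebra.adjoin_le (by
        rintro _ rfl
        change emb (r ^ 3) ∈ Subalgebra.centralizer K {x}
        rw [map_pow, hr]
        exact mem_centralizer_of_commute hx)
    have h4 : emb r ∈ Subalgebra.centralizer K {x} := hle' hmem
    rw [hr] at h4
    exact hxv ((Subalgebra.mem_centralizer_iff K).1 h4 x rfl)
  have := hle (v ^ 3)
  have hk2 : k < 3 := by
    by_contra! h
    have : 3 ^ 3 ≤ 3 ^ k := Nat.pow_le_pow_right (by norm_num) h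
    omega
  interval_cases k <;> omega

omit [FiniteDimensional K C] [IsSimpleRing C] [Algebra.IsCentral K C] in
/-- In a domain, a cube root of a cube is a multiple of it by a cube root of unity. -/
theorem mem_range_of_pow_three_eq [IsDomain C] {ζ c : K} (hζ : IsPrimitiveRoot ζ 3) {w : C}
    (hw : w ^ 3 = algebraMap K C (c ^ 3)) : w ∈ (algebraMap K C).range := by
  have hsum : 1 + ζ + ζ ^ 2 = 0 := by
    have := hζ.geom_sum_eq_zero (by norm_num)
    simpa [Finset.sum_range_succ] using this
  have hsum' : (1 : K[X]) + Polynomial.C ζ + Polynomial.C ζ ^ 2 = 0 := by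
    rw [← Polynomial.C_1, ← Polynomial.C_pow, ← Polynomial.C_add, ← Polynomial.C_add, hsum,
      Polynomial.C_0]
  have h1 : (X - Polynomial.C c) * ((X - Polynomial.C (ζ * c)) * (X - Polynomial.C (ζ ^ 2 * c))) =
      X ^ 3 - Polynomial.C (c ^ 3) := by
    simp only [Polynomial.C_mul, Polynomial.C_pow]
    linear_combination (-X ^ 2 * Polynomial.C c + X * Polynomial.C c ^ 2 * Polynomial.C ζ -
      Polynomial.C c ^ 3 * (Polynomial.C ζ - 1)) * hsum'
  have h2 := congr(aeval w $h1)
  simp only [map_mul, map_sub, aeval_X, aeval_C, map_pow] at h2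
  rw [hw, map_pow _ c 3, sub_self, mul_eq_zero, mul_eq_zero] at h2
  rcases h2 with h2 | h2 | h2
  · exact ⟨c, (sub_eq_zero.1 h2).symm⟩
  · exact ⟨ζ * c, by rw [map_mul]; exact (sub_eq_zero.1 h2).symm⟩
  · exact ⟨ζ ^ 2 * c, by rw [map_mul, map_pow]; exact (sub_eq_zero.1 h2).symm⟩

end Degree

namespace AbelianCrossedProduct

variable {F : Type u} {E : Type v} {A : Type w} [Field F] [Field E] [Algebra F E] [Ring A]
  [Algebra F A] {σ₁ σ₂ : E ≃ₐ[F] E} {b₁ b₂ u t₁ t₂ : E} {ζ : F}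
  (X : AbelianCrossedProduct F E A σ₁ σ₂ b₁ b₂ u)
  (h₁₁ : σ₁ t₁ = t₁) (h₂₁ : σ₂ t₁ = algebraMap F E ζ * t₁)
  (h₂₂ : σ₂ t₂ = t₂) (h₁₂ : σ₁ t₂ = algebraMap F E ζ * t₂)

theorem z₁_skew {e : E} {c : F} (h : σ₁ e = algebraMap F E c * e) :
    X.z₁ * X.emb e = c • (X.emb e * X.z₁) := by
  rw [X.z₁_mul, h, ← Algebra.smul_def, map_smul, smul_mul_assoc]

theorem z₂_skew {e : E} {c : F} (h : σ₂ e = algebraMap F E c * e) :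
    X.z₂ * X.emb e = c • (X.emb e * X.z₂) := by
  rw [X.z₂_mul, h, ← Algebra.smul_def, map_smul, smul_mul_assoc]

include h₁₁ h₂₁ in
theorem z₁_add_z₂_ne_zero (hζ : IsPrimitiveRoot ζ 3) (ht₁ : t₁ ≠ 0) : X.z₁ + X.z₂ ≠ 0 := by
  intro h
  have h1 := X.z₁_skew (c := 1) (by rw [h₁₁, map_one, one_mul])
  rw [eq_neg_of_add_eq_zero_left h, neg_mul, mul_neg, X.z₂_skew h₂₁, one_smul, neg_inj,
    ← sub_eq_zero] at h1
  have h2 : (ζ - 1) • (X.emb t₁ * X.z₂) = 0 := by rw [sub_smul, one_smul, h1]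
  have hu : IsUnit (X.emb t₁ * X.z₂) := ((IsUnit.mk0 _ ht₁).map _).mul X.isUnit_z₂
  have := X.nontrivial
  rcases smul_eq_zero.1 h2 with h2 | h2
  · exact hζ.ne_one (by norm_num) (sub_eq_zero.1 h2)
  · exact hu.ne_zero h2

include h₁₁ h₂₁ h₂₂ h₁₂ in
theorem z₁_add_z₂_skew :
    (X.z₁ + X.z₂) * X.emb (t₁ * t₂) = ζ • (X.emb (t₁ * t₂) * (X.z₁ + X.z₂)) := by
  rw [add_mul, X.z₁_skew (c := ζ) (by rw [map_mul, h₁₁, h₁₂]; ring),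
    X.z₂_skew (c := ζ) (by rw [map_mul, h₂₁, h₂₂]; ring), mul_add, smul_add]

include h₁₁ h₂₁ h₁₂ in
/-- The cube of `z₁ + z₂` has trace zero if the constant terms of `b₁` and `b₂` cancel: each term
of the remaining sum skew-commutes with one of `z₁`, `z₂`, `t₁`. -/
theorem mulTrace_z₁_add_z₂_pow_three (hζ : IsPrimitiveRoot ζ 3) (ht₁ : t₁ ≠ 0)
    {c₁ c₂ d₁ d₂ : F}
    (hb : b₁ + b₂ = algebraMap F E c₁ * t₁ + algebraMap F E c₂ * t₁ ^ 2 + algebraMap F E d₁ * t₂ +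
      algebraMap F E d₂ * t₂ ^ 2) : mulTrace F A ((X.z₁ + X.z₂) ^ 3) = 0 := by
  have hζ0 : ζ ≠ 0 := hζ.ne_zero three_ne_zero
  have hζ1 : ζ ≠ 1 := hζ.ne_one (by norm_num)
  have hζ2 : ζ ^ 2 ≠ 1 := hζ.pow_ne_one_of_pos_of_lt (by norm_num) (by norm_num)
  have hi1 : ζ⁻¹ ≠ 1 := fun h => hζ1 (inv_eq_one.1 h)
  have hi2 : (ζ ^ 2)⁻¹ ≠ 1 := fun h => hζ2 (inv_eq_one.1 h)
  have hs : IsUnit (X.emb t₁) := (IsUnit.mk0 _ ht₁).map _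
  have hs1 : X.emb t₁ * X.z₁ = (1 : F) • (X.z₁ * X.emb t₁) := by rw [X.z₁_mul, h₁₁, one_smul]
  have hs2 : X.emb t₁ * X.z₂ = ζ⁻¹ • (X.z₂ * X.emb t₁) := by
    rw [X.z₂_skew h₂₁, smul_smul, inv_mul_cancel₀ hζ0, one_smul]
  have hexp : (X.z₁ + X.z₂) ^ 3 = X.emb (b₁ + b₂) +
      (X.z₁ * (X.z₁ * X.z₂) + X.z₁ * (X.z₂ * X.z₁) + X.z₂ * (X.z₁ * X.z₁) +
        X.z₁ * (X.z₂ * X.z₂) + X.z₂ * (X.z₁ * X.z₂) + X.z₂ * (X.z₂ * X.z₁)) := by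
    rw [map_add, ← X.z₁_pow, ← X.z₂_pow]
    noncomm_ring
  have hsq {σ : E ≃ₐ[F] E} {t : E} (h : σ t = algebraMap F E ζ * t) :
      σ (t ^ 2) = algebraMap F E (ζ ^ 2) * t ^ 2 := by rw [map_pow, h, map_pow]; ring
  rw [hexp, hb]
  simp only [← Algebra.smul_def, map_add, map_smul]
  rw [mulTrace_eq_zero_of_skew X.isUnit_z₂ hζ1 (X.z₂_skew h₂₁),
    mulTrace_eq_zero_of_skew X.isUnit_z₂ hζ2 (X.z₂_skew (hsq h₂₁)),
    mulTrace_eq_zero_of_skew X.isUnit_z₁ hζ1 (X.z₁_skew h₁₂),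
    mulTrace_eq_zero_of_skew X.isUnit_z₁ hζ2 (X.z₁_skew (hsq h₁₂)),
    mulTrace_eq_zero_of_skew hs hi1 (skew_mul hs1 (skew_mul hs1 hs2 rfl) (by simp)),
    mulTrace_eq_zero_of_skew hs hi1 (skew_mul hs1 (skew_mul hs2 hs1 rfl) (by simp)),
    mulTrace_eq_zero_of_skew hs hi1 (skew_mul hs2 (skew_mul hs1 hs1 rfl) (by simp)),
    mulTrace_eq_zero_of_skew hs hi2 (skew_mul hs1 (skew_mul hs2 hs2 rfl) (by simp [sq])),
    mulTrace_eq_zero_of_skew hs hi2 (skew_mul hs2 (skew_mul hs1 hs2 rfl) (by simp [sq])),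
    mulTrace_eq_zero_of_skew hs hi2 (skew_mul hs2 (skew_mul hs2 hs1 rfl) (by simp [sq]))]
  simp

end AbelianCrossedProduct

/-! ### Descent to a quadratic extension -/

section BaseChange

open Polynomial

variable {F : Type u} [Field F] (L : Type u) [Field L] [Algebra F L]

theorem one_tmul_algebraMap {C : Type*} [Ring C] [Algebra F C] (c : F) :
    (1 : L) ⊗ₜ[F] algebraMap F C c = algebraMap L (L ⊗[F] C) (algebraMap F L c) :=
  ((Algebra.TensorProduct.includeRight : C →ₐ[F] L ⊗[F] C).commutes c).trans
    (IsScalarTower.algebraMap_apply F L (L ⊗[F] C) c)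

theorem nonempty_algEquiv_baseChange_symbolAlgebra {n : ℕ} [NeZero n] {ρ a b : F}
    (hρ : IsPrimitiveRoot ρ n) (ha : a ≠ 0) (hb : b ≠ 0) :
    Nonempty (SymbolAlgebra n (algebraMap F L ρ) (algebraMap F L a) (algebraMap F L b) ≃ₐ[L]
      L ⊗[F] SymbolAlgebra n ρ a b) := by
  have := SymbolAlgebra.nontrivial (a := a) (b := b) hρ
  refine SymbolAlgebra.nonempty_algEquiv (hρ.map_of_injective (algebraMap F L).injective)
    ((_root_.map_ne_zero _).2 ha) ((_root_.map_ne_zero _).2 hb)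
    (by rw [Module.finrank_baseChange, SymbolAlgebra.finrank_eq hρ ha hb])
    (x := 1 ⊗ₜ SymbolAlgebra.genX n ρ a b) (y := 1 ⊗ₜ SymbolAlgebra.genY n ρ a b) ?_ ?_ ?_
  · rw [Algebra.TensorProduct.tmul_pow, SymbolAlgebra.genX_pow, one_pow, one_tmul_algebraMap]
  · rw [Algebra.TensorProduct.tmul_pow, SymbolAlgebra.genY_pow, one_pow, one_tmul_algebraMap]
  · rw [Algebra.TensorProduct.tmul_mul_tmul, Algebra.TensorProduct.tmul_mul_tmul,
      SymbolAlgebra.genY_mul_genX, TensorProduct.tmul_smul, algebraMap_smul]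

variable {C : Type v} [Ring C] [Algebra F C] [FiniteDimensional F C] [IsSimpleRing C]
  [Algebra.IsCentral F C] [IsDomain C]

/-- If `v ^ 9 = γ` lies in `F`, but `v ^ 3` does not, then `C_L ⊗ (g, γ⁻¹) ∼ (c, γ)` over
extensions `L` of degree at most two. -/
theorem exists_brauerSimilar_baseChange_of_pow_nine {ρ : F} (hρ : IsPrimitiveRoot ρ 9)
    (hC : Module.finrank F C = 81) (hL0 : 0 < Module.finrank F L) (hL : Module.finrank F L ≤ 2)
    {g γ : F} (hg : g ≠ 0) {v : C} (hv9 : v ^ 9 = algebraMap F C γ)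
    (hv3 : v ^ 3 ∉ (algebraMap F C).range) :
    γ ≠ 0 ∧ ∃ c ≠ 0, BrauerSimilar L
      ((L ⊗[F] C) ⊗[L] SymbolAlgebra 9 (algebraMap F L ρ) (algebraMap F L g) (algebraMap F L γ)⁻¹)
      (SymbolAlgebra 9 (algebraMap F L ρ) c (algebraMap F L γ)) := by
  have hζ : IsPrimitiveRoot (ρ ^ 3) 3 := hρ.pow (by norm_num) (by norm_num)
  have hγ3 (c : F) : c ^ 3 ≠ γ := fun hc =>
    hv3 (mem_range_of_pow_three_eq hζ (c := c) (by rw [← pow_mul, hv9, hc]))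
  have hγ : γ ≠ 0 := fun h => hγ3 0 (by rw [h]; norm_num)
  refine ⟨hγ, exists_brauerSimilar_tensor_of_pow_nine
    (hρ.map_of_injective (algebraMap F L).injective) (by rw [Module.finrank_baseChange, hC])
    ((_root_.map_ne_zero _).2 hg) ((_root_.map_ne_zero _).2 hγ) (fun c hc => ?_)
    (v := (1 : L) ⊗ₜ[F] v) ?_⟩
  · have hirr : Irreducible (X ^ 3 - Polynomial.C γ) :=
      X_pow_sub_C_irreducible_of_prime Nat.prime_three hγ3
    exact aeval_ne_zero_of_finrank_le_two hirr (natDegree_X_pow_sub_C) hL0 hL c (by simp [hc])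
  · rw [Algebra.TensorProduct.tmul_pow, hv9, one_pow, one_tmul_algebraMap]

omit L in
/-- If `v ^ 3` has degree three and trace zero, and its cube is not in `F`, then a quadratic
extension `L` provides `l`, `m` such that `v ^ 3 = t + m t ^ 2` with `t ^ 3 = l`: for the minimal
polynomial `X ^ 3 + β X + γ`, the element `l` is a root of `X ^ 2 + γ X - β ^ 3 / 27`, and
`m = -β / (3 l)`. -/
theorem exists_brauerSimilar_baseChange_of_cubic {ρ : F} (hρ : IsPrimitiveRoot ρ 9)
    (hC : Module.finrank F C = 81) {g : F} (hg : g ≠ 0) {x v : C} (hx : x ^ 3 = algebraMap F C g)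
    (hvx : v * x = ρ ^ 3 • (x * v)) (hdeg : (minpoly F (v ^ 3)).natDegree = 3)
    (htr : mulTrace F C (v ^ 3) = 0) (hv9 : v ^ 9 ∉ Set.range (algebraMap F C)) :
    ∃ (L : Type u) (_ : Field L) (_ : Algebra F L) (l m : L),
      (Module.finrank F L = 2 ∨ (Module.finrank F L = 1 ∧
        ∀ M : IntermediateField F (AlgebraicClosure F), Module.finrank F M ≠ 2)) ∧
      l ≠ 0 ∧ m ≠ 0 ∧
      (∃ c ≠ 0, BrauerSimilar L
        ((L ⊗[F] C) ⊗[L] SymbolAlgebra 9 (algebraMap F L ρ) (algebraMap F L g)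
          ((-algebraMap F L g) ^ 3 * l⁻¹))
        (SymbolAlgebra 9 (algebraMap F L ρ) c (-(algebraMap F L g * m) ^ 3 * l))) ∧
      ∃ t ∈ Algebra.adjoin L {(1 : L) ⊗ₜ[F] (v ^ 3)}, t ^ 3 = algebraMap L (L ⊗[F] C) l ∧
        (1 : L) ⊗ₜ[F] (v ^ 3) = t + m • t ^ 2 := by
  have h3F : (3 : F) ≠ 0 := by
    have hζ : IsPrimitiveRoot (ρ ^ 3) 3 := hρ.pow (by norm_num) (by norm_num)
    exact_mod_cast hζ.natCast_ne_zero
  have hirr := minpoly.irreducible (IsIntegral.of_finite F (v ^ 3))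
  obtain ⟨β, γ, hmin⟩ := minpoly_eq_reduced_cubic hirr hdeg htr (by
    rw [hC, show ((81 : ℕ) : F) = 3 ^ 4 by norm_num]
    exact pow_ne_zero 4 h3F)
  have haev : aeval (v ^ 3) (X ^ 3 + Polynomial.C β * X + Polynomial.C γ) = 0 := by
    rw [← hmin, minpoly.aeval]
  have hβ : β ≠ 0 := by
    rintro rfl
    refine hv9 ⟨-γ, ?_⟩
    simp only [map_zero, zero_mul, add_zero, map_add, map_pow, aeval_X, aeval_C] at haev
    rw [map_neg, ← eq_neg_of_add_eq_zero_left haev, ← pow_mul]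
  obtain ⟨L, _, _, l, hdegL, hl⟩ := exists_quadratic_extension_root F γ (-(β ^ 3 / 27))
  have hL0 : 0 < Module.finrank F L := by rcases hdegL with h | ⟨h, -⟩ <;> omega
  have hL2 : Module.finrank F L ≤ 2 := by rcases hdegL with h | ⟨h, -⟩ <;> omega
  have h3 : (3 : L) ≠ 0 := by
    have := (_root_.map_ne_zero (algebraMap F L)).2 h3F
    rwa [map_ofNat] at this
  have h27 : (27 : L) ≠ 0 := by
    rw [show (27 : L) = 3 ^ 3 by norm_num]
    exact pow_ne_zero 3 h3
  have hβL : algebraMap F L β ≠ 0 := (_root_.map_ne_zero _).2 hβ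
  have hl0 : l ≠ 0 := by
    rintro rfl
    simp only [map_neg, map_div₀, map_pow, map_ofNat] at hl
    field_simp at hl
    simp [hβ] at hl
  let m : L := -(algebraMap F L β) / (3 * l)
  have hm0 : m ≠ 0 := div_ne_zero (neg_ne_zero.2 hβL) (mul_ne_zero h3 hl0)
  have hβm : algebraMap F L β = -(3 * m * l) := by simp only [m]; field_simp
  have hγm : algebraMap F L γ = -(l + m ^ 3 * l ^ 2) := by
    simp only [map_neg, map_div₀, map_pow, map_ofNat, hβm] at hl
    field_simp at hl
    refine mul_left_cancel₀ (mul_ne_zero h27 hl0) ?_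
    linear_combination hl
  -- the minimal polynomial of `v ^ 3` has no root in `L`
  have hroot (y : L) : y ^ 3 - 3 * m * l * y - (l + m ^ 3 * l ^ 2) ≠ 0 := by
    intro hy
    rw [hmin] at hdeg hirr
    refine aeval_ne_zero_of_finrank_le_two hirr hdeg hL0 hL2 y ?_
    simp only [map_add, map_mul, map_pow, aeval_X, aeval_C, hβm, hγm]
    linear_combination hy
  have hl3 (c : L) : c ^ 3 ≠ l := fun hc =>
    hroot (c + m * c ^ 2) (by rw [← hc]; ring)
  have hk : 1 - m ^ 3 * l ≠ 0 := fun h => hroot (-m⁻¹) (by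
    have h1 : l = (m ^ 3)⁻¹ := by
      refine eq_inv_of_mul_eq_one_right ?_
      linear_combination -h
    rw [h1]
    field_simp
    ring)
  let incl : C →ₐ[F] L ⊗[F] C := Algebra.TensorProduct.includeRight
  obtain ⟨t, htmem, ht3, hvt⟩ := exists_cube_root_of_cubic hk (w := (1 : L) ⊗ₜ[F] (v ^ 3)) (by
    have h1 := congr(incl $haev)
    simp only [map_add, map_mul, map_pow, aeval_X, aeval_C, map_zero, AlgHom.commutes] at h1
    rw [IsScalarTower.algebraMap_apply F L (L ⊗[F] C) β,
      IsScalarTower.algebraMap_apply F L (L ⊗[F] C) γ, hβm, hγm, ← map_pow] at h1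
    rw [map_sub, map_sub, map_pow, map_mul, aeval_X, aeval_C, aeval_C, ← h1]
    simp only [map_neg, neg_mul, incl, Algebra.TensorProduct.includeRight_apply]
    abel)
  have hpow : ((1 : L) ⊗ₜ[F] v) ^ 3 = (1 : L) ⊗ₜ[F] (v ^ 3) := by
    rw [Algebra.TensorProduct.tmul_pow, one_pow]
  refine ⟨L, _, _, l, m, hdegL, hl0, hm0, ?_, t, htmem, ht3, hvt⟩
  refine exists_brauerSimilar_tensor_of_cubic (hρ.map_of_injective (algebraMap F L).injective)
    (by rw [Module.finrank_baseChange, hC]) ((_root_.map_ne_zero _).2 hg) hl0 hm0 hl3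
    (x := (1 : L) ⊗ₜ[F] x) (v := (1 : L) ⊗ₜ[F] v) ?_ ?_ ht3 (by rwa [hpow]) (by rwa [hpow])
  · rw [Algebra.TensorProduct.tmul_pow, hx, one_pow, one_tmul_algebraMap]
  · rw [Algebra.TensorProduct.tmul_mul_tmul, Algebra.TensorProduct.tmul_mul_tmul, hvx,
      TensorProduct.tmul_smul, ← map_pow, algebraMap_smul]

end BaseChange

/-! ### The decomposition of `A` -/

theorem isDomain_of_forall_isUnit {C : Type*} [Ring C] [Nontrivial C]
    (h : ∀ c : C, c ≠ 0 → IsUnit c) : IsDomain C := by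
  have : NoZeroDivisors C := ⟨fun {a b} hab => by
    by_cases ha : a = 0
    · exact Or.inl ha
    · exact Or.inr ((h a ha).mul_right_eq_zero.1 hab)⟩
  exact NoZeroDivisors.to_isDomain C

theorem mainTheorem4 {F : Type u} {E : Type v} {A : Type w} [Field F] [Field E] [Algebra F E]
    [IsGalois F E] [Ring A] [Algebra F A]
    (ρ : F) (hρ : IsPrimitiveRoot ρ 9)
    (hE : Module.finrank F E = 9)
    (σ₁ σ₂ : E ≃ₐ[F] E) (hσ₁ : σ₁ ^ 3 = 1) (hσ₂ : σ₂ ^ 3 = 1) (hσ₁₂ : Commute σ₁ σ₂)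
    (hσ : Subgroup.closure {σ₁, σ₂} = ⊤)
    (t₁ t₂ : E) (f₁ f₂ : F) (hf₁ : f₁ ≠ 0) (hf₂ : f₂ ≠ 0)
    (ht₁ : t₁ ^ 3 = algebraMap F E f₁) (ht₂ : t₂ ^ 3 = algebraMap F E f₂)
    (hσt₁₁ : σ₁ t₁ = t₁) (hσt₂₁ : σ₂ t₁ = algebraMap F E (ρ ^ 3) * t₁)
    (hσt₂₂ : σ₂ t₂ = t₂) (hσt₁₂ : σ₁ t₂ = algebraMap F E (ρ ^ 3) * t₂)
    (b₁ b₂ u : E) (c₀ c₁ c₂ a₀ a₁ a₂ : F) (hc₀ : c₀ ≠ 0) (ha₀ : a₀ ≠ 0)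
    (hb₁ : b₁ = algebraMap F E c₀ + algebraMap F E c₁ * t₁ + algebraMap F E c₂ * t₁ ^ 2)
    (hb₂ : b₂ = algebraMap F E a₀ + algebraMap F E a₁ * t₂ + algebraMap F E a₂ * t₂ ^ 2)
    (_Y : AbelianCrossedProduct F E A σ₁ σ₂ b₁ b₂ u) :
    ∃ (C : Type v) (_ : Ring C) (_ : Algebra F C)
      (X : AbelianCrossedProduct F E C σ₁ σ₂ b₁ (algebraMap F E (-c₀ / a₀) * b₂) u)
      (L : Type u) (_ : Field L) (_ : Algebra F L) (l l₁ l₂ l₃ : L),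
      -- `L` is a quadratic extension of `F`, or `L = F` if `F` has no quadratic extension at all
      (Module.finrank F L = 2 ∨ (Module.finrank F L = 1 ∧
        ∀ M : IntermediateField F (AlgebraicClosure F), Module.finrank F M ≠ 2)) ∧
      l ≠ 0 ∧ l₁ ≠ 0 ∧ l₂ ≠ 0 ∧ l₃ ≠ 0 ∧
      -- `A_L ∼ R ⊗ D⁻¹ ⊗ B⁻¹`
      BrauerSimilar L (L ⊗[F] A)
        ((SymbolAlgebra 9 (algebraMap F L ρ) l₃ (-(algebraMap F L (f₁ * f₂) * l₂ / l₁) ^ 3 * l)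
          ⊗[L] (SymbolAlgebra 9 (algebraMap F L ρ) (algebraMap F L (f₁ * f₂))
              ((-(algebraMap F L (f₁ * f₂) / l₁)) ^ 3 * l⁻¹))ᵐᵒᵖ)
          ⊗[L] (L ⊗[F] SymbolAlgebra 3 (ρ ^ 3) f₁ (-c₀ / a₀))ᵐᵒᵖ) ∧
      -- the generic case: `l, l₁, l₂` are read off from `v ^ 3`, where `v = z₁ + z₂` in `C`
      (¬ BrauerSimilar F (A ⊗[F] (A ⊗[F] A)) F →
        (X.z₁ + X.z₂) ^ 9 ∉ Set.range (algebraMap F C) →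
        ∃ t₃ ∈ Algebra.adjoin L {(1 : L) ⊗ₜ[F] ((X.z₁ + X.z₂) ^ 3)},
          t₃ ^ 3 = algebraMap L (L ⊗[F] C) l ∧
          (1 : L) ⊗ₜ[F] ((X.z₁ + X.z₂) ^ 3) = l₁ • t₃ + l₂ • t₃ ^ 2) := by
  have hζ : IsPrimitiveRoot (ρ ^ 3) 3 := hρ.pow (by norm_num) (by norm_num)
  have hE0 : FiniteDimensional F E := Module.finite_of_finrank_pos (by omega)
  have hg : f₁ * f₂ ≠ 0 := mul_ne_zero hf₁ hf₂
  have hd : -c₀ / a₀ ≠ 0 := div_ne_zero (neg_ne_zero.2 hc₀) ha₀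
  have ht₁0 : t₁ ≠ 0 := by
    rintro rfl
    exact hf₁ ((map_eq_zero (algebraMap F E)).1 (by rw [← ht₁]; norm_num))
  have ht₂0 : t₂ ≠ 0 := by
    rintro rfl
    exact hf₂ ((map_eq_zero (algebraMap F E)).1 (by rw [← ht₂]; norm_num))
  obtain ⟨C, _, _, X, hAC⟩ := _Y.exists_brauerSimilar_tensor_symbolAlgebra hζ ht₁0 ht₂0 hσt₁₁ hσt₂₁
    hσt₂₂ hσt₁₂ hE ht₁ hd
  have := X.nontrivial
  have := X.finiteDimensional hE
  have := X.isSimpleRing hζ ht₁0 ht₂0 hσt₁₁ hσt₂₁ hσt₂₂ hσt₁₂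
  have := X.isCentral hζ ht₁0 ht₂0 hσt₁₁ hσt₂₁ hσt₂₂ hσt₁₂ hσ
  have hC := X.finrank_eq hE
  have := SymbolAlgebra.isSimpleRing hζ hf₁ hd
  have := SymbolAlgebra.isCentral hζ hf₁ hd
  refine ⟨C, inferInstance, inferInstance, X, ?_⟩
  -- it suffices to compare `C_L ⊗ D` with `R`
  suffices h : ∃ (L : Type u) (_ : Field L) (_ : Algebra F L) (l l₁ l₂ l₃ : L),
      (Module.finrank F L = 2 ∨ (Module.finrank F L = 1 ∧
        ∀ M : IntermediateField F (AlgebraicClosure F), Module.finrank F M ≠ 2)) ∧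
      l ≠ 0 ∧ l₁ ≠ 0 ∧ l₂ ≠ 0 ∧ l₃ ≠ 0 ∧
      BrauerSimilar L
        ((L ⊗[F] C) ⊗[L] SymbolAlgebra 9 (algebraMap F L ρ) (algebraMap F L (f₁ * f₂))
          ((-(algebraMap F L (f₁ * f₂) / l₁)) ^ 3 * l⁻¹))
        (SymbolAlgebra 9 (algebraMap F L ρ) l₃
          (-(algebraMap F L (f₁ * f₂) * l₂ / l₁) ^ 3 * l)) ∧
      (¬ BrauerSimilar F (A ⊗[F] (A ⊗[F] A)) F →
        (X.z₁ + X.z₂) ^ 9 ∉ Set.range (algebraMap F C) →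
        ∃ t₃ ∈ Algebra.adjoin L {(1 : L) ⊗ₜ[F] ((X.z₁ + X.z₂) ^ 3)},
          t₃ ^ 3 = algebraMap L (L ⊗[F] C) l ∧
          (1 : L) ⊗ₜ[F] ((X.z₁ + X.z₂) ^ 3) = l₁ • t₃ + l₂ • t₃ ^ 2) by
    obtain ⟨L, _, _, l, l₁, l₂, l₃, hL, hl, hl₁, hl₂, hl₃, hsim, hgen⟩ := h
    refine ⟨L, _, _, l, l₁, l₂, l₃, hL, hl, hl₁, hl₂, hl₃, ?_, hgen⟩
    have hρL : IsPrimitiveRoot (algebraMap F L ρ) 9 :=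
      hρ.map_of_injective (algebraMap F L).injective
    have hgL : algebraMap F L (f₁ * f₂) ≠ 0 := (map_ne_zero _).2 hg
    have hD : (-(algebraMap F L (f₁ * f₂) / l₁)) ^ 3 * l⁻¹ ≠ 0 :=
      mul_ne_zero (pow_ne_zero 3 (neg_ne_zero.2 (div_ne_zero hgL hl₁))) (inv_ne_zero hl)
    have := SymbolAlgebra.isSimpleRing hρL hgL hD
    have := SymbolAlgebra.isCentral hρL hgL hD
    exact .of_tensor_of_baseChange_tensor hAC hsim
  by_cases hdiv : ∀ c : C, c ≠ 0 → IsUnit c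
  · -- `C` is a division algebra
    have := isDomain_of_forall_isUnit hdiv
    have hv0 : X.z₁ + X.z₂ ≠ 0 := X.z₁_add_z₂_ne_zero hσt₁₁ hσt₂₁ hζ ht₁0
    have htr : mulTrace F C ((X.z₁ + X.z₂) ^ 3) = 0 :=
      X.mulTrace_z₁_add_z₂_pow_three hσt₁₁ hσt₂₁ hσt₁₂ hζ ht₁0 (c₁ := c₁) (c₂ := c₂)
        (d₁ := -c₀ / a₀ * a₁) (d₂ := -c₀ / a₀ * a₂) (by
          have h1 : algebraMap F E (-c₀ / a₀) * algebraMap F E a₀ = -algebraMap F E c₀ := by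
            rw [← map_mul, div_mul_cancel₀ _ ha₀, map_neg]
          rw [hb₁, hb₂, map_mul, map_mul]
          linear_combination h1)
    have hvx := X.z₁_add_z₂_skew hσt₁₁ hσt₂₁ hσt₂₂ hσt₁₂
    have hx3 : X.emb (t₁ * t₂) ^ 3 = algebraMap F C (f₁ * f₂) := by
      rw [← map_pow, mul_pow, ht₁, ht₂, ← map_mul, AlgHom.commutes]
    have hx0 : X.emb (t₁ * t₂) ≠ 0 := (map_ne_zero _).2 (mul_ne_zero ht₁0 ht₂0)
    have hv3 : (X.z₁ + X.z₂) ^ 3 ∉ (algebraMap F C).range := by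
      rintro ⟨r, hr⟩
      rw [← hr, mulTrace_algebraMap, hC, mul_eq_zero] at htr
      have h3 : (3 : F) ≠ 0 := by exact_mod_cast hζ.natCast_ne_zero
      have hr0 : r = 0 := htr.resolve_left (by
        rw [show ((81 : ℕ) : F) = 3 ^ 4 by norm_num]
        exact pow_ne_zero 4 h3)
      rw [hr0, map_zero] at hr
      exact hv0 (pow_eq_zero_iff three_ne_zero |>.1 hr.symm)
    by_cases hv9 : (X.z₁ + X.z₂) ^ 9 ∈ Set.range (algebraMap F C)
    · -- `v ^ 9 = γ ∈ F`: with `l = γ`, `l₁ = -f₁ f₂`, `l₂ = 1` the second slots of `D` and `R` become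
      -- `γ⁻¹` and `γ`
      obtain ⟨γ, hγ⟩ := hv9
      obtain ⟨L, _, _, -, hL, -⟩ := exists_quadratic_extension_root F 0 0
      obtain ⟨hγ0, c, hc, hsim⟩ := exists_brauerSimilar_baseChange_of_pow_nine L hρ hC
        (by rcases hL with h | ⟨h, -⟩ <;> omega) (by rcases hL with h | ⟨h, -⟩ <;> omega) hg hγ.symm
        hv3
      have hgL : algebraMap F L (f₁ * f₂) ≠ 0 := (map_ne_zero _).2 hg
      refine ⟨L, _, _, algebraMap F L γ, -algebraMap F L (f₁ * f₂), 1, c, hL, (map_ne_zero _).2 hγ0,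
        neg_ne_zero.2 hgL, one_ne_zero, hc, ?_, fun _ h => absurd ⟨γ, hγ⟩ h⟩
      rw [mul_one, div_neg, div_self hgL, neg_neg, one_pow, one_mul,
        show -(-1 : L) ^ 3 * algebraMap F L γ = algebraMap F L γ by ring]
      exact hsim
    · -- the generic situation, where `l₁ = 1`
      have hdeg := natDegree_minpoly_pow_three (K := F) hC (x := X.emb (t₁ * t₂))
        (v := X.z₁ + X.z₂) (fun h => by
          have h1 : (ρ ^ 3 - 1) • (X.emb (t₁ * t₂) * (X.z₁ + X.z₂)) = 0 := by
            rw [sub_smul, one_smul, ← hvx, h.eq, sub_self]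
          rcases smul_eq_zero.1 h1 with h1 | h1
          · exact hζ.ne_one (by norm_num) (sub_eq_zero.1 h1)
          · exact (mul_ne_zero hx0 hv0) h1)
        (by
          have hxv : X.emb (t₁ * t₂) * (X.z₁ + X.z₂) =
              (ρ ^ 3)⁻¹ • ((X.z₁ + X.z₂) * X.emb (t₁ * t₂)) := by
            rw [hvx, smul_smul, inv_mul_cancel₀ (hζ.ne_zero three_ne_zero), one_smul]
          have h1 := skew_pow hxv 3
          rwa [inv_pow, hζ.pow_eq_one, inv_one, one_smul] at h1) hv3
      obtain ⟨L, _, _, l, m, hL, hl, hm, ⟨c, hc, hsim⟩, t, ht, ht3, hvt⟩ :=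
        exists_brauerSimilar_baseChange_of_cubic hρ hC hg hx3 hvx hdeg htr hv9
      refine ⟨L, _, _, l, 1, m, c, hL, hl, one_ne_zero, hm, hc, ?_, fun _ _ =>
        ⟨t, ht, ht3, by rw [one_smul]; exact hvt⟩⟩
      rw [div_one, div_one]
      exact hsim
  · -- otherwise `C ∼ (a, b)` in degree three, and `l = 1`, `l₁ = -f₁ f₂`, `l₂ = b` turn `D` into the
    -- split algebra `(f₁ f₂, 1)` and the second slot of `R` into `b ^ 3`
    push Not at hdiv
    obtain ⟨c, hc0, hc⟩ := hdiv
    obtain ⟨a, b, ha, hb, hCS⟩ := exists_brauerSimilar_symbolAlgebra_three hC hc0 hc hζ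
    obtain ⟨L, _, _, -, hL, -⟩ := exists_quadratic_extension_root F 0 0
    have hρL : IsPrimitiveRoot (algebraMap F L ρ) 9 :=
      hρ.map_of_injective (algebraMap F L).injective
    have hgL : algebraMap F L (f₁ * f₂) ≠ 0 := (map_ne_zero _).2 hg
    have haL : algebraMap F L a ≠ 0 := (map_ne_zero _).2 ha
    have hbL : algebraMap F L b ≠ 0 := (map_ne_zero _).2 hb
    refine ⟨L, _, _, 1, -algebraMap F L (f₁ * f₂), algebraMap F L b, algebraMap F L a, hL,
      one_ne_zero, neg_ne_zero.2 hgL, hbL, haL, ?_, fun h => absurd ?_ h⟩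
    · rw [div_neg, div_neg, div_self hgL, neg_neg, one_pow, one_mul, inv_one,
        mul_div_cancel_left₀ _ hgL,
        show -(-algebraMap F L b) ^ 3 * 1 = algebraMap F L b ^ 3 by ring]
      obtain ⟨e⟩ := nonempty_algEquiv_baseChange_symbolAlgebra L hζ ha hb
      rw [map_pow] at e
      exact (BrauerSimilar.tensor_split (brauerSimilar_symbolAlgebra_one hρL hgL)).trans
        ((hCS.baseChange L).trans ((BrauerSimilar.of_algEquiv e.symm).trans
          (brauerSimilar_symbolAlgebra_pow_three hρL haL hbL).symm))
    · exact brauerSimilar_tensor_three (hAC.trans hCS)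
        (brauerSimilar_symbolAlgebra_tensor_three hζ hf₁ hd)
        (brauerSimilar_symbolAlgebra_tensor_three hζ ha hb)
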